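/- **Setting.** Let $W\subset\mathbb R^d$ be compact and convex, let $f_1,\dots,f_n:\mathbb R\to\mathbb R$ be convex and differentiable with $L_f$-Lipschitz derivatives, let $X\in\mathbb R^{n\times d}$ have rows $x_i^T$ and $A\in\mathbb R^{m\times d}$ have rows $a_l^T$, and let $g:\mathbb R^m\to\mathbb R\cup\{+\infty\}$ be proper, closed and convex (for instance Lipschitz continuous, or the indicator function of a nonempty closed convex set). Consider $$F^*=\min_{w\in W}F(w),\qquad F(w)=\frac1n\sum_{i=1}^n f_i(x_i^Tw)+g(Aw),$$ and assume that the minimum is attained with a finite value. For $\beta>0$ put $g_\beta(z)=\sup_y\{\langle y,z\rangle-g^*(y)-\tfrac\beta2\|y\|^2\}$, where $g^*$ is the Fenchel conjugate, and $F_\beta(w)=\frac1n\sum_i f_i(x_i^Tw)+g_\beta(Aw)$. In Variant 2 it is assumed that $g(z)=\frac1m\sum_{l=1}^m g_l(z_l)$ with each $g_l:\mathbb R\to\mathbb R\cup\{+\infty\}$ proper, closed and convex, and $g_\beta(z)$ stands for $\frac1m\sum_l g_{\beta,l}(z_l)$ with $g_{\beta,l}=(g_l)_\beta$. **Algorithm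 (H-SAG-CGM).** Let $\beta_0>0$, $w_1\in W$, $\alpha_0\in\mathbb R^n$, $\gamma_0\in\mathbb R^m$, $v_0^f=X^T\alpha_0$, $v_0^g=A^T\gamma_0$. For $k=1,2,\dots$ let $\eta_k=\frac2{k+1}$ and $\beta_k=\frac{\beta_0}{\sqrt{k+1}}$; draw $j$ uniformly from $\{1,\dots,n\}$, independently of the past; let $\alpha_k$ be $\alpha_{k-1}$ with the $j$-th coordinate replaced by $\frac1nf_j'(x_j^Tw_k)$, and $v_k^f=v_{k-1}^f+(\alpha_{k,j}-\alpha_{k-1,j})x_j$; compute $v_k^g$; choose $s_k\in\arg\min_{u\in W}\langle u,v_k^f+v_k^g\rangle$; and let $w_{k+1}=w_k+\eta_k(s_k-w_k)$. * Variant 1: $v_k^g=\frac1{\beta_k}A^T\bigl(Aw_k-\mathrm{prox}_{\beta_kg}(Aw_k)\bigr)$. * Variant 2: draw $l$ uniformly from $\{1,\dots,m\}$, independently of the past, let $\gamma_k$ be $\gamma_{k-1}$ with the $l$-th coordinate replaced by $\frac1m g_{\beta_k,l}'(a_l^Tw_k)$, and $v_k^g=v_{k-1}^g+(\gamma_{k,l}-\gamma_{k-1,l})a_l$.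 Write $\nabla f(Xw)=\bigl(\frac1nf_i'(x_i^Tw)\bigr)_i$ and, in Variant 2, $\nabla g_\beta(Aw)=\bigl(\frac1mg_{\beta,l}'(a_l^Tw)\bigr)_l$. Let $D_W=\max_{u,v\in W}\|u-v\|_2$, $D_1(M)=\max_{u,v\in W}\|M(u-v)\|_1$, $D_\infty(M)=\max_{u,v\in W}\|M(u-v)\|_\infty$, and let $\|M\|$ be the Euclidean operator norm. **Theorem.** For both variants and all $k\ge2$, the random variable $F_{\beta_k}(w_{k+1})-F^*$ is integrable and $$S_{\beta_k}(w_{k+1})=\mathbb E\bigl[F_{\beta_k}(w_{k+1})-F^*\bigr]\le\frac{C_1}{\sqrt k}+\frac{C_2}{k}+\frac{C_3}{k^2}.$$ For Variant 1, $$C_1=\frac{2D_W^2\|A\|^2}{\beta_0},\qquad C_2=8L_fD_1(X)D_\infty(X)+\frac2nL_f\|X\|^2D_W^2,$$ $$C_3=2n^2D_\infty(X)\bigl(\|\nabla f(Xw_1)-\alpha_0\|_1+32L_fD_1(X)\bigr).$$ For Variant 2, $C_2$ is the same and $$C_1=\frac{2D_W^2\|A\|^2+10D_1(A)D_\infty(A)}{\beta_0},$$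 $$C_3=2n^2D_\infty(X)\bigl(\|\nabla f(Xw_1)-\alpha_0\|_1+32L_fD_1(X)\bigr)+2m^2D_\infty(A)\,\|\nabla g_{\beta_0}(Aw_1)-\gamma_0\|_1.$$ -/

import Mathlib

open MeasureTheory ProbabilityTheory
open scoped NNReal ENNReal

noncomputable section

namespace HSagCgm

/-! ### Extended-valued convex functions, conjugates and smoothing -/

/-- A proper, closed (lower semicontinuous) and convex function with values in `ℝ ∪ {+∞}`;
convexity is convexity of the epigraph. Lipschitz continuous convex functions and indicator
functions of nonempty closed convex sets are the main examples. -/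
structure IsProperClosedConvex {V : Type*} [NormedAddCommGroup V] [NormedSpace ℝ V]
    (g : V → EReal) : Prop where
  ne_bot : ∀ z, g z ≠ ⊥
  exists_ne_top : ∃ z, g z ≠ ⊤
  convex_epigraph : Convex ℝ {p : V × ℝ | g p.1 ≤ (p.2 : EReal)}
  lowerSemicontinuous : LowerSemicontinuous g

/-- The Fenchel conjugate `g*(y) = sup_x ⟨x, y⟩ - g(x)`. -/
def fenchelConj {V : Type*} [NormedAddCommGroup V] [InnerProductSpace ℝ V]
    (g : V → EReal) (y : V) : EReal :=
  ⨆ x : V, ((inner ℝ x y : ℝ) : EReal) - g x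

/-- The smooth approximation `g_β(z) = sup_y ⟨y, z⟩ - g*(y) - (β/2)‖y‖²`.
For `β > 0` and `g` proper, closed and convex the supremum is a real number. -/
def smoothed {V : Type*} [NormedAddCommGroup V] [InnerProductSpace ℝ V]
    (g : V → EReal) (β : ℝ) (z : V) : ℝ :=
  (⨆ y : V, ((inner ℝ y z - β / 2 * ‖y‖ ^ 2 : ℝ) : EReal) - fenchelConj g y).toReal

/-- `p = prox_{βg}(z)`, i.e. `p` minimizes `y ↦ β g(y) + ½‖y - z‖²`. -/
def IsProx {V : Type*} [NormedAddCommGroup V] [InnerProductSpace ℝ V]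
    (g : V → EReal) (β : ℝ) (z p : V) : Prop :=
  IsMinOn (fun y => (β : EReal) * g y + ((1 / 2 * ‖y - z‖ ^ 2 : ℝ) : EReal)) Set.univ p

/-! ### Matrices and diameters -/

/-- The matrix-vector product between Euclidean spaces. -/
def mv {p q : ℕ} (M : Matrix (Fin p) (Fin q) ℝ) (w : EuclideanSpace ℝ (Fin q)) :
    EuclideanSpace ℝ (Fin p) :=
  M.toEuclideanLin w

/-- The `i`-th row of a matrix as a Euclidean vector. -/
def row {p q : ℕ} (M : Matrix (Fin p) (Fin q) ℝ) (i : Fin p) : EuclideanSpace ℝ (Fin q) :=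
  WithLp.toLp 2 (M i)

/-- The (Euclidean) operator norm of a matrix. -/
def opNorm {p q : ℕ} (M : Matrix (Fin p) (Fin q) ℝ) : ℝ :=
  ‖LinearMap.toContinuousLinearMap M.toEuclideanLin‖

/-- `D_1(M) = max_{u,v ∈ W} ‖M(u - v)‖_1`. -/
def diamOne {p q : ℕ} (W : Set (EuclideanSpace ℝ (Fin q))) (M : Matrix (Fin p) (Fin q) ℝ) : ℝ :=
  sSup {r | ∃ u ∈ W, ∃ v ∈ W, r = ∑ i, |mv M (u - v) i|}

/-- `D_∞(M) = max_{u,v ∈ W} ‖M(u - v)‖_∞`; the norm on `Fin p → ℝ` is the sup norm. -/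
def diamInf {p q : ℕ} (W : Set (EuclideanSpace ℝ (Fin q))) (M : Matrix (Fin p) (Fin q) ℝ) : ℝ :=
  sSup {r | ∃ u ∈ W, ∃ v ∈ W, r = ‖(fun i => mv M (u - v) i : Fin p → ℝ)‖}

/-! ### The optimization problem -/

/-- The smooth part `(1/n) ∑ f_i(x_i^T w)`; `x_i^T` is the `i`-th row of `X`. -/
def smoothPart {n d : ℕ} (f : Fin n → ℝ → ℝ) (X : Matrix (Fin n) (Fin d) ℝ)
    (w : EuclideanSpace ℝ (Fin d)) : ℝ :=
  1 / (n : ℝ) * ∑ i, f i (mv X w i)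

/-- The objective `F(w) = (1/n) ∑ f_i(x_i^T w) + g(Aw)`, with values in `ℝ ∪ {+∞}`. -/
def objective {n m d : ℕ} (f : Fin n → ℝ → ℝ) (X : Matrix (Fin n) (Fin d) ℝ)
    (g : EuclideanSpace ℝ (Fin m) → EReal) (A : Matrix (Fin m) (Fin d) ℝ)
    (w : EuclideanSpace ℝ (Fin d)) : EReal :=
  (smoothPart f X w : EReal) + g (mv A w)

/-- The separable function `g(z) = (1/m) ∑ g_i(z_i)`. -/
def separable {m : ℕ} (g : Fin m → ℝ → EReal) (z : EuclideanSpace ℝ (Fin m)) : EReal :=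
  ((1 / (m : ℝ) : ℝ) : EReal) * ∑ i, g i (z i)

/-- The smoothed objective `F_β(w) = (1/n) ∑ f_i(x_i^T w) + g_β(Aw)`. -/
def smoothedObjective {n m d : ℕ} (f : Fin n → ℝ → ℝ) (X : Matrix (Fin n) (Fin d) ℝ)
    (g : EuclideanSpace ℝ (Fin m) → EReal) (A : Matrix (Fin m) (Fin d) ℝ) (β : ℝ)
    (w : EuclideanSpace ℝ (Fin d)) : ℝ :=
  smoothPart f X w + smoothed g β (mv A w)

/-- The smoothed objective for separable `g`:
`F_β(w) = (1/n) ∑ f_i(x_i^T w) + (1/m) ∑ g_{β,j}(a_j^T w)`, each `g_j` being smoothed with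
parameter `β`. -/
def smoothedObjectiveSep {n m d : ℕ} (f : Fin n → ℝ → ℝ) (X : Matrix (Fin n) (Fin d) ℝ)
    (g : Fin m → ℝ → EReal) (A : Matrix (Fin m) (Fin d) ℝ) (β : ℝ)
    (w : EuclideanSpace ℝ (Fin d)) : ℝ :=
  smoothPart f X w + 1 / (m : ℝ) * ∑ l, smoothed (g l) β (mv A w l)

/-- `wstar` is a solution of `min_{w ∈ W} F(w)` with finite optimal value. -/
def IsSolution {d : ℕ} (W : Set (EuclideanSpace ℝ (Fin d)))
    (F : EuclideanSpace ℝ (Fin d) → EReal) (wstar : EuclideanSpace ℝ (Fin d)) : Prop :=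
  wstar ∈ W ∧ IsMinOn F W wstar ∧ F wstar ≠ ⊤

/-! ### The algorithm -/

/-- `η_k = 2/(k+1)`. -/
def stepSize (k : ℕ) : ℝ := 2 / ((k : ℝ) + 1)

/-- `β_k = β_0/√(k+1)`. -/
def smoothParam (β₀ : ℝ) (k : ℕ) : ℝ := β₀ / Real.sqrt ((k : ℝ) + 1)

/-- A coordinate of `∇f(Xw)`: `(1/n) f_i'(x_i^T w)`. -/
def gradF {n d : ℕ} (f : Fin n → ℝ → ℝ) (X : Matrix (Fin n) (Fin d) ℝ)
    (w : EuclideanSpace ℝ (Fin d)) (i : Fin n) : ℝ :=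
  1 / (n : ℝ) * deriv (f i) (mv X w i)

/-- A coordinate of `∇g_β(Aw)` for separable `g`: `(1/m) g_{β,l}'(a_l^T w)`. -/
def gradG {m d : ℕ} (g : Fin m → ℝ → EReal) (A : Matrix (Fin m) (Fin d) ℝ) (β : ℝ)
    (w : EuclideanSpace ℝ (Fin d)) (l : Fin m) : ℝ :=
  1 / (m : ℝ) * deriv (smoothed (g l) β) (mv A w l)

/-- `j 1, j 2, …` are uniform samples: `j k` is drawn uniformly, independently of everything
that happened in the iterations before `k` (collected in `ℱ (k - 1)`), and is known at time `k`. -/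
structure IsUniformSampling {Ω : Type*} [mΩ : MeasurableSpace Ω] (μ : Measure Ω)
    (ℱ : Filtration ℕ mΩ) {p : ℕ} (j : ℕ → Ω → Fin p) : Prop where
  measurable : ∀ k, Measurable[ℱ (k + 1)] (j (k + 1))
  uniform : ∀ k i, μ {ω | j (k + 1) ω = i} = (p : ℝ≥0∞)⁻¹
  indep : ∀ k, Indep (MeasurableSpace.comap (j (k + 1)) ⊤) (ℱ k) μ

/-- The part of a run that is common to both variants. The first iteration is `k = 1`, it starts
from `w 1 = w₁`. The estimator `vg` of the gradient of the nonsmooth part is left to the variant.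
The point `s k` may be any point of `argmin_{u ∈ W} ⟨u, v_k⟩`, with any (possibly random)
tie-breaking that does not look into the future. -/
structure IsRun {n d : ℕ} {Ω : Type*} [mΩ : MeasurableSpace Ω] (μ : Measure Ω)
    (ℱ : Filtration ℕ mΩ)
    (W : Set (EuclideanSpace ℝ (Fin d))) (f : Fin n → ℝ → ℝ) (X : Matrix (Fin n) (Fin d) ℝ)
    (w₁ : EuclideanSpace ℝ (Fin d)) (α₀ : Fin n → ℝ)
    (j : ℕ → Ω → Fin n) (α : ℕ → Ω → Fin n → ℝ)
    (vf vg s w : ℕ → Ω → EuclideanSpace ℝ (Fin d)) : Prop where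
  sampling : IsUniformSampling μ ℱ j
  init_w : ∀ ω, w 1 ω = w₁
  init_α : ∀ ω, α 0 ω = α₀
  init_vf : ∀ ω, vf 0 ω = mv X.transpose (WithLp.toLp 2 α₀)
  α_step : ∀ k ω, α (k + 1) ω =
    Function.update (α k ω) (j (k + 1) ω) (gradF f X (w (k + 1) ω) (j (k + 1) ω))
  vf_step : ∀ k ω, vf (k + 1) ω = vf k ω +
    (α (k + 1) ω (j (k + 1) ω) - α k ω (j (k + 1) ω)) • row X (j (k + 1) ω)
  s_measurable : ∀ k, Measurable[ℱ (k + 1)] (s (k + 1))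
  s_mem : ∀ k ω, s (k + 1) ω ∈ W
  s_min : ∀ k ω, IsMinOn (fun u => inner ℝ u (vf (k + 1) ω + vg (k + 1) ω)) W (s (k + 1) ω)
  w_step : ∀ k ω, w (k + 2) ω =
    w (k + 1) ω + stepSize (k + 1) • (s (k + 1) ω - w (k + 1) ω)

/-- Variant 1: `v_k^g = (1/β_k) A^T (A w_k - prox_{β_k g}(A w_k))`. -/
def IsVariantOne {m d : ℕ} {Ω : Type*} (g : EuclideanSpace ℝ (Fin m) → EReal)
    (A : Matrix (Fin m) (Fin d) ℝ) (β₀ : ℝ) (vg w : ℕ → Ω → EuclideanSpace ℝ (Fin d)) : Prop :=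
  ∀ k ω, ∃ p, IsProx g (smoothParam β₀ (k + 1)) (mv A (w (k + 1) ω)) p ∧
    vg (k + 1) ω = (1 / smoothParam β₀ (k + 1)) • mv A.transpose (mv A (w (k + 1) ω) - p)

/-- Variant 2: a second stochastic average gradient estimator `γ`, refreshed in one uniformly
sampled coordinate `l k` per iteration. -/
structure IsVariantTwo {m d : ℕ} {Ω : Type*} [mΩ : MeasurableSpace Ω] (μ : Measure Ω)
    (ℱ : Filtration ℕ mΩ) (g : Fin m → ℝ → EReal)
    (A : Matrix (Fin m) (Fin d) ℝ) (β₀ : ℝ) (γ₀ : Fin m → ℝ)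
    (l : ℕ → Ω → Fin m) (γ : ℕ → Ω → Fin m → ℝ)
    (vg w : ℕ → Ω → EuclideanSpace ℝ (Fin d)) : Prop where
  sampling : IsUniformSampling μ ℱ l
  init_γ : ∀ ω, γ 0 ω = γ₀
  init_vg : ∀ ω, vg 0 ω = mv A.transpose (WithLp.toLp 2 γ₀)
  γ_step : ∀ k ω, γ (k + 1) ω = Function.update (γ k ω) (l (k + 1) ω)
    (gradG g A (smoothParam β₀ (k + 1)) (w (k + 1) ω) (l (k + 1) ω))
  vg_step : ∀ k ω, vg (k + 1) ω = vg k ω +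
    (γ (k + 1) ω (l (k + 1) ω) - γ k ω (l (k + 1) ω)) • row A (l (k + 1) ω)

end HSagCgm

end

namespace HSagCgm

/-! ### Subgradients, proximal points and the smoothed function -/

section Smoothing

variable {V : Type*} [NormedAddCommGroup V] [InnerProductSpace ℝ V] {g : V → EReal}

/-! The argument is a conditional gradient descent estimate with a moving smoothing parameter, in
which the only stochastic inputs are expectations of processes that are reset at uniformly sampled
coordinates.

Smoothing. The gradient `y` of `g_β` at `z` is characterized by `y ∈ ∂g(z - βy)`. Testing the
supremum defining `g_β` with this `y`, and bounding it through the Fenchel inequality at `z - βy`,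
gives `HasSubgradient.smoothed_mem`. Everything else follows from it: convexity and
`1/β`-smoothness, the comparison of two parameters, and the inequality `g_β(z) + ⟨y, u - z⟩ +
(β/2)‖y‖² ≤ g(u)` with its quadratic gain. Lowering the parameter costs a multiple of `‖y‖²`; the
schedule `β₀/√(k+1)` is slow enough for a quarter of the gain to pay for it, so `smoothed_step`
keeps the term `-(3/8)ηβ‖y‖²`. No Lipschitz bound on `g` is used.

Smooth part. The error of `α` in a coordinate is at most a quantity that is `0` after a refresh and
otherwise grows with the movement of the iterates (`stale`). The sample is independent of the past,
so the expected `ℓ₁` error satisfies `n u_{k+1} ≤ (n-1) u_k + c/(k+1)`.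

Variant 1. The nonsmooth gradient is exact, so one step gives a recursion for the expected gap.
Multiplied by `(k+1)(k+2)` it telescopes (`rate_of_recursion`).

Variant 2. A stored coordinate of `γ` was computed with an older, larger parameter. By monotonicity
of the subdifferential, the error caused by this is proportional to `age/(k+1)` times the current
gradient, which may be unbounded as `β` tends to `0`. It is therefore cancelled and not bounded.
First the gradient at the iterate is replaced by the gradient `Y` at the solution, a deterministic
number (`IsVariantTwo.abs_dualG_sub_le`). Then Young's inequality and the reserve `-(3/8)ηβ‖y‖²`
leave a multiple of `(κ² - c²)Y²` with `κ = age/(k+1)` (`mul_sub_sq_le`). Since `E[age²] ≤ 2m²`, a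
weight `c` of order `m/k` makes its expectation nonpositive. The two estimators are handled
separately by linearity, so their samples need not be independent of each other. -/

/-- `y` is a subgradient of `g` at `p`, where `g` takes the real value `c`. -/
structure HasSubgradient (g : V → EReal) (p y : V) (c : ℝ) : Prop where
  value : g p = c
  le : ∀ u, ((c + inner ℝ y (u - p) : ℝ) : EReal) ≤ g u

theorem HasSubgradient.le_of_eq {p y u : V} {c r : ℝ} (h : HasSubgradient g p y c)
    (hu : g u = r) : c + inner ℝ y (u - p) ≤ r := by
  have := h.le u
  rw [hu] at this
  exact_mod_cast this

theorem HasSubgradient.le_fenchelConj {p y : V} {c : ℝ} (h : HasSubgradient g p y c) (y' : V) :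
    ((inner ℝ p y' - c : ℝ) : EReal) ≤ fenchelConj g y' := by
  refine le_iSup_of_le p ?_
  rw [h.value]
  exact_mod_cast le_rfl

theorem HasSubgradient.fenchelConj_eq {p y : V} {c : ℝ} (h : HasSubgradient g p y c) :
    fenchelConj g y = ((inner ℝ p y - c : ℝ) : EReal) := by
  refine le_antisymm (iSup_le fun x => ?_) (h.le_fenchelConj y)
  calc ((inner ℝ x y : ℝ) : EReal) - g x
      ≤ ((inner ℝ x y : ℝ) : EReal) - ((c + inner ℝ y (x - p) : ℝ) : EReal) :=
        EReal.sub_le_sub le_rfl (h.le x)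
    _ = ((inner ℝ p y - c : ℝ) : EReal) := by
        rw [← EReal.coe_sub]
        congr 1
        rw [inner_sub_right, real_inner_comm x y, real_inner_comm p y]
        ring

theorem inner_sub_half_mul_sq_le {β : ℝ} (hβ : 0 < β) (y x : V) :
    inner ℝ y x - β / 2 * ‖y‖ ^ 2 ≤ ‖x‖ ^ 2 / (2 * β) := by
  have h := real_inner_le_norm y x
  have h2 : ‖y‖ * ‖x‖ - β / 2 * ‖y‖ ^ 2 ≤ ‖x‖ ^ 2 / (2 * β) := by
    rw [le_div_iff₀ (by positivity)]
    nlinarith [sq_nonneg (β * ‖y‖ - ‖x‖)]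
  linarith

/-- The lower bound inserts `y` itself into the supremum, where the conjugate is known exactly; the
upper bound uses the Fenchel inequality at `p` and maximizes the remaining quadratic. The two bounds
coincide when `z = p + βy`, and this coincidence produces the calculus rules for the smoothed
function. -/
theorem HasSubgradient.smoothed_mem {p y : V} {c : ℝ} (h : HasSubgradient g p y c) {β : ℝ}
    (hβ : 0 < β) (z : V) :
    c + inner ℝ y (z - p) - β / 2 * ‖y‖ ^ 2 ≤ smoothed g β z ∧
      smoothed g β z ≤ c + ‖z - p‖ ^ 2 / (2 * β) := by
  obtain ⟨S, hS⟩ : ∃ S : EReal, S =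
    ⨆ y : V, ((inner ℝ y z - β / 2 * ‖y‖ ^ 2 : ℝ) : EReal) - fenchelConj g y := ⟨_, rfl⟩
  have h1 : ((c + inner ℝ y (z - p) - β / 2 * ‖y‖ ^ 2 : ℝ) : EReal) ≤ S := by
    rw [hS]
    refine le_iSup_of_le y ?_
    rw [h.fenchelConj_eq, ← EReal.coe_sub]
    apply EReal.coe_le_coe
    rw [inner_sub_right, real_inner_comm p y]
    linarith
  have h2 : S ≤ ((c + ‖z - p‖ ^ 2 / (2 * β) : ℝ) : EReal) := by
    rw [hS]
    refine iSup_le fun y' => ?_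
    refine (EReal.sub_le_sub le_rfl (h.le_fenchelConj y')).trans ?_
    rw [← EReal.coe_sub]
    apply EReal.coe_le_coe
    have := inner_sub_half_mul_sq_le hβ y' (z - p)
    rw [inner_sub_right] at this
    rw [real_inner_comm y' p]
    linarith
  have e : smoothed g β z = S.toReal := by rw [hS]; rfl
  rw [e]
  have hb : S ≠ ⊥ := ne_bot_of_le_ne_bot (EReal.coe_ne_bot _) h1
  have ht : S ≠ ⊤ := ne_top_of_le_ne_top (EReal.coe_ne_top _) h2
  lift S to ℝ using ⟨ht, hb⟩
  exact ⟨by exact_mod_cast h1, by exact_mod_cast h2⟩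

/-- `y` is the gradient of the smoothed function at `z`: it is a subgradient of `g` at `z - βy`. -/
def IsSmoothedGrad (g : V → EReal) (β : ℝ) (z y : V) : Prop :=
  ∃ c, HasSubgradient g (z - β • y) y c

theorem IsSmoothedGrad.lower {β : ℝ} (hβ : 0 < β) {z y : V} (h : IsSmoothedGrad g β z y) (z' : V) :
    smoothed g β z + inner ℝ y (z' - z) ≤ smoothed g β z' := by
  obtain ⟨c, h⟩ := h
  have h1 := (h.smoothed_mem hβ z).2
  have h2 := (h.smoothed_mem hβ z').1
  have e : z' - (z - β • y) = (z' - z) + β • y := by abel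
  have e1 : z - (z - β • y) = β • y := by abel
  rw [e, inner_add_right, inner_smul_right, real_inner_self_eq_norm_sq] at h2
  rw [e1, norm_smul, Real.norm_of_nonneg hβ.le, mul_pow] at h1
  have : β ^ 2 * ‖y‖ ^ 2 / (2 * β) = β / 2 * ‖y‖ ^ 2 := by field_simp
  linarith

theorem IsSmoothedGrad.upper {β : ℝ} (hβ : 0 < β) {z y : V} (h : IsSmoothedGrad g β z y) (z' : V) :
    smoothed g β z' ≤ smoothed g β z + inner ℝ y (z' - z) + ‖z' - z‖ ^ 2 / (2 * β) := by
  obtain ⟨c, h⟩ := h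
  have h1 := (h.smoothed_mem hβ z).1
  have h2 := (h.smoothed_mem hβ z').2
  have e : z' - (z - β • y) = (z' - z) + β • y := by abel
  have e1 : z - (z - β • y) = β • y := by abel
  rw [e, norm_add_sq_real, inner_smul_right, norm_smul, Real.norm_of_nonneg hβ.le, mul_pow,
    real_inner_comm] at h2
  rw [e1, inner_smul_right, real_inner_self_eq_norm_sq] at h1
  have : (‖z' - z‖ ^ 2 + 2 * (β * inner ℝ y (z' - z)) + β ^ 2 * ‖y‖ ^ 2) / (2 * β)
      = ‖z' - z‖ ^ 2 / (2 * β) + inner ℝ y (z' - z) + β / 2 * ‖y‖ ^ 2 := by field_simp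
  linarith

/-- The subgradient inequality is based at `z - βy`, not at `z`; moving the base point creates
`β‖y‖²`, half of which is spent on the gap between `g_β(z)` and `g(z - βy)`. The other half is the
gain that later pays for the decrease of `β` and for stale gradients. -/
theorem IsSmoothedGrad.add_inner_le {β : ℝ} (hβ : 0 < β) {z y : V} (h : IsSmoothedGrad g β z y)
    {u : V} {r : ℝ} (hu : g u = r) :
    smoothed g β z + inner ℝ y (u - z) + β / 2 * ‖y‖ ^ 2 ≤ r := by
  obtain ⟨c, h⟩ := h
  have h1 := (h.smoothed_mem hβ z).2
  have h2 := h.le_of_eq hu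
  have e : u - (z - β • y) = (u - z) + β • y := by abel
  have e1 : z - (z - β • y) = β • y := by abel
  rw [e, inner_add_right, inner_smul_right, real_inner_self_eq_norm_sq] at h2
  rw [e1, norm_smul, Real.norm_of_nonneg hβ.le, mul_pow] at h1
  have : β ^ 2 * ‖y‖ ^ 2 / (2 * β) = β / 2 * ‖y‖ ^ 2 := by field_simp
  linarith

theorem IsSmoothedGrad.smoothed_le_smoothed {β β' : ℝ} (hβ : 0 < β) (hβ' : 0 < β') {z y : V}
    (h : IsSmoothedGrad g β z y) :
    smoothed g β z ≤ smoothed g β' z + (β' - β) / 2 * ‖y‖ ^ 2 := by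
  obtain ⟨c, h⟩ := h
  have h1 := (h.smoothed_mem hβ z).2
  have h2 := (h.smoothed_mem hβ' z).1
  have e1 : z - (z - β • y) = β • y := by abel
  rw [e1, inner_smul_right, real_inner_self_eq_norm_sq] at h2
  rw [e1, norm_smul, Real.norm_of_nonneg hβ.le, mul_pow] at h1
  have : β ^ 2 * ‖y‖ ^ 2 / (2 * β) = β / 2 * ‖y‖ ^ 2 := by field_simp
  linarith

/-- Monotonicity of the subdifferential at `z - βy` and `z' - β'y'`, followed by Cauchy–Schwarz. The
change of parameter is weighted by `‖y‖` alone, so a bound on either gradient suffices, with the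
roles chosen accordingly. -/
theorem IsSmoothedGrad.mul_norm_sub_le {β β' : ℝ} {z z' y y' : V}
    (h : IsSmoothedGrad g β z y) (h' : IsSmoothedGrad g β' z' y') :
    β' * ‖y - y'‖ ≤ ‖z - z'‖ + |β' - β| * ‖y‖ := by
  obtain ⟨c, h⟩ := h
  obtain ⟨c', h'⟩ := h'
  have h1 := h.le_of_eq h'.value
  have h2 := h'.le_of_eq h.value
  have h3 : β' * ‖y - y'‖ ^ 2 ≤ inner ℝ (y - y') ((z - z') + (β' - β) • y) := by
    have e : (z - z') + (β' - β) • y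
        = ((z - β • y) - (z' - β' • y')) + β' • (y - y') := by
      simp only [sub_smul, smul_sub]; abel
    rw [e, inner_add_right, inner_smul_right, real_inner_self_eq_norm_sq, inner_sub_left]
    have e2 : inner ℝ y (z' - β' • y' - (z - β • y)) = - inner ℝ y (z - β • y - (z' - β' • y')) := by
      rw [← inner_neg_right]; congr 1; abel
    linarith
  have h4 := real_inner_le_norm (y - y') ((z - z') + (β' - β) • y)
  have h5 : ‖(z - z') + (β' - β) • y‖ ≤ ‖z - z'‖ + |β' - β| * ‖y‖ := by
    refine (norm_add_le _ _).trans ?_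
    rw [norm_smul, Real.norm_eq_abs]
  rcases (norm_nonneg (y - y')).eq_or_lt with h0 | h0
  · rw [← h0, mul_zero]; positivity
  · refine le_of_mul_le_mul_left ?_ h0
    nlinarith [mul_le_mul_of_nonneg_left h5 h0.le]

/-- The affine minorant and the quadratic majorant touch at `z`, so the linearization error is
`O((x' - z)²)`. -/
theorem IsSmoothedGrad.hasDerivAt {g : ℝ → EReal} {β : ℝ} (hβ : 0 < β) {z y : ℝ}
    (h : IsSmoothedGrad g β z y) : HasDerivAt (smoothed g β) y z := by
  rw [hasDerivAt_iff_isLittleO]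
  have : (fun x' => smoothed g β x' - smoothed g β z - (x' - z) • y) =O[nhds z]
      fun x' => (x' - z) ^ 2 := by
    refine Asymptotics.IsBigO.of_bound (1 / (2 * β)) (Filter.Eventually.of_forall fun x' => ?_)
    have h1 := h.lower hβ x'
    have h2 := h.upper hβ x'
    simp only [Real.norm_eq_abs, sq_abs, smul_eq_mul, abs_pow] at h1 h2 ⊢
    have e : inner ℝ y (x' - z) = (x' - z) * y := rfl
    rw [e] at h1 h2
    rw [abs_of_nonneg (by linarith)]
    have : (x' - z) ^ 2 / (2 * β) = 1 / (2 * β) * (x' - z) ^ 2 := by ring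
    linarith
  refine this.trans_isLittleO ?_
  have := (Asymptotics.isLittleO_pow_id (𝕜 := ℝ) (n := 2) (by norm_num)).comp_tendsto
    (show Filter.Tendsto (fun x' : ℝ => x' - z) (nhds z) (nhds 0) by
      simpa using (continuous_id.sub continuous_const).tendsto (f := fun x' : ℝ => x' - z) z)
  simpa [Function.comp_def] using this

theorem continuous_smoothed {β : ℝ} (hβ : 0 < β) (h : ∀ z, ∃ y, IsSmoothedGrad g β z y) :
    Continuous (smoothed g β) := by
  rw [continuous_iff_continuousAt]
  intro z
  obtain ⟨y, hy⟩ := h z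
  have hl : Continuous fun z' => smoothed g β z + inner ℝ y (z' - z) := by fun_prop
  have hu : Continuous fun z' => smoothed g β z + inner ℝ y (z' - z) + ‖z' - z‖ ^ 2 / (2 * β) := by
    fun_prop
  have tl := hl.tendsto z
  have tu := hu.tendsto z
  simp only [sub_self, inner_zero_right, add_zero, norm_zero, ne_eq, OfNat.ofNat_ne_zero,
    not_false_eq_true, zero_pow, zero_div] at tl tu
  exact tendsto_of_tendsto_of_tendsto_of_le_of_le tl tu (hy.lower hβ) (hy.upper hβ)

/-! ### Existence of proximal points -/

/-- First-order optimality for the proximal problem, phrased over the epigraph so that convexity and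
minimality become statements about real numbers. -/
theorem hasSubgradient_of_isMinOn_epigraph (hg : IsProperClosedConvex g) {β : ℝ} (hβ : 0 < β)
    {z p : V} {c : ℝ} (hp : g p ≤ c)
    (hmin : ∀ (u : V) (r : ℝ), g u ≤ r →
      β * c + 1 / 2 * ‖p - z‖ ^ 2 ≤ β * r + 1 / 2 * ‖u - z‖ ^ 2) :
    HasSubgradient g p ((1 / β) • (z - p)) c := by
  have key : ∀ (u : V) (r : ℝ), g u ≤ r → c + inner ℝ ((1 / β) • (z - p)) (u - p) ≤ r := by
    intro u r hu
    -- Minimality along the segment from `(p, c)` to `(u, r)`, divided by `t`; letting `t` tend to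
    -- `0` leaves the first-order condition.
    have h1 : ∀ t : ℝ, 0 < t → t ≤ 1 →
        0 ≤ (β * (r - c) + inner ℝ (p - z) (u - p)) + t * (1 / 2 * ‖u - p‖ ^ 2) := by
      intro t ht ht1
      have hc := hg.convex_epigraph (x := (p, c)) hp (y := (u, r)) hu
        (sub_nonneg.2 ht1) ht.le (by ring)
      have := hmin _ _ hc
      simp only [Prod.smul_mk, Prod.mk_add_mk, smul_eq_mul] at this
      have e : (1 - t) • p + t • u - z = (p - z) + t • (u - p) := by
        simp only [sub_smul, smul_sub, one_smul]; abel
      rw [e, norm_add_sq_real, inner_smul_right, norm_smul, mul_pow, Real.norm_eq_abs,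
        sq_abs] at this
      refine nonneg_of_mul_nonneg_right (a := t) ?_ ht
      nlinarith
    have h2 : 0 ≤ β * (r - c) + inner ℝ (p - z) (u - p) := by
      by_contra hneg
      push Not at hneg
      set a := β * (r - c) + inner ℝ (p - z) (u - p)
      set b := 1 / 2 * ‖u - p‖ ^ 2
      have hb : 0 ≤ b := by positivity
      have hpos : 0 < min 1 (-a / (2 * (b + 1))) :=
        lt_min one_pos (div_pos (by linarith) (by linarith))
      have := h1 _ hpos (min_le_left _ _)
      have h3 : min 1 (-a / (2 * (b + 1))) * b ≤ -a / (2 * (b + 1)) * (b + 1) := by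
        have := min_le_right 1 (-a / (2 * (b + 1)))
        nlinarith
      have h4 : -a / (2 * (b + 1)) * (b + 1) = -a / 2 := by field_simp
      linarith
    rw [inner_smul_left]
    have e : inner ℝ (p - z) (u - p) = - inner ℝ (z - p) (u - p) := by
      rw [← inner_neg_left]; congr 1; abel
    rw [e] at h2
    simp only [conj_trivial]
    have : 1 / β * inner ℝ (z - p) (u - p) ≤ r - c := by
      rw [one_div, inv_mul_le_iff₀ hβ]; linarith
    linarith
  have hpb := hg.ne_bot p
  have hpt : g p ≠ ⊤ := ne_top_of_le_ne_top (EReal.coe_ne_top _) hp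
  refine ⟨?_, fun u => ?_⟩
  · lift g p to ℝ using ⟨hpt, hpb⟩ with x hx
    have := key p x hx.symm.le
    simp only [sub_self, inner_zero_right, add_zero] at this
    exact le_antisymm hp (by exact_mod_cast this)
  · rcases eq_or_ne (g u) ⊤ with hu | hu
    · rw [hu]; exact le_top
    · lift g u to ℝ using ⟨hu, hg.ne_bot u⟩ with x hx
      exact_mod_cast key u x hx.symm.le

theorem IsProx.isSmoothedGrad (hg : IsProperClosedConvex g) {β : ℝ} (hβ : 0 < β) {z p : V}
    (h : IsProx g β z p) : IsSmoothedGrad g β z ((1 / β) • (z - p)) := by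
  have hmin : ∀ u : V, (β : EReal) * g p + ((1 / 2 * ‖p - z‖ ^ 2 : ℝ) : EReal)
      ≤ (β : EReal) * g u + ((1 / 2 * ‖u - z‖ ^ 2 : ℝ) : EReal) := fun u => h (Set.mem_univ u)
  have hpt : g p ≠ ⊤ := by
    intro hp
    obtain ⟨u, hu⟩ := hg.exists_ne_top
    have := hmin u
    lift g u to ℝ using ⟨hu, hg.ne_bot u⟩ with x hx
    rw [hp, EReal.coe_mul_top_of_pos hβ, EReal.top_add_coe, ← EReal.coe_mul, ← EReal.coe_add,
      top_le_iff] at this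
    exact EReal.coe_ne_top _ this
  obtain ⟨c, hc⟩ : ∃ c : ℝ, g p = c := by
    lift g p to ℝ using ⟨hpt, hg.ne_bot p⟩ with x hx
    exact ⟨x, rfl⟩
  refine ⟨c, ?_⟩
  have e : z - β • (1 / β) • (z - p) = p := by
    rw [smul_smul, mul_one_div_cancel hβ.ne', one_smul]; abel
  rw [e]
  refine hasSubgradient_of_isMinOn_epigraph hg hβ hc.le fun u r hu => ?_
  have h1 := hmin u
  rw [hc] at h1
  have h2 : (β : EReal) * g u ≤ (β : EReal) * (r : EReal) :=
    mul_le_mul_of_nonneg_left hu (by exact_mod_cast hβ.le)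
  have h3 := h1.trans (add_le_add_left h2 _)
  exact_mod_cast h3

/-- A proper closed convex function is bounded below by a function of linear growth. -/
theorem IsProperClosedConvex.exists_linear_lower_bound [FiniteDimensional ℝ V]
    (hg : IsProperClosedConvex g) :
    ∃ (x₀ : V) (C : ℝ), 0 ≤ C ∧ ∀ (x : V) (r : ℝ), g x ≤ r → -C * (1 + ‖x - x₀‖) ≤ r := by
  have : ProperSpace V := FiniteDimensional.proper ℝ V
  obtain ⟨x₀, hx₀⟩ := hg.exists_ne_top
  obtain ⟨q, -, hq⟩ := LowerSemicontinuousOn.exists_isMinOn (f := g)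
    (s := Metric.closedBall x₀ 1) ⟨x₀, by simp⟩ (isCompact_closedBall _ _)
    (hg.lowerSemicontinuous.lowerSemicontinuousOn _)
  obtain ⟨c₀, hc₀⟩ : ∃ c : ℝ, g x₀ = c := by
    lift g x₀ to ℝ using ⟨hx₀, hg.ne_bot x₀⟩ with x hx
    exact ⟨x, rfl⟩
  obtain ⟨M, hM⟩ : ∃ M : ℝ, g q = M := by
    have : g q ≤ g x₀ := hq (by simp)
    have ht : g q ≠ ⊤ := ne_top_of_le_ne_top hx₀ this
    lift g q to ℝ using ⟨ht, hg.ne_bot q⟩ with x hx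
    exact ⟨x, rfl⟩
  have hball : ∀ (x : V) (r : ℝ), ‖x - x₀‖ ≤ 1 → g x ≤ r → M ≤ r := by
    intro x r hx hr
    have h1 : g q ≤ g x := hq (by simpa [dist_eq_norm] using hx)
    rw [hM] at h1
    exact_mod_cast h1.trans hr
  refine ⟨x₀, |M| + |c₀|, by positivity, fun x r hr => ?_⟩
  have hM' := neg_abs_le M
  have hc' := le_abs_self c₀
  have hM0 := abs_nonneg M
  have hc0 := abs_nonneg c₀
  have hn := norm_nonneg (x - x₀)
  rcases le_or_gt ‖x - x₀‖ 1 with hx | hx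
  · have := hball x r hx hr
    nlinarith
  -- Outside the ball, convexity is used at the point of the unit sphere on the segment from `x₀` to
  -- `x`, where `M` bounds the function from below.
  · set ρ := ‖x - x₀‖ with hρ
    have hρ0 : 0 < ρ := by linarith
    have ht1 : 1 / ρ ≤ 1 := by rw [div_le_one hρ0]; exact hx.le
    have hc : g ((1 - 1 / ρ) • x₀ + (1 / ρ) • x) ≤ (((1 - 1 / ρ) * c₀ + 1 / ρ * r : ℝ) : EReal) :=
      hg.convex_epigraph (x := (x₀, c₀)) hc₀.le (y := (x, r)) hr
        (sub_nonneg.2 ht1) (b := 1 / ρ) (by positivity) (by ring)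
    have e : (1 - 1 / ρ) • x₀ + (1 / ρ) • x - x₀ = (1 / ρ) • (x - x₀) := by
      simp only [sub_smul, smul_sub, one_smul]; abel
    have := hball _ _ (by
      rw [e, norm_smul, Real.norm_of_nonneg (by positivity), ← hρ, one_div_mul_cancel hρ0.ne'])
      hc
    have h2 : ρ * M ≤ (ρ - 1) * c₀ + r := by
      have := mul_le_mul_of_nonneg_left this hρ0.le
      have e2 : ρ * ((1 - 1 / ρ) * c₀ + 1 / ρ * r) = (ρ - 1) * c₀ + r := by field_simp
      linarith
    nlinarith [mul_le_mul_of_nonneg_left hM' hρ0.le, mul_le_mul_of_nonneg_left hc'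
      (by linarith : 0 ≤ ρ - 1)]

theorem IsProperClosedConvex.exists_isSmoothedGrad [FiniteDimensional ℝ V]
    (hg : IsProperClosedConvex g) {β : ℝ} (hβ : 0 < β) (z : V) :
    ∃ y, IsSmoothedGrad g β z y := by
  have : ProperSpace V := FiniteDimensional.proper ℝ V
  obtain ⟨x₀, C, hC, hlow⟩ := hg.exists_linear_lower_bound
  obtain ⟨x₁, hx₁⟩ := hg.exists_ne_top
  obtain ⟨c₁, hc₁⟩ : ∃ c : ℝ, g x₁ = c := by
    lift g x₁ to ℝ using ⟨hx₁, hg.ne_bot x₁⟩ with x hx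
    exact ⟨x, rfl⟩
  let φ : V × ℝ → ℝ := fun q => β * q.2 + 1 / 2 * ‖q.1 - z‖ ^ 2
  have hφ : Continuous φ := by fun_prop
  set B := φ (x₁, c₁) with hB
  -- The proximal objective is continuous on the epigraph, and it is coercive there because the
  -- quadratic dominates the linear lower bound. A minimizer over this compact sublevel set is a
  -- global one.
  let K : Set (V × ℝ) := {q | g q.1 ≤ (q.2 : EReal)} ∩ {q | φ q ≤ B}
  have hclosed : IsClosed {q : V × ℝ | g q.1 ≤ (q.2 : EReal)} := by
    have h1 := hg.lowerSemicontinuous.isClosed_epigraph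
    have : Continuous fun q : V × ℝ => (q.1, (q.2 : EReal)) :=
      continuous_fst.prodMk (continuous_coe_real_ereal.comp continuous_snd)
    exact h1.preimage this
  have hKclosed : IsClosed K := hclosed.inter (isClosed_le hφ continuous_const)
  have hKne : K.Nonempty := ⟨(x₁, c₁), hc₁.le, le_refl B⟩
  have hKbdd : Bornology.IsBounded K := by
    set a := ‖z - x₀‖
    have ha : 0 ≤ a := norm_nonneg _
    set R := 2 * β * C + 1 + |B| + β * C * (1 + a)
    have hR : 0 ≤ R := by positivity
    have hnorm : ∀ q ∈ K, ‖q.1 - z‖ ≤ 2 * R ∧ |q.2| ≤ C * (1 + (2 * R + a)) + |B| / β := by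
      rintro ⟨x, r⟩ ⟨hx, hxB⟩
      have h1 := hlow x r hx
      have h2 : β * r + 1 / 2 * ‖x - z‖ ^ 2 ≤ B := hxB
      have h3 : ‖x - x₀‖ ≤ ‖x - z‖ + a := norm_sub_le_norm_sub_add_norm_sub x z x₀
      set ρ := ‖x - z‖
      have hρ : 0 ≤ ρ := norm_nonneg _
      have h4 : -C * (1 + (ρ + a)) ≤ r := by nlinarith
      have hB' := le_abs_self B
      have hBn := abs_nonneg B
      have h5 : 1 / 2 * ρ ^ 2 ≤ |B| + β * C * (1 + a) + β * C * ρ := by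
        nlinarith [mul_le_mul_of_nonneg_left h4 hβ.le]
      have hρR : ρ ≤ 2 * R := by
        by_contra hlt
        push Not at hlt
        have hbC : 0 ≤ β * C := by positivity
        have hbCa : 0 ≤ β * C * (1 + a) := by positivity
        have hR1 : 1 ≤ R := by
          change 1 ≤ 2 * β * C + 1 + |B| + β * C * (1 + a); nlinarith
        have : 1 / 2 * ρ ^ 2 > R * ρ := by nlinarith
        have h6 : R * ρ = (2 * (β * C) + 1 + |B| + β * C * (1 + a)) * ρ := by
          change (2 * β * C + 1 + |B| + β * C * (1 + a)) * ρ = _; ring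
        nlinarith
      refine ⟨hρR, abs_le.2 ⟨?_, ?_⟩⟩
      · have : 0 ≤ |B| / β := by positivity
        change _ ≤ r
        nlinarith [mul_le_mul_of_nonneg_left hρR hC]
      · change r ≤ _
        have h7 : r ≤ |B| / β := by
          rw [le_div_iff₀ hβ]; nlinarith [sq_nonneg ρ]
        have : 0 ≤ C * (1 + (2 * R + a)) := by positivity
        linarith
    refine (Metric.isBounded_closedBall (x := (z, (0 : ℝ)))
      (r := max (2 * R) (C * (1 + (2 * R + a)) + |B| / β))).subset fun q hq => ?_
    obtain ⟨h1, h2⟩ := hnorm q hq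
    rw [Metric.mem_closedBall, Prod.dist_eq, dist_eq_norm, dist_eq_norm, sub_zero]
    exact max_le_max h1 h2
  obtain ⟨⟨p, c⟩, hpK, hmin⟩ := (Metric.isCompact_of_isClosed_isBounded hKclosed hKbdd).exists_isMinOn
    hKne hφ.continuousOn
  refine ⟨(1 / β) • (z - p), c, ?_⟩
  have e : z - β • (1 / β) • (z - p) = p := by
    rw [smul_smul, mul_one_div_cancel hβ.ne', one_smul]; abel
  rw [e]
  refine hasSubgradient_of_isMinOn_epigraph hg hβ hpK.1 fun u r hu => ?_
  change φ (p, c) ≤ φ (u, r)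
  rcases le_or_gt (φ (u, r)) B with h | h
  · exact hmin ⟨hu, h⟩
  · exact le_trans hpK.2 h.le

end Smoothing

/-! ### Convex functions with Lipschitz derivative -/

theorem tangent_le_of_convexOn {f : ℝ → ℝ} (hf : ConvexOn ℝ Set.univ f) (hd : Differentiable ℝ f)
    (x y : ℝ) : f x + deriv f x * (y - x) ≤ f y := by
  rcases lt_trichotomy x y with h | h | h
  · have := hf.deriv_le_slope (Set.mem_univ x) (Set.mem_univ y) h (hd x)
    rw [slope_def_field, le_div_iff₀ (sub_pos.2 h)] at this
    linarith
  · simp [h]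
  · have := hf.slope_le_deriv (Set.mem_univ y) (Set.mem_univ x) h (hd x)
    rw [slope_def_field, div_le_iff₀ (sub_pos.2 h)] at this
    nlinarith

/-- The function `L/2 t² - f t` has a monotone derivative, hence is convex, and the claim is its
tangent inequality. -/
theorem le_tangent_add_sq_of_lipschitzWith_deriv {f : ℝ → ℝ} {L : ℝ≥0} (hd : Differentiable ℝ f)
    (hL : LipschitzWith L (deriv f)) (x y : ℝ) :
    f y ≤ f x + deriv f x * (y - x) + L / 2 * (y - x) ^ 2 := by
  have hder : ∀ t, HasDerivAt (fun t => L / 2 * t ^ 2 - f t) (L * t - deriv f t) t := by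
    intro t
    exact (((hasDerivAt_pow 2 t).const_mul ((L : ℝ) / 2)).sub (hd t).hasDerivAt).congr_deriv
      (by push_cast; ring)
  have hdiff : Differentiable ℝ fun t => (L : ℝ) / 2 * t ^ 2 - f t :=
    fun t => (hder t).differentiableAt
  have hmono : Monotone (deriv fun t => (L : ℝ) / 2 * t ^ 2 - f t) := by
    intro a b hab
    rw [(hder a).deriv, (hder b).deriv]
    have := hL.dist_le_mul b a
    rw [Real.dist_eq, Real.dist_eq, abs_of_nonneg (sub_nonneg.2 hab)] at this
    have := (le_abs_self _).trans this
    linarith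
  have := tangent_le_of_convexOn (hmono.convexOn_univ_of_deriv hdiff) hdiff x y
  rw [(hder x).deriv] at this
  nlinarith

/-! ### Deterministic recursions -/

section Sequences

open Finset

theorem sum_add_mul_le {a : ℝ} {u i : ℕ → ℝ} (h : ∀ k, a * u (k + 1) ≤ (a - 1) * u k + i k)
    (K : ℕ) : ∑ k ∈ range K, u (k + 1) + (a - 1) * u K ≤ (a - 1) * u 0 + ∑ k ∈ range K, i k := by
  induction K with
  | zero => simp
  | succ K ih =>
    rw [sum_range_succ, sum_range_succ]
    have := h K
    linarith

theorem weighted_sum_add_mul_le {a : ℝ} {u i : ℕ → ℝ}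
    (h : ∀ k, a * u (k + 1) ≤ (a - 1) * u k + i k) (K : ℕ) :
    ∑ k ∈ range K, ((k : ℝ) + 1) * u (k + 1) + (a - 1) * K * u K
      ≤ ∑ k ∈ range K, ((k : ℝ) + 1) * i k + (a - 1) * ∑ k ∈ range K, u k := by
  induction K with
  | zero => simp
  | succ K ih =>
    rw [sum_range_succ, sum_range_succ, sum_range_succ]
    have := mul_le_mul_of_nonneg_left (h K) (by positivity : (0 : ℝ) ≤ K + 1)
    push_cast
    linarith

/-- Weighting the recursion by `k + 1` makes `k u_k` telescope up to an unweighted sum, which the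
unweighted telescoping controls. A forcing of order `1/k` thus contributes linearly in `K`, and the
initial error only a constant. -/
theorem weighted_sum_le {a : ℝ} (ha : 1 ≤ a) {u i : ℕ → ℝ} (hu : ∀ k, 0 ≤ u k)
    (h : ∀ k, a * u (k + 1) ≤ (a - 1) * u k + i k) (K : ℕ) :
    ∑ k ∈ range K, ((k : ℝ) + 1) * u (k + 1)
      ≤ ∑ k ∈ range K, ((k : ℝ) + 1) * i k + (a - 1) * (a * u 0 + ∑ k ∈ range K, i k) := by
  have h1 := sum_add_mul_le h K
  have h2 := weighted_sum_add_mul_le h K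
  have h3 : ∑ k ∈ range K, u k ≤ u 0 + ∑ k ∈ range K, u (k + 1) := by
    have e := sum_range_succ' u K
    rw [sum_range_succ] at e
    linarith [hu K]
  have ha' : 0 ≤ a - 1 := by linarith
  have h4 : 0 ≤ (a - 1) * K * u K := mul_nonneg (mul_nonneg ha' (by positivity)) (hu K)
  have h5 : 0 ≤ (a - 1) * u K := mul_nonneg ha' (hu K)
  have h6 := mul_le_mul_of_nonneg_left
    (by linarith : ∑ k ∈ range K, u k ≤ a * u 0 + ∑ k ∈ range K, i k) ha'
  linarith

theorem sqrt_succ_sub_sqrt_le {k : ℝ} (hk : 0 < k) : √(k + 1) - √k ≤ 1 / (2 * √k) := by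
  have h0 := Real.sqrt_pos.2 hk
  have h1 := Real.sq_sqrt hk.le
  have h2 := Real.sq_sqrt (by linarith : 0 ≤ k + 1)
  rw [le_div_iff₀ (by positivity)]
  nlinarith [sq_nonneg (√(k + 1) - √k)]

theorem one_div_two_sqrt_le {k : ℝ} (hk : 0 ≤ k) : 1 / (2 * √(k + 1)) ≤ √(k + 1) - √k := by
  have h0 := Real.sqrt_pos.2 (by linarith : 0 < k + 1)
  have h1 := Real.sq_sqrt hk
  have h2 := Real.sq_sqrt (by linarith : 0 ≤ k + 1)
  rw [div_le_iff₀ (by positivity)]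
  nlinarith [sq_nonneg (√(k + 1) - √k)]

theorem sum_one_div_le (K : ℕ) : ∑ k ∈ range K, 1 / ((k : ℝ) + 1) ≤ 2 * √K := by
  induction K with
  | zero => simp
  | succ K ih =>
    rw [sum_range_succ]
    push_cast
    have h1 := one_div_two_sqrt_le (Nat.cast_nonneg (α := ℝ) K)
    have h2 : 1 / ((K : ℝ) + 1) ≤ 1 / √((K : ℝ) + 1) := by
      have : (1 : ℝ) ≤ √((K : ℝ) + 1) := Real.one_le_sqrt.2 (by linarith [Nat.cast_nonneg (α := ℝ) K])
      have h3 := Real.sq_sqrt (by positivity : (0 : ℝ) ≤ (K : ℝ) + 1)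
      apply one_div_le_one_div_of_le (by positivity)
      nlinarith
    have h3 : 1 / (2 * √((K : ℝ) + 1)) = 1 / √((K : ℝ) + 1) / 2 := by
      rw [div_div, mul_comm]
    linarith

/-- The form `√K (K + 1)` is chosen so that division by `K (K + 1)` gives exactly `2/3 / √K`. -/
theorem sum_sqrt_le (K : ℕ) :
    ∑ k ∈ range K, √((k : ℝ) + 1) ≤ 2 / 3 * (√K * ((K : ℝ) + 1)) := by
  induction K with
  | zero => simp
  | succ K ih =>
    rw [sum_range_succ]
    push_cast
    have hK := Nat.cast_nonneg (α := ℝ) K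
    have h1 := Real.sq_sqrt hK
    have h2 := Real.sq_sqrt (by positivity : (0 : ℝ) ≤ (K : ℝ) + 1)
    have h3 := Real.sqrt_nonneg (K : ℝ)
    have h4 := Real.sqrt_nonneg ((K : ℝ) + 1)
    have h5 : √(K : ℝ) * √((K : ℝ) + 1) ≤ K + 1 / 2 := by nlinarith [sq_nonneg (√((K : ℝ) + 1) - √K)]
    nlinarith

/-- A recursion with decay rate `1 - 1/a` and forcing `I/√k`. -/
theorem le_of_sqrt_forcing {a I e : ℝ} (ha : 1 ≤ a) (hI : 0 ≤ I) {r : ℕ → ℝ} (h0 : r 0 ≤ e)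
    (h : ∀ k : ℕ, a * r (k + 1) ≤ (a - 1) * r k + a * (I / √((k : ℝ) + 1))) (k : ℕ) :
    r (k + 1) ≤ (1 - 1 / a) ^ (k + 1) * e + 2 * a * I / √((k : ℝ) + 1) := by
  have ha0 : 0 < a := by linarith
  have hρ : 1 - 1 / a = (a - 1) / a := by field_simp
  have step : ∀ (k : ℕ) (B : ℝ), r k ≤ (1 - 1 / a) ^ k * e + B →
      r (k + 1) ≤ (1 - 1 / a) ^ (k + 1) * e + ((a - 1) / a * B + I / √((k : ℝ) + 1)) := by
    intro k B hB
    have h1 := h k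
    have h2 := mul_le_mul_of_nonneg_left hB (by linarith : 0 ≤ a - 1)
    refine le_of_mul_le_mul_left ?_ ha0
    have h3 : a * ((1 - 1 / a) ^ (k + 1) * e + ((a - 1) / a * B + I / √((k : ℝ) + 1)))
        = (a - 1) * ((1 - 1 / a) ^ k * e + B) + a * (I / √((k : ℝ) + 1)) := by
      rw [pow_succ, hρ]; field_simp; ring
    linarith
  -- Adding up the forcing without using the damping. This is sharp enough as long as `k ≤ a`, where
  -- `√k ≤ a/√k`.
  have first : ∀ k : ℕ, r k ≤ (1 - 1 / a) ^ k * e + 2 * I * √(k : ℝ) := by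
    intro k
    induction k with
    | zero => simpa using h0
    | succ k ih =>
      refine (step k _ ih).trans ?_
      have h1 : (a - 1) / a * (2 * I * √(k : ℝ)) ≤ 2 * I * √(k : ℝ) := by
        apply mul_le_of_le_one_left (by positivity)
        rw [div_le_one ha0]; linarith
      have h2 := one_div_two_sqrt_le (Nat.cast_nonneg (α := ℝ) k)
      have h3 : I / √((k : ℝ) + 1) = 2 * I * (1 / (2 * √((k : ℝ) + 1))) := by
        field_simp
      have h4 := mul_le_mul_of_nonneg_left h2 (by positivity : 0 ≤ 2 * I)
      push_cast
      linarith
  induction k with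
  | zero =>
    have := first 1
    simp only [Nat.cast_one, Real.sqrt_one, mul_one] at this
    simp only [zero_add, Nat.cast_zero, Real.sqrt_one, div_one]
    nlinarith
  | succ k ih =>
    have hk0 : (0 : ℝ) ≤ k := Nat.cast_nonneg k
    rcases le_or_gt ((k : ℝ) + 2) a with hle | hgt
    · refine (first (k + 2)).trans ?_
      have hs : 0 < √((k : ℝ) + 2) := Real.sqrt_pos.2 (by linarith)
      have h2 := Real.sq_sqrt (by linarith : 0 ≤ (k : ℝ) + 2)
      have e1 : (((k + 2 : ℕ) : ℝ)) = (k : ℝ) + 2 := by push_cast; ring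
      have e2 : (((k + 1 : ℕ) : ℝ)) + 1 = (k : ℝ) + 2 := by push_cast; ring
      rw [e1, e2]
      have : 2 * I * √((k : ℝ) + 2) ≤ 2 * a * I / √((k : ℝ) + 2) := by
        rw [le_div_iff₀ hs]
        nlinarith
      linarith
    · refine (step (k + 1) _ ih).trans ?_
      have e2 : (((k + 1 : ℕ) : ℝ)) + 1 = (k : ℝ) + 2 := by push_cast; ring
      rw [e2]
      have hs1 : 0 < √((k : ℝ) + 1) := Real.sqrt_pos.2 (by linarith)
      have hs2 : 0 < √((k : ℝ) + 2) := Real.sqrt_pos.2 (by linarith)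
      have h1 := Real.sq_sqrt (by linarith : 0 ≤ (k : ℝ) + 1)
      have h2 := Real.sq_sqrt (by linarith : 0 ≤ (k : ℝ) + 2)
      have h3 : √((k : ℝ) + 2) ≤ √((k : ℝ) + 1) + 1 / (2 * √((k : ℝ) + 1)) := by
        have := sqrt_succ_sub_sqrt_le (by linarith : 0 < (k : ℝ) + 1)
        rw [show (k : ℝ) + 1 + 1 = k + 2 by ring] at this
        linarith
      have h4 : √((k : ℝ) + 2) / √((k : ℝ) + 1) ≤ 1 + 1 / (2 * ((k : ℝ) + 1)) := by
        rw [div_le_iff₀ hs1]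
        have : (1 + 1 / (2 * ((k : ℝ) + 1))) * √((k : ℝ) + 1)
            = √((k : ℝ) + 1) + 1 / (2 * √((k : ℝ) + 1)) := by
          nth_rewrite 1 [← h1]
          field_simp
        linarith
      -- Once `k + 1 ≥ a - 1`, the damping factor `1 - 1/a` outweighs the decay of `1/√k` over one
      -- step, and the bound reproduces itself.
      have h5 : (a - 1) * (2 * (√((k : ℝ) + 2) / √((k : ℝ) + 1))) ≤ 2 * a - 1 := by
        have h6 : (a - 1) * (1 / ((k : ℝ) + 1)) ≤ 1 := by
          rw [mul_one_div, div_le_one (by positivity)]; linarith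
        have h7 : 1 / (2 * ((k : ℝ) + 1)) = 1 / ((k : ℝ) + 1) / 2 := by
          rw [div_div, mul_comm]
        rw [h7] at h4
        have := mul_le_mul_of_nonneg_left h4 (by linarith : 0 ≤ a - 1)
        linarith
      have h6 : (a - 1) / a * (2 * a * I / √((k : ℝ) + 1)) + I / √((k : ℝ) + 2)
          = I / √((k : ℝ) + 2) * ((a - 1) * (2 * (√((k : ℝ) + 2) / √((k : ℝ) + 1))) + 1) := by
        field_simp
      have h7 : I / √((k : ℝ) + 2) * ((a - 1) * (2 * (√((k : ℝ) + 2) / √((k : ℝ) + 1))) + 1)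
          ≤ I / √((k : ℝ) + 2) * (2 * a) :=
        mul_le_mul_of_nonneg_left (by linarith) (by positivity)
      have h8 : I / √((k : ℝ) + 2) * (2 * a) = 2 * a * I / √((k : ℝ) + 2) := by ring
      linarith

end Sequences

/-! ### Quantities that are reset at randomly sampled coordinates -/

section Stale

variable {Ω : Type*} {p : ℕ} {j : ℕ → Ω → Fin p} {r₀ : Fin p → ℝ} {inc : ℕ → Ω → Fin p → ℝ}

/-- Coordinates that accumulate the increments `inc` and are reset to `0` when sampled. -/
def stale (j : ℕ → Ω → Fin p) (r₀ : Fin p → ℝ) (inc : ℕ → Ω → Fin p → ℝ) :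
    ℕ → Ω → Fin p → ℝ
  | 0 => fun _ => r₀
  | k + 1 => fun ω i => if j (k + 1) ω = i then 0 else stale j r₀ inc k ω i + inc k ω i

theorem stale_succ (r₀ : Fin p → ℝ) (inc : ℕ → Ω → Fin p → ℝ) (k : ℕ) (ω : Ω) (i : Fin p) :
    stale j r₀ inc (k + 1) ω i
      = if j (k + 1) ω = i then 0 else stale j r₀ inc k ω i + inc k ω i := rfl

theorem stale_nonneg (h₀ : ∀ i, 0 ≤ r₀ i) (hinc : ∀ k ω i, 0 ≤ inc k ω i) (k : ℕ) (ω : Ω)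
    (i : Fin p) : 0 ≤ stale j r₀ inc k ω i := by
  induction k with
  | zero => exact h₀ i
  | succ k ih =>
    rw [stale_succ]
    split_ifs
    · exact le_rfl
    · exact add_nonneg ih (hinc k ω i)

theorem stale_bounded {C : ℕ → ℝ} (hC : ∀ k ω i, |inc k ω i| ≤ C k) (i : Fin p) (k : ℕ) :
    ∃ B, ∀ ω, |stale j r₀ inc k ω i| ≤ B := by
  induction k with
  | zero => exact ⟨|r₀ i|, fun ω => le_rfl⟩
  | succ k ih =>
    obtain ⟨B, hB⟩ := ih
    refine ⟨B + C k, fun ω => ?_⟩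
    have hb := hB ω
    have hc := hC k ω i
    rw [stale_succ]
    split_ifs
    · simpa using add_nonneg ((abs_nonneg _).trans hb) ((abs_nonneg _).trans hc)
    · exact (abs_add_le _ _).trans (add_le_add hb hc)

/-- The number of iterations since the last refresh of a coordinate. -/
def age (j : ℕ → Ω → Fin p) : ℕ → Ω → Fin p → ℕ
  | 0 => fun _ _ => 0
  | k + 1 => fun ω i => if j (k + 1) ω = i then 0 else age j k ω i + 1

theorem age_succ (k : ℕ) (ω : Ω) (i : Fin p) :
    age j (k + 1) ω i = if j (k + 1) ω = i then 0 else age j k ω i + 1 := rfl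

theorem age_le (k : ℕ) (ω : Ω) (i : Fin p) : age j k ω i ≤ k := by
  induction k with
  | zero => exact le_rfl
  | succ k ih => rw [age_succ]; split_ifs <;> omega

theorem age_eq_stale (k : ℕ) (ω : Ω) (i : Fin p) :
    (age j k ω i : ℝ) = stale j 0 (fun _ _ _ => 1) k ω i := by
  induction k with
  | zero => simp [age, stale]
  | succ k ih => rw [age_succ, stale_succ]; split_ifs <;> simp [ih]

/-- As `(t + 1)² - t² = 2t + 1`, the squared age is again a reset process, so its mean obeys the
same kind of recursion. -/
theorem age_sq_eq_stale (k : ℕ) (ω : Ω) (i : Fin p) :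
    (age j k ω i : ℝ) ^ 2 = stale j 0 (fun k ω i => 2 * (age j k ω i : ℝ) + 1) k ω i := by
  induction k with
  | zero => simp [age, stale]
  | succ k ih =>
    rw [stale_succ, ← ih, age_succ]
    split_ifs
    · simp
    · push_cast; ring

variable [mΩ : MeasurableSpace Ω] {μ : Measure Ω} {ℱ : Filtration ℕ mΩ}

theorem IsUniformSampling.measurableSet (hj : IsUniformSampling μ ℱ j) (k : ℕ) (i : Fin p) :
    MeasurableSet[ℱ (k + 1)] {ω | j (k + 1) ω = i} :=
  hj.measurable k (measurableSet_singleton i)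

/-- Independence of the sample from the past turns resetting into multiplication of the mean by `1 -
1/p`. All other expectation recursions rest on this one fact. -/
theorem IsUniformSampling.integral_ite [IsProbabilityMeasure μ] (hj : IsUniformSampling μ ℱ j)
    (k : ℕ) (i : Fin p) {Z : Ω → ℝ} (hZ : Measurable[ℱ k] Z) (hZi : Integrable Z μ) :
    p * ∫ ω, (if j (k + 1) ω = i then 0 else Z ω) ∂μ = (p - 1) * ∫ ω, Z ω ∂μ := by
  have hle : MeasurableSpace.comap (j (k + 1)) ⊤ ≤ mΩ :=
    ((hj.measurable k).mono (ℱ.le _) le_rfl).comap_le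
  have hA : MeasurableSet[MeasurableSpace.comap (j (k + 1)) ⊤] {ω | j (k + 1) ω = i} :=
    ⟨{i}, trivial, rfl⟩
  have hind : Indep (MeasurableSpace.comap (j (k + 1)) ⊤)
      (MeasurableSpace.comap Z inferInstance) μ :=
    indep_of_indep_of_le_right (hj.indep k) hZ.comap_le
  have hZm : Measurable Z := hZ.mono (ℱ.le k) le_rfl
  have h1 : ∫ ω in {ω | j (k + 1) ω = i}, Z ω ∂μ
      = μ.real {ω | j (k + 1) ω = i} * ∫ ω, Z ω ∂μ :=
    Indep.setIntegral_eq_mul (f := id) hle hind hZm.aemeasurable hA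
      aestronglyMeasurable_id
  have hp : (p : ℝ) ≠ 0 := by
    have : 0 < p := Fin.pos i
    exact_mod_cast this.ne'
  have h2 : μ.real {ω | j (k + 1) ω = i} = (p : ℝ)⁻¹ := by
    rw [measureReal_def, hj.uniform k i]
    simp
  have h3 : ∫ ω, (if j (k + 1) ω = i then 0 else Z ω) ∂μ
      = ∫ ω, Z ω ∂μ - ∫ ω in {ω | j (k + 1) ω = i}, Z ω ∂μ := by
    rw [← integral_indicator (hle _ hA), ← integral_sub hZi (hZi.indicator (hle _ hA))]
    refine integral_congr_ae (Filter.Eventually.of_forall fun ω => ?_)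
    by_cases h : j (k + 1) ω = i <;> simp [h]
  rw [h3, h1, h2]
  field_simp

theorem stale_measurable (hj : IsUniformSampling μ ℱ j)
    (hinc : ∀ k i, Measurable[ℱ k] fun ω => inc k ω i) (k : ℕ) (i : Fin p) :
    Measurable[ℱ k] fun ω => stale j r₀ inc k ω i := by
  induction k with
  | zero => exact measurable_const
  | succ k ih =>
    refine Measurable.ite (hj.measurableSet k i) measurable_const ?_
    exact (ih.add (hinc k i)).mono (ℱ.mono (Nat.le_succ k)) le_rfl

theorem age_measurable (hj : IsUniformSampling μ ℱ j) (k : ℕ) (i : Fin p) :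
    Measurable[ℱ k] fun ω => (age j k ω i : ℝ) := by
  simp_rw [age_eq_stale]
  exact stale_measurable hj (fun _ _ => measurable_const) k i

variable [IsProbabilityMeasure μ]

theorem integrable_of_abs_le {Z : Ω → ℝ} (hZ : Measurable Z) {B : ℝ} (hB : ∀ ω, |Z ω| ≤ B) :
    Integrable Z μ :=
  Integrable.of_bound hZ.aestronglyMeasurable B (Filter.Eventually.of_forall hB)

theorem stale_integrable (hj : IsUniformSampling μ ℱ j)
    (hinc : ∀ k i, Measurable[ℱ k] fun ω => inc k ω i) {C : ℕ → ℝ}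
    (hC : ∀ k ω i, |inc k ω i| ≤ C k) (k : ℕ) (i : Fin p) :
    Integrable (fun ω => stale j r₀ inc k ω i) μ := by
  obtain ⟨B, hB⟩ := stale_bounded (j := j) (r₀ := r₀) hC i k
  exact integrable_of_abs_le ((stale_measurable hj hinc k i).mono (ℱ.le k) le_rfl) hB

theorem integral_stale_succ (hj : IsUniformSampling μ ℱ j)
    (hinc : ∀ k i, Measurable[ℱ k] fun ω => inc k ω i) {C : ℕ → ℝ}
    (hC : ∀ k ω i, |inc k ω i| ≤ C k) (k : ℕ) (i : Fin p) :
    p * ∫ ω, stale j r₀ inc (k + 1) ω i ∂μ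
      = (p - 1) * (∫ ω, stale j r₀ inc k ω i ∂μ + ∫ ω, inc k ω i ∂μ) := by
  have h1 := stale_integrable (μ := μ) (r₀ := r₀) hj hinc hC k i
  have h2 : Integrable (fun ω => inc k ω i) μ :=
    integrable_of_abs_le ((hinc k i).mono (ℱ.le k) le_rfl) fun ω => hC k ω i
  rw [← integral_add h1 h2]
  exact hj.integral_ite k i ((stale_measurable hj hinc k i).add (hinc k i)) (h1.add h2)

theorem integral_sum_stale_succ_le (hj : IsUniformSampling μ ℱ j)
    (hinc : ∀ k i, Measurable[ℱ k] fun ω => inc k ω i) {C : ℕ → ℝ}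
    (hC : ∀ k ω i, |inc k ω i| ≤ C k) {k : ℕ} {b : ℝ} (hb : ∀ ω, ∑ i, inc k ω i ≤ b)
    (hp : 1 ≤ p) :
    p * ∫ ω, ∑ i, stale j r₀ inc (k + 1) ω i ∂μ
      ≤ (p - 1) * (∫ ω, ∑ i, stale j r₀ inc k ω i ∂μ + b) := by
  have hp' : (0 : ℝ) ≤ p - 1 := by
    have : (1 : ℝ) ≤ p := by exact_mod_cast hp
    linarith
  have h2 : ∀ i, Integrable (fun ω => inc k ω i) μ := fun i =>
    integrable_of_abs_le ((hinc k i).mono (ℱ.le k) le_rfl) fun ω => hC k ω i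
  rw [integral_finsetSum _ fun i _ => stale_integrable hj hinc hC (k + 1) i,
    integral_finsetSum _ fun i _ => stale_integrable hj hinc hC k i, Finset.mul_sum]
  simp_rw [integral_stale_succ hj hinc hC]
  rw [← Finset.mul_sum, Finset.sum_add_distrib]
  refine mul_le_mul_of_nonneg_left (add_le_add_right ?_ _) hp'
  rw [← integral_finsetSum _ fun i _ => h2 i]
  calc ∫ ω, ∑ i, inc k ω i ∂μ ≤ ∫ _, b ∂μ :=
        integral_mono (integrable_finsetSum _ fun i _ => h2 i) (integrable_const b) hb
    _ = b := by simp

theorem integrable_age_sq (hj : IsUniformSampling μ ℱ j) (k : ℕ) (i : Fin p) :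
    Integrable (fun ω => (age j k ω i : ℝ) ^ 2) μ := by
  refine integrable_of_abs_le (((age_measurable hj k i).pow_const 2).mono (ℱ.le k) le_rfl)
    (B := (k : ℝ) ^ 2) fun ω => ?_
  rw [abs_of_nonneg (by positivity)]
  have : (age j k ω i : ℝ) ≤ k := by exact_mod_cast age_le k ω i
  gcongr

theorem integral_age_le (hj : IsUniformSampling μ ℱ j) (k : ℕ) (i : Fin p) :
    ∫ ω, (age j k ω i : ℝ) ∂μ ≤ p - 1 := by
  have hp : (1 : ℝ) ≤ p := by exact_mod_cast (Fin.pos i : 0 < p)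
  induction k with
  | zero => simpa [age] using hp
  | succ k ih =>
    have h := integral_stale_succ (μ := μ) (r₀ := 0) (inc := fun _ _ _ => 1) (C := fun _ => 1) hj
      (fun _ _ => measurable_const) (by simp) k i
    simp_rw [← age_eq_stale] at h
    simp only [integral_const, probReal_univ, smul_eq_mul, mul_one] at h
    have h2 : (p - 1) * (∫ ω, (age j k ω i : ℝ) ∂μ + 1) ≤ (p - 1) * (p : ℝ) :=
      mul_le_mul_of_nonneg_left (by linarith) (by linarith)
    exact le_of_mul_le_mul_left (a := (p : ℝ)) (by linarith) (by linarith)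

theorem integral_age_sq_le (hj : IsUniformSampling μ ℱ j) (k : ℕ) (i : Fin p) :
    ∫ ω, (age j k ω i : ℝ) ^ 2 ∂μ ≤ 2 * p ^ 2 := by
  have hp : (1 : ℝ) ≤ p := by exact_mod_cast (Fin.pos i : 0 < p)
  induction k with
  | zero => simp [age]
  | succ k ih =>
    have hint : ∀ k, Integrable (fun ω => (age j k ω i : ℝ)) μ := fun k => by
      refine integrable_of_abs_le ((age_measurable hj k i).mono (ℱ.le k) le_rfl) (B := k)
        fun ω => ?_
      rw [abs_of_nonneg (by positivity)]
      exact_mod_cast age_le k ω i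
    have h := integral_stale_succ (μ := μ) (r₀ := 0)
      (inc := fun k ω i => 2 * (age j k ω i : ℝ) + 1) (C := fun k => 2 * k + 1) hj
      (fun k i => ((age_measurable hj k i).const_mul 2).add measurable_const) (fun k ω i => by
        rw [abs_of_nonneg (by positivity)]
        have : (age j k ω i : ℝ) ≤ k := by exact_mod_cast age_le k ω i
        linarith) k i
    simp_rw [← age_sq_eq_stale] at h
    rw [integral_add ((hint k).const_mul 2) (integrable_const 1), integral_const_mul] at h
    simp only [integral_const, probReal_univ, smul_eq_mul, mul_one] at h
    have h1 := integral_age_le hj (μ := μ) k i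
    have h2 : (p - 1) * (∫ ω, (age j k ω i : ℝ) ^ 2 ∂μ + (2 * ∫ ω, (age j k ω i : ℝ) ∂μ + 1))
        ≤ (p - 1) * (2 * (p : ℝ) ^ 2 + (2 * (p - 1) + 1)) :=
      mul_le_mul_of_nonneg_left (by linarith) (by linarith)
    refine le_of_mul_le_mul_left (a := (p : ℝ)) ?_ (by linarith)
    -- The value `2p²` is invariant: `(p - 1)(2p² + 2(p - 1) + 1) = 2p³ - 3p + 1 ≤ 2p³`.
    nlinarith

end Stale

/-! ### Matrices and diameters -/

section Geometry

variable {p q : ℕ} (M : Matrix (Fin p) (Fin q) ℝ)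

theorem mv_add (x y : EuclideanSpace ℝ (Fin q)) : mv M (x + y) = mv M x + mv M y := map_add _ x y

theorem mv_sub (x y : EuclideanSpace ℝ (Fin q)) : mv M (x - y) = mv M x - mv M y := map_sub _ x y

theorem mv_smul (c : ℝ) (x : EuclideanSpace ℝ (Fin q)) : mv M (c • x) = c • mv M x :=
  map_smul _ c x

theorem continuous_mv : Continuous (mv M) := M.toEuclideanLin.continuous_of_finiteDimensional

theorem norm_mv_le (x : EuclideanSpace ℝ (Fin q)) : ‖mv M x‖ ≤ opNorm M * ‖x‖ :=
  (LinearMap.toContinuousLinearMap M.toEuclideanLin).le_opNorm x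

theorem opNorm_nonneg : 0 ≤ opNorm M := norm_nonneg _

theorem mv_apply (x : EuclideanSpace ℝ (Fin q)) (i : Fin p) : mv M x i = ∑ k, M i k * x k := rfl

theorem inner_row (x : EuclideanSpace ℝ (Fin q)) (i : Fin p) : inner ℝ (row M i) x = mv M x i := by
  rw [mv_apply, PiLp.inner_apply]
  exact Finset.sum_congr rfl fun k _ => mul_comm _ _

theorem inner_mv_transpose (a : EuclideanSpace ℝ (Fin p)) (x : EuclideanSpace ℝ (Fin q)) :
    inner ℝ (mv M.transpose a) x = ∑ i, a i * mv M x i := by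
  simp_rw [PiLp.inner_apply, mv_apply, Finset.mul_sum]
  rw [Finset.sum_comm]
  refine Finset.sum_congr rfl fun k _ => ?_
  simp only [RCLike.inner_apply, conj_trivial, Finset.mul_sum, Matrix.transpose_apply]
  exact Finset.sum_congr rfl fun i _ => by ring

/-- A stochastic average gradient estimator stays equal to `Mᵀ a`. -/
theorem inner_estimator {v : ℕ → EuclideanSpace ℝ (Fin q)} {a : ℕ → Fin p → ℝ} {j : ℕ → Fin p}
    {b : ℕ → ℝ} (h₀ : v 0 = mv M.transpose (WithLp.toLp 2 (a 0)))
    (ha : ∀ k, a (k + 1) = Function.update (a k) (j (k + 1)) (b k))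
    (hv : ∀ k, v (k + 1) = v k +
      (a (k + 1) (j (k + 1)) - a k (j (k + 1))) • row M (j (k + 1)))
    (k : ℕ) (x : EuclideanSpace ℝ (Fin q)) : inner ℝ (v k) x = ∑ i, a k i * mv M x i := by
  induction k with
  | zero => rw [h₀, inner_mv_transpose]
  | succ k ih =>
    rw [hv, inner_add_left, ih, inner_smul_left, inner_row, ha]
    simp only [conj_trivial, Function.update_self]
    have : ∀ i, Function.update (a k) (j (k + 1)) (b k) i * mv M x i
        = a k i * mv M x i
          + if i = j (k + 1) then (b k - a k (j (k + 1))) * mv M x (j (k + 1)) else 0 := by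
      intro i
      by_cases hi : i = j (k + 1)
      · subst hi; simp; ring
      · simp [hi]
    simp_rw [this, Finset.sum_add_distrib]
    simp

theorem continuous_mv_coord (i : Fin p) :
    Continuous fun x : EuclideanSpace ℝ (Fin q) => mv M x i :=
  (EuclideanSpace.proj (𝕜 := ℝ) i).continuous.comp (continuous_mv M)

variable {W : Set (EuclideanSpace ℝ (Fin q))}

theorem diamInf_nonneg : 0 ≤ diamInf W M :=
  Real.sSup_nonneg (by rintro r ⟨u, -, v, -, rfl⟩; exact norm_nonneg _)

variable (hW : IsCompact W)
include hW

theorem bddAbove_diam {F : EuclideanSpace ℝ (Fin q) → ℝ} (hF : Continuous F) :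
    BddAbove {r | ∃ u ∈ W, ∃ v ∈ W, r = F (u - v)} := by
  have h := ((hW.prod hW).image (f := fun z : _ × _ => F (z.1 - z.2)) (by fun_prop)).bddAbove
  refine h.mono ?_
  rintro r ⟨u, hu, v, hv, rfl⟩
  exact ⟨(u, v), ⟨hu, hv⟩, rfl⟩

theorem sum_abs_mv_le_diamOne {u v : EuclideanSpace ℝ (Fin q)} (hu : u ∈ W) (hv : v ∈ W) :
    ∑ i, |mv M (u - v) i| ≤ diamOne W M := by
  refine le_csSup (bddAbove_diam hW (F := fun x => ∑ i, |mv M x i|) ?_) ⟨u, hu, v, hv, rfl⟩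
  exact continuous_finsetSum _ fun i _ => (continuous_mv_coord M i).abs

theorem abs_mv_le_diamInf {u v : EuclideanSpace ℝ (Fin q)} (hu : u ∈ W) (hv : v ∈ W) (i : Fin p) :
    |mv M (u - v) i| ≤ diamInf W M := by
  refine (norm_le_pi_norm (fun i => mv M (u - v) i) i).trans ?_
  refine le_csSup (bddAbove_diam hW (F := fun x => ‖(fun i => mv M x i : Fin p → ℝ)‖) ?_)
    ⟨u, hu, v, hv, rfl⟩
  exact (continuous_pi fun i => continuous_mv_coord M i).norm

theorem diamOne_nonneg (hne : W.Nonempty) : 0 ≤ diamOne W M := by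
  obtain ⟨u, hu⟩ := hne
  exact (Finset.sum_nonneg fun i _ => abs_nonneg _).trans (sum_abs_mv_le_diamOne M hW hu hu)

theorem sum_sq_mv_le {u v : EuclideanSpace ℝ (Fin q)} (hu : u ∈ W) (hv : v ∈ W) :
    ∑ i, (mv M (u - v) i) ^ 2 ≤ diamOne W M * diamInf W M := by
  calc ∑ i, (mv M (u - v) i) ^ 2 ≤ ∑ i, |mv M (u - v) i| * diamInf W M := by
        refine Finset.sum_le_sum fun i _ => ?_
        rw [← sq_abs, sq]
        exact mul_le_mul_of_nonneg_left (abs_mv_le_diamInf M hW hu hv i) (abs_nonneg _)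
    _ = (∑ i, |mv M (u - v) i|) * diamInf W M := by rw [Finset.sum_mul]
    _ ≤ diamOne W M * diamInf W M :=
        mul_le_mul_of_nonneg_right (sum_abs_mv_le_diamOne M hW hu hv) (diamInf_nonneg M)

theorem norm_mv_sq_le {u v : EuclideanSpace ℝ (Fin q)} (hu : u ∈ W) (hv : v ∈ W) :
    ‖mv M (u - v)‖ ^ 2 ≤ opNorm M ^ 2 * Metric.diam W ^ 2 := by
  rw [← mul_pow]
  have h1 : ‖u - v‖ ≤ Metric.diam W := by
    rw [← dist_eq_norm]; exact Metric.dist_le_diam_of_mem hW.isBounded hu hv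
  have := (norm_mv_le M (u - v)).trans (mul_le_mul_of_nonneg_left h1 (opNorm_nonneg M))
  gcongr

end Geometry

/-! ### Step sizes and smoothing parameters -/

theorem smoothParam_pos {β₀ : ℝ} (hβ₀ : 0 < β₀) (k : ℕ) : 0 < smoothParam β₀ k := by
  unfold smoothParam; positivity

theorem smoothParam_zero (β₀ : ℝ) : smoothParam β₀ 0 = β₀ := by simp [smoothParam]

theorem one_div_smoothParam (β₀ : ℝ) (k : ℕ) : 1 / smoothParam β₀ k = √((k : ℝ) + 1) / β₀ := by
  rw [smoothParam, one_div_div]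

theorem smoothParam_antitone {β₀ : ℝ} (hβ₀ : 0 < β₀) : Antitone (smoothParam β₀) := by
  intro a b hab
  unfold smoothParam
  gcongr

theorem stepSize_succ (k : ℕ) : stepSize (k + 1) = 2 / ((k : ℝ) + 2) := by
  unfold stepSize; push_cast; ring_nf

theorem stepSize_mem (k : ℕ) : 0 ≤ stepSize (k + 1) ∧ stepSize (k + 1) ≤ 1 := by
  rw [stepSize_succ, div_le_one (by positivity)]
  exact ⟨by positivity, by linarith [Nat.cast_nonneg (α := ℝ) k]⟩

/-- Reduces to `√(k+2) - √(k+1) ≤ 1/(2√(k+1))`. The factor `1/4` is what `smoothed_step` needs to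
keep three quarters of the quadratic gain. -/
theorem smoothParam_decrease_le {β₀ : ℝ} (hβ₀ : 0 < β₀) (k : ℕ) :
    (1 - stepSize (k + 1)) * (smoothParam β₀ k - smoothParam β₀ (k + 1))
      ≤ stepSize (k + 1) * smoothParam β₀ (k + 1) / 4 := by
  have hk : (0 : ℝ) ≤ k := Nat.cast_nonneg k
  rw [stepSize_succ]
  unfold smoothParam
  push_cast
  rw [show (k : ℝ) + 1 + 1 = k + 2 by ring]
  have ha : 0 < √((k : ℝ) + 1) := Real.sqrt_pos.2 (by linarith)
  have hb : 0 < √((k : ℝ) + 2) := Real.sqrt_pos.2 (by linarith)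
  have h1 := Real.sq_sqrt (by linarith : 0 ≤ (k : ℝ) + 1)
  have h := sqrt_succ_sub_sqrt_le (by linarith : 0 < (k : ℝ) + 1)
  rw [show (k : ℝ) + 1 + 1 = k + 2 by ring, le_div_iff₀ (by positivity)] at h
  set a := √((k : ℝ) + 1)
  set b := √((k : ℝ) + 2)
  have e1 : (1 - 2 / ((k : ℝ) + 2)) * (β₀ / a - β₀ / b)
      = β₀ / ((k + 2) * a ^ 2 * b) * (k * ((b - a) * a)) := by
    field_simp; ring
  have e2 : 2 / ((k : ℝ) + 2) * (β₀ / b) / 4 = β₀ / ((k + 2) * a ^ 2 * b) * (a ^ 2 / 2) := by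
    field_simp; ring
  rw [e1, e2]
  refine mul_le_mul_of_nonneg_left ?_ (by positivity)
  nlinarith

/-- The quotient is `√x` with `x = (T+1)/(k+1) ≤ 1`, and `x ≤ √x`. This bounds the relative change
of the parameter since the last refresh by the age over `k + 1`. -/
theorem one_sub_smoothParam_div_le {β₀ : ℝ} (hβ₀ : 0 < β₀) {T k : ℕ} (h : T ≤ k) :
    1 - smoothParam β₀ k / smoothParam β₀ T ≤ ((k - T : ℕ) : ℝ) / ((k : ℝ) + 1) := by
  have hT : (T : ℝ) ≤ k := by exact_mod_cast h
  have hT0 : (0 : ℝ) ≤ T := Nat.cast_nonneg T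
  rw [Nat.cast_sub h]
  unfold smoothParam
  have ha : 0 < √((T : ℝ) + 1) := Real.sqrt_pos.2 (by linarith)
  have hb : 0 < √((k : ℝ) + 1) := Real.sqrt_pos.2 (by linarith)
  have h1 := Real.sq_sqrt (by linarith : 0 ≤ (T : ℝ) + 1)
  have h2 := Real.sq_sqrt (by linarith : 0 ≤ (k : ℝ) + 1)
  have hab : √((T : ℝ) + 1) ≤ √((k : ℝ) + 1) := Real.sqrt_le_sqrt (by linarith)
  have e : β₀ / √((k : ℝ) + 1) / (β₀ / √((T : ℝ) + 1)) = √((T : ℝ) + 1) / √((k : ℝ) + 1) := by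
    field_simp
  rw [e]
  have e3 : ((k : ℝ) - T) / (k + 1) = 1 - (T + 1) / (k + 1) := by field_simp; ring
  rw [e3, sub_le_sub_iff_left, div_le_div_iff₀ (by linarith) hb]
  nlinarith [mul_nonneg (mul_nonneg ha.le hb.le) (sub_nonneg.2 hab)]

/-! ### One step of the conditional gradient method -/

theorem smooth_step {f : ℝ → ℝ} {L : ℝ≥0} (hc : ConvexOn ℝ Set.univ f)
    (hd : Differentiable ℝ f) (hL : LipschitzWith L (deriv f)) {η : ℝ} (hη : 0 ≤ η) (x d u : ℝ) :
    f (x + η * d) - f u ≤ (1 - η) * (f x - f u) + η * (deriv f x * (x + d - u))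
      + L / 2 * η ^ 2 * d ^ 2 := by
  have h1 := le_tangent_add_sq_of_lipschitzWith_deriv hd hL x (x + η * d)
  have h2 := mul_le_mul_of_nonneg_left (tangent_le_of_convexOn hc hd x u) hη
  have e : x + η * d - x = η * d := by ring
  rw [e] at h1
  linarith

/-- Smoothness yields the step from `z`; an `η` share of the value at `z` is traded for `g(u)` with
gain `ηβ/2 ‖y‖²`, and the rest is moved to the old parameter at a cost of at most `ηβ/8 ‖y‖²`. The
difference is the coefficient `3/8`. -/
theorem smoothed_step {V : Type*} [NormedAddCommGroup V] [InnerProductSpace ℝ V] {g : V → EReal}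
    {β β' η : ℝ} (hβ : 0 < β) (hβ' : 0 < β') (hη : 0 ≤ η) (hη1 : η ≤ 1)
    (hdec : (1 - η) * (β' - β) ≤ η * β / 4) {z y d u : V} {r : ℝ} (hy : IsSmoothedGrad g β z y)
    (hu : g u = r) :
    smoothed g β (z + η • d) - r ≤ (1 - η) * (smoothed g β' z - r) + η * inner ℝ y (z + d - u)
      + η ^ 2 / (2 * β) * ‖d‖ ^ 2 - 3 / 8 * η * β * ‖y‖ ^ 2 := by
  have h1 := hy.upper hβ (z + η • d)
  have h2 := mul_le_mul_of_nonneg_left (hy.add_inner_le hβ hu) hη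
  have h3 := mul_le_mul_of_nonneg_left (hy.smoothed_le_smoothed hβ hβ') (sub_nonneg.2 hη1)
  have h4 := mul_le_mul_of_nonneg_right hdec (sq_nonneg ‖y‖)
  have e : z + η • d - z = η • d := by abel
  rw [e, inner_smul_right, norm_smul, Real.norm_of_nonneg hη, mul_pow] at h1
  have e2 : z + d - u = d - (u - z) := by abel
  rw [e2, inner_sub_right]
  have e3 : η ^ 2 * ‖d‖ ^ 2 / (2 * β) = η ^ 2 / (2 * β) * ‖d‖ ^ 2 := by ring
  linarith

theorem smoothPart_step {n d : ℕ} {f : Fin n → ℝ → ℝ} {L : ℝ≥0}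
    (hc : ∀ i, ConvexOn ℝ Set.univ (f i)) (hd : ∀ i, Differentiable ℝ (f i))
    (hL : ∀ i, LipschitzWith L (deriv (f i))) (X : Matrix (Fin n) (Fin d) ℝ) {η : ℝ} (hη : 0 ≤ η)
    (w s u : EuclideanSpace ℝ (Fin d)) :
    smoothPart f X (w + η • (s - w)) - smoothPart f X u
      ≤ (1 - η) * (smoothPart f X w - smoothPart f X u) + η * ∑ i, gradF f X w i * mv X (s - u) i
        + η ^ 2 / 2 * (L / n * ‖mv X (s - w)‖ ^ 2) := by
  have h : ∀ i, f i (mv X (w + η • (s - w)) i) - f i (mv X u i)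
      ≤ (1 - η) * (f i (mv X w i) - f i (mv X u i)) + η * (deriv (f i) (mv X w i) * mv X (s - u) i)
        + L / 2 * η ^ 2 * (mv X (s - w) i) ^ 2 := by
    intro i
    have := smooth_step (hc i) (hd i) (hL i) hη (mv X w i) (mv X (s - w) i) (mv X u i)
    have e1 : mv X (w + η • (s - w)) i = mv X w i + η * mv X (s - w) i := by
      rw [mv_add, mv_smul]; rfl
    have e2 : mv X w i + mv X (s - w) i - mv X u i = mv X (s - u) i := by
      rw [mv_sub, mv_sub]; simp
    rwa [e2, ← e1] at this
  have hs := mul_le_mul_of_nonneg_left (Finset.sum_le_sum fun i (_ : i ∈ Finset.univ) => h i)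
    (by positivity : 0 ≤ 1 / (n : ℝ))
  simp only [Finset.sum_add_distrib, Finset.sum_sub_distrib, ← Finset.mul_sum] at hs
  have e3 : ∑ i, gradF f X w i * mv X (s - u) i
      = 1 / (n : ℝ) * ∑ i, deriv (f i) (mv X w i) * mv X (s - u) i := by
    rw [Finset.mul_sum]
    exact Finset.sum_congr rfl fun i _ => by rw [gradF, mul_assoc]
  rw [e3, EuclideanSpace.norm_sq_eq]
  simp only [Real.norm_eq_abs, sq_abs]
  unfold smoothPart
  have e4 : η ^ 2 / 2 * (L / n * ∑ i, (mv X (s - w) i) ^ 2)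
      = 1 / (n : ℝ) * (L / 2 * η ^ 2 * ∑ i, (mv X (s - w) i) ^ 2) := by ring
  rw [e4]
  linarith

theorem separable_step {m d : ℕ} {g : Fin m → ℝ → EReal} (A : Matrix (Fin m) (Fin d) ℝ)
    {β β' η : ℝ} (hβ : 0 < β) (hβ' : 0 < β') (hη : 0 ≤ η) (hη1 : η ≤ 1)
    (hdec : (1 - η) * (β' - β) ≤ η * β / 4) {w s u : EuclideanSpace ℝ (Fin d)} {y r : Fin m → ℝ}
    (hy : ∀ l, IsSmoothedGrad (g l) β (mv A w l) (y l)) (hu : ∀ l, g l (mv A u l) = r l) :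
    1 / (m : ℝ) * ∑ l, smoothed (g l) β (mv A (w + η • (s - w)) l) - 1 / (m : ℝ) * ∑ l, r l
      ≤ (1 - η) * (1 / (m : ℝ) * ∑ l, smoothed (g l) β' (mv A w l) - 1 / (m : ℝ) * ∑ l, r l)
        + η * (1 / (m : ℝ) * ∑ l, y l * mv A (s - u) l)
        + η ^ 2 / (2 * β) * (1 / (m : ℝ) * ‖mv A (s - w)‖ ^ 2)
        - 3 / 8 * η * β * (1 / (m : ℝ) * ∑ l, y l ^ 2) := by
  have h : ∀ l, smoothed (g l) β (mv A (w + η • (s - w)) l) - r l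
      ≤ (1 - η) * (smoothed (g l) β' (mv A w l) - r l) + η * (y l * mv A (s - u) l)
        + η ^ 2 / (2 * β) * (mv A (s - w) l) ^ 2 - 3 / 8 * η * β * y l ^ 2 := by
    intro l
    have := smoothed_step hβ hβ' hη hη1 hdec (d := mv A (s - w) l) (hy l) (hu l)
    have e1 : mv A (w + η • (s - w)) l = mv A w l + η • mv A (s - w) l := by
      rw [mv_add, mv_smul]; rfl
    have e2 : mv A w l + mv A (s - w) l - mv A u l = mv A (s - u) l := by
      rw [mv_sub, mv_sub]; simp
    rw [e2, ← e1, Real.norm_eq_abs, Real.norm_eq_abs, sq_abs, sq_abs] at this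
    rwa [mul_comm (y l) (mv A (s - u) l)]
  have hs := mul_le_mul_of_nonneg_left (Finset.sum_le_sum fun i (_ : i ∈ Finset.univ) => h i)
    (by positivity : 0 ≤ 1 / (m : ℝ))
  simp only [Finset.sum_add_distrib, Finset.sum_sub_distrib, ← Finset.mul_sum] at hs
  rw [EuclideanSpace.norm_sq_eq]
  simp only [Real.norm_eq_abs, sq_abs]
  linarith

/-! ### The convergence rate of the deterministic recursion -/

open Finset in
/-- The recursion for the expected gap `G`, where `u` is the error of the stochastic average
gradient estimator of the smooth part and `E` collects the errors of the nonsmooth part. -/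
theorem rate_of_recursion {G u E e : ℕ → ℝ} {a P c₁ LX LA B Ce : ℝ} (ha : 1 ≤ a) (hP : 0 ≤ P)
    (hc₁ : 0 ≤ c₁) (hLX : 0 ≤ LX) (hLA : 0 ≤ LA) (hB : 0 ≤ B) (hCe : 0 ≤ Ce)
    (hu0 : ∀ k, 0 ≤ u k)
    (hu : ∀ k : ℕ, a * u (k + 1) ≤ (a - 1) * u k + c₁ / ((k : ℝ) + 1))
    (hE : ∀ k : ℕ, 2 * ((k : ℝ) + 1) * E k ≤ B * √((k : ℝ) + 1) + e k)
    (he : ∀ K, ∑ k ∈ range K, e k ≤ Ce)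
    (hG : ∀ k : ℕ, G (k + 1) ≤ (1 - 2 / ((k : ℝ) + 2)) * G k
      + 2 / ((k : ℝ) + 2) * (P * u (k + 1) + E k)
      + 2 / ((k : ℝ) + 2) ^ 2 * (LX + LA * √((k : ℝ) + 2))) {K : ℕ} (hK : 1 ≤ K) :
    G K ≤ 2 / 3 * (2 * LA + B) / √K + (4 * P * c₁ + 2 * LX) / K
      + (2 * a ^ 2 * P * (u 0 + c₁) + Ce) / (K : ℝ) ^ 2 := by
  -- The weight `(k+1)(k+2)` turns the factor `1 - 2/(k+2)` into `k(k+1)`, so the left side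
  -- telescopes. At `k = 0` the weight vanishes, and the initial gap never enters.
  have hstep : ∀ k : ℕ, ((k : ℝ) + 1) * ((k : ℝ) + 2) * G (k + 1)
      ≤ (k : ℝ) * ((k : ℝ) + 1) * G k + (2 * P * (((k : ℝ) + 1) * u (k + 1))
        + (2 * LA + B) * √((k : ℝ) + 1) + 2 * LX + e k) := by
    intro k
    have hk : (0 : ℝ) ≤ k := Nat.cast_nonneg k
    have h := mul_le_mul_of_nonneg_left (hG k) (by positivity : 0 ≤ ((k : ℝ) + 1) * (k + 2))
    have e1 : ((k : ℝ) + 1) * (k + 2) * ((1 - 2 / ((k : ℝ) + 2)) * G k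
        + 2 / ((k : ℝ) + 2) * (P * u (k + 1) + E k)
        + 2 / ((k : ℝ) + 2) ^ 2 * (LX + LA * √((k : ℝ) + 2)))
        = (k : ℝ) * (k + 1) * G k + (2 * P * ((k + 1) * u (k + 1)) + 2 * ((k : ℝ) + 1) * E k
          + 2 * (((k : ℝ) + 1) / (k + 2)) * LX
          + 2 * LA * (((k : ℝ) + 1) / (k + 2) * √((k : ℝ) + 2))) := by
      field_simp; ring
    have h1 : ((k : ℝ) + 1) / (k + 2) ≤ 1 := by rw [div_le_one (by positivity)]; linarith
    have h2 : ((k : ℝ) + 1) / (k + 2) * √((k : ℝ) + 2) ≤ √((k : ℝ) + 1) := by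
      have ha := Real.sqrt_nonneg ((k : ℝ) + 1)
      have hb : 0 < √((k : ℝ) + 2) := Real.sqrt_pos.2 (by linarith)
      have h1 := Real.sq_sqrt (by linarith : 0 ≤ (k : ℝ) + 1)
      have h2 := Real.sq_sqrt (by linarith : 0 ≤ (k : ℝ) + 2)
      have hab : √((k : ℝ) + 1) ≤ √((k : ℝ) + 2) := Real.sqrt_le_sqrt (by linarith)
      rw [div_mul_eq_mul_div, div_le_iff₀ (by positivity)]
      nlinarith [mul_nonneg (mul_nonneg ha hb.le) (sub_nonneg.2 hab)]
    rw [e1] at h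
    have h3 := mul_le_mul_of_nonneg_right h1 hLX
    have h4 := mul_le_mul_of_nonneg_left h2 hLA
    linarith [hE k]
  have hsum : ∀ K : ℕ, (K : ℝ) * ((K : ℝ) + 1) * G K
      ≤ 2 * P * ∑ k ∈ range K, ((k : ℝ) + 1) * u (k + 1)
        + (2 * LA + B) * ∑ k ∈ range K, √((k : ℝ) + 1) + 2 * LX * K + ∑ k ∈ range K, e k := by
    intro K
    induction K with
    | zero => simp
    | succ K ih =>
      simp only [sum_range_succ]
      push_cast
      have := hstep K
      rw [show (K : ℝ) + 1 + 1 = K + 2 by ring]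
      linarith
  have hK' : (1 : ℝ) ≤ K := by exact_mod_cast hK
  have hK0 : (0 : ℝ) < K := by linarith
  have hu' : ∑ k ∈ range K, ((k : ℝ) + 1) * u (k + 1)
      ≤ 2 * c₁ * K + a ^ 2 * (u 0 + c₁) := by
    have h := weighted_sum_le ha hu0 hu K
    have e1 : ∑ k ∈ range K, ((k : ℝ) + 1) * (c₁ / ((k : ℝ) + 1)) = K * c₁ := by
      have : ∀ k : ℕ, ((k : ℝ) + 1) * (c₁ / ((k : ℝ) + 1)) = c₁ := fun k => by field_simp
      simp [this]
    have e2 : ∑ k ∈ range K, c₁ / ((k : ℝ) + 1) ≤ c₁ * (2 * √K) := by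
      have := mul_le_mul_of_nonneg_left (sum_one_div_le K) hc₁
      rw [mul_sum] at this
      simpa only [mul_one_div] using this
    rw [e1] at h
    have hs := Real.sq_sqrt hK0.le
    have hs0 := Real.sqrt_nonneg (K : ℝ)
    have h3 : (a - 1) * (a * u 0 + ∑ k ∈ range K, c₁ / ((k : ℝ) + 1))
        ≤ a * (a * u 0 + c₁ * (2 * √K)) := by
      apply mul_le_mul (by linarith) (by linarith) _ (by linarith)
      have h0 : 0 ≤ ∑ k ∈ range K, c₁ / ((k : ℝ) + 1) := sum_nonneg fun k _ => by positivity
      have := mul_nonneg (by linarith : 0 ≤ a) (hu0 0)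
      linarith
    -- This splits the mixed term between the `1/K` and the `1/K²` constants, which explains the
    -- coefficient `2c₁` of `K` and the term `a² c₁`.
    have h4 : a * (2 * √K) ≤ a ^ 2 + K := by nlinarith [sq_nonneg (a - √K)]
    have h5 := mul_le_mul_of_nonneg_left h4 hc₁
    linarith
  have hmain : (K : ℝ) * ((K : ℝ) + 1) * G K
      ≤ (2 * LA + B) * (2 / 3 * (√K * ((K : ℝ) + 1))) + (4 * P * c₁ + 2 * LX) * K
        + (2 * a ^ 2 * P * (u 0 + c₁) + Ce) := by
    have h1 := mul_le_mul_of_nonneg_left hu' (by linarith : 0 ≤ 2 * P)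
    have h2 := mul_le_mul_of_nonneg_left (sum_sqrt_le K) (by linarith : 0 ≤ 2 * LA + B)
    linarith [hsum K, he K]
  have hpos : 0 < (K : ℝ) * ((K : ℝ) + 1) := by positivity
  have hs : 0 < √(K : ℝ) := Real.sqrt_pos.2 hK0
  have hsq := Real.sq_sqrt hK0.le
  refine le_of_mul_le_mul_left (hmain.trans ?_) hpos
  have hX : 0 ≤ 4 * P * c₁ + 2 * LX := by positivity
  have hY : 0 ≤ 2 * a ^ 2 * P * (u 0 + c₁) + Ce := by
    have := hu0 0
    positivity
  have e : (K : ℝ) * ((K : ℝ) + 1) * (2 / 3 * (2 * LA + B) / √K + (4 * P * c₁ + 2 * LX) / K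
      + (2 * a ^ 2 * P * (u 0 + c₁) + Ce) / (K : ℝ) ^ 2)
      = (2 * LA + B) * (2 / 3 * ((K : ℝ) / √K * ((K : ℝ) + 1)))
        + ((4 * P * c₁ + 2 * LX) * K + (4 * P * c₁ + 2 * LX))
        + ((2 * a ^ 2 * P * (u 0 + c₁) + Ce) + (2 * a ^ 2 * P * (u 0 + c₁) + Ce) / K) := by
    field_simp
  rw [e, Real.div_sqrt]
  have : 0 ≤ (2 * a ^ 2 * P * (u 0 + c₁) + Ce) / K := by positivity
  linarith

/-! ### Properties of a run -/

section Run

variable {n d : ℕ} {Ω : Type*}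

/-- The iterates, extended to time `0` by the initial point. -/
def iter (w : ℕ → Ω → EuclideanSpace ℝ (Fin d)) (k : ℕ) : Ω → EuclideanSpace ℝ (Fin d) :=
  w (max k 1)

theorem iter_succ (w : ℕ → Ω → EuclideanSpace ℝ (Fin d)) (k : ℕ) : iter w (k + 1) = w (k + 1) := by
  simp [iter]

theorem iter_zero (w : ℕ → Ω → EuclideanSpace ℝ (Fin d)) : iter w 0 = w 1 := rfl

theorem measurable_abs_mv {mΩ : MeasurableSpace Ω} {p : ℕ} (M : Matrix (Fin p) (Fin d) ℝ)
    {x : Ω → EuclideanSpace ℝ (Fin d)} (hx : Measurable x) (i : Fin p) :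
    Measurable fun ω => |mv M (x ω) i| :=
  ((continuous_mv_coord M i).abs.measurable).comp hx

/-- The increments that dominate the change of the gradient of the smooth part. -/
noncomputable def incF (L : ℝ≥0) (X : Matrix (Fin n) (Fin d) ℝ) (w : ℕ → Ω → EuclideanSpace ℝ (Fin d))
    (k : ℕ) (ω : Ω) (i : Fin n) : ℝ :=
  L / n * |mv X (w (k + 1) ω - iter w k ω) i|

/-- An upper bound for the error of the estimator `α`. -/
noncomputable def errF (L : ℝ≥0) (f : Fin n → ℝ → ℝ) (X : Matrix (Fin n) (Fin d) ℝ)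
    (w₁ : EuclideanSpace ℝ (Fin d)) (α₀ : Fin n → ℝ) (j : ℕ → Ω → Fin n)
    (w : ℕ → Ω → EuclideanSpace ℝ (Fin d)) : ℕ → Ω → Fin n → ℝ :=
  stale j (fun i => |gradF f X w₁ i - α₀ i|) (incF L X w)

theorem errF_nonneg {f : Fin n → ℝ → ℝ} {X : Matrix (Fin n) (Fin d) ℝ}
    {w₁ : EuclideanSpace ℝ (Fin d)} {α₀ : Fin n → ℝ} {j : ℕ → Ω → Fin n}
    {w : ℕ → Ω → EuclideanSpace ℝ (Fin d)} (L : ℝ≥0) (k : ℕ) (ω : Ω) (i : Fin n) : 0 ≤ errF L f X w₁ α₀ j w k ω i :=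
  stale_nonneg (fun _ => abs_nonneg _) (fun _ _ _ => by unfold incF; positivity) k ω i

variable [mΩ : MeasurableSpace Ω] {μ : Measure Ω} {ℱ : Filtration ℕ mΩ}
  {W : Set (EuclideanSpace ℝ (Fin d))} {f : Fin n → ℝ → ℝ} {X : Matrix (Fin n) (Fin d) ℝ}
  {w₁ : EuclideanSpace ℝ (Fin d)} {α₀ : Fin n → ℝ} {j : ℕ → Ω → Fin n} {α : ℕ → Ω → Fin n → ℝ}
  {vf vg s w : ℕ → Ω → EuclideanSpace ℝ (Fin d)}

theorem IsRun.w_measurable (h : IsRun μ ℱ W f X w₁ α₀ j α vf vg s w) (k : ℕ) :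
    Measurable[ℱ k] (w (k + 1)) := by
  induction k with
  | zero =>
    rw [funext h.init_w]
    exact measurable_const
  | succ k ih =>
    rw [funext (h.w_step k)]
    have h1 := ih.mono (ℱ.mono (Nat.le_succ k)) le_rfl
    exact h1.add (((h.s_measurable k).sub h1).const_smul (stepSize (k + 1)))

theorem IsRun.iter_measurable (h : IsRun μ ℱ W f X w₁ α₀ j α vf vg s w) (k : ℕ) :
    Measurable[ℱ k] (iter w k) := by
  cases k with
  | zero => exact h.w_measurable 0
  | succ k =>
    rw [iter_succ]
    exact (h.w_measurable k).mono (ℱ.mono (Nat.le_succ k)) le_rfl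

theorem IsRun.w_mem (h : IsRun μ ℱ W f X w₁ α₀ j α vf vg s w) (hW : Convex ℝ W) (hw₁ : w₁ ∈ W)
    (k : ℕ) (ω : Ω) : w (k + 1) ω ∈ W := by
  induction k with
  | zero => rw [h.init_w]; exact hw₁
  | succ k ih =>
    rw [h.w_step]
    exact hW.add_smul_sub_mem ih (h.s_mem k ω) (stepSize_mem k)

theorem IsRun.iter_mem (h : IsRun μ ℱ W f X w₁ α₀ j α vf vg s w) (hW : Convex ℝ W)
    (hw₁ : w₁ ∈ W) (k : ℕ) (ω : Ω) : iter w k ω ∈ W := by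
  cases k with
  | zero => exact h.w_mem hW hw₁ 0 ω
  | succ k => rw [iter_succ]; exact h.w_mem hW hw₁ k ω

/-- Consecutive iterates differ by at most `2/(k+1)` times an `ℓ₁` diameter. -/
theorem IsRun.sum_abs_mv_iter_sub_le (h : IsRun μ ℱ W f X w₁ α₀ j α vf vg s w)
    (hWc : IsCompact W) (hW : Convex ℝ W) (hw₁ : w₁ ∈ W) {p : ℕ} (M : Matrix (Fin p) (Fin d) ℝ)
    (k : ℕ) (ω : Ω) : ∑ i, |mv M (w (k + 1) ω - iter w k ω) i| ≤ 2 / ((k : ℝ) + 1) * diamOne W M := by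
  have hD := diamOne_nonneg M hWc ⟨w₁, hw₁⟩
  cases k with
  | zero =>
    have : mv M 0 = 0 := map_zero _
    simp only [zero_add, iter_zero, sub_self, this]
    simpa using hD
  | succ k =>
    rw [iter_succ, h.w_step k ω, add_sub_cancel_left, mv_smul, stepSize_succ]
    have h1 := sum_abs_mv_le_diamOne M hWc (h.s_mem k ω) (h.w_mem hW hw₁ k ω)
    have h2 := mul_le_mul_of_nonneg_left h1 (by positivity : 0 ≤ 2 / ((k : ℝ) + 2))
    rw [Finset.mul_sum] at h2
    push_cast
    rw [show (k : ℝ) + 1 + 1 = k + 2 by ring]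
    refine le_trans (le_of_eq (Finset.sum_congr rfl fun i _ => ?_)) h2
    rw [PiLp.smul_apply, smul_eq_mul, abs_mul, abs_of_nonneg (by positivity)]

/-- A refreshed coordinate is exact; any other keeps its old value while the true gradient drifts by
at most `incF`, because `deriv (f i)` is Lipschitz. At time `0` the reference point is the initial
iterate, so the first increment is zero. -/
theorem IsRun.abs_gradF_sub_le (h : IsRun μ ℱ W f X w₁ α₀ j α vf vg s w) {L : ℝ≥0}
    (hL : ∀ i, LipschitzWith L (deriv (f i))) (k : ℕ) (ω : Ω) (i : Fin n) :
    |gradF f X (iter w k ω) i - α k ω i| ≤ errF L f X w₁ α₀ j w k ω i := by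
  induction k with
  | zero =>
    rw [iter_zero, h.init_w, h.init_α]; exact le_rfl
  | succ k ih =>
    rw [errF, stale_succ, h.α_step, iter_succ]
    split_ifs with hji
    · rw [hji, Function.update_self, sub_self, abs_zero]
    · rw [Function.update_of_ne (Ne.symm hji)]
      have h1 : |gradF f X (w (k + 1) ω) i - gradF f X (iter w k ω) i| ≤ incF L X w k ω i := by
        rw [gradF, gradF, ← mul_sub, abs_mul, abs_of_nonneg (by positivity), incF, mv_sub]
        have := (hL i).dist_le_mul (mv X (w (k + 1) ω) i) (mv X (iter w k ω) i)
        rw [Real.dist_eq, Real.dist_eq] at this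
        rw [PiLp.sub_apply]
        calc _ ≤ 1 / (n : ℝ) * (L * |mv X (w (k + 1) ω) i - mv X (iter w k ω) i|) := by gcongr
          _ = _ := by ring
      have h2 := abs_sub_le (gradF f X (w (k + 1) ω) i) (gradF f X (iter w k ω) i) (α k ω i)
      have ih' : _ ≤ stale j _ _ k ω i := ih
      linarith

theorem IsRun.measurable_incF (h : IsRun μ ℱ W f X w₁ α₀ j α vf vg s w) (L : ℝ≥0) (k : ℕ)
    (i : Fin n) : Measurable[ℱ k] fun ω => incF L X w k ω i :=
  (measurable_abs_mv X ((h.w_measurable k).sub (h.iter_measurable k)) i).const_mul _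

theorem IsRun.abs_incF_le (h : IsRun μ ℱ W f X w₁ α₀ j α vf vg s w) (hWc : IsCompact W)
    (hW : Convex ℝ W) (hw₁ : w₁ ∈ W) (L : ℝ≥0) (k : ℕ) (ω : Ω) (i : Fin n) :
    |incF L X w k ω i| ≤ L / n * diamInf W X := by
  rw [incF, abs_of_nonneg (by positivity)]
  gcongr
  exact abs_mv_le_diamInf X hWc (h.w_mem hW hw₁ k ω) (h.iter_mem hW hw₁ k ω) i

theorem IsRun.integrable_errF [IsProbabilityMeasure μ]
    (h : IsRun μ ℱ W f X w₁ α₀ j α vf vg s w) (hWc : IsCompact W)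
    (hW : Convex ℝ W) (hw₁ : w₁ ∈ W) (L : ℝ≥0) (k : ℕ) :
    Integrable (fun ω => ∑ i, errF L f X w₁ α₀ j w k ω i) μ :=
  integrable_finsetSum _ fun i _ => stale_integrable h.sampling (h.measurable_incF L)
    (C := fun _ => L / n * diamInf W X) (fun k ω i => h.abs_incF_le hWc hW hw₁ L k ω i) k i

theorem IsRun.integral_errF_succ_le [IsProbabilityMeasure μ]
    (h : IsRun μ ℱ W f X w₁ α₀ j α vf vg s w) (hWc : IsCompact W)
    (hW : Convex ℝ W) (hw₁ : w₁ ∈ W) (L : ℝ≥0) (hn : 1 ≤ n) (k : ℕ) :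
    n * ∫ ω, ∑ i, errF L f X w₁ α₀ j w (k + 1) ω i ∂μ
      ≤ (n - 1) * ∫ ω, ∑ i, errF L f X w₁ α₀ j w k ω i ∂μ
        + 2 * L * diamOne W X / ((k : ℝ) + 1) := by
  have hn' : (1 : ℝ) ≤ n := by exact_mod_cast hn
  have hD := diamOne_nonneg X hWc ⟨w₁, hw₁⟩
  have h1 := integral_sum_stale_succ_le (μ := μ) (r₀ := fun i => |gradF f X w₁ i - α₀ i|)
    h.sampling (h.measurable_incF L) (C := fun _ => L / n * diamInf W X)
    (fun k ω i => h.abs_incF_le hWc hW hw₁ L k ω i) (k := k)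
    (b := L / n * (2 / ((k : ℝ) + 1) * diamOne W X)) (fun ω => by
      simp only [incF, ← Finset.mul_sum]
      gcongr
      exact h.sum_abs_mv_iter_sub_le hWc hW hw₁ X k ω) hn
  refine h1.trans ?_
  rw [mul_add]
  have h2 : ((n : ℝ) - 1) * (L / n * (2 / ((k : ℝ) + 1) * diamOne W X))
      ≤ n * (L / n * (2 / ((k : ℝ) + 1) * diamOne W X)) :=
    mul_le_mul_of_nonneg_right (by linarith) (by positivity)
  have e : n * (L / n * (2 / ((k : ℝ) + 1) * diamOne W X)) = 2 * L * diamOne W X / ((k : ℝ) + 1) := by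
    field_simp
  rw [e] at h2
  exact add_le_add le_rfl h2

/-- The linear minimization step turns the inner products with the gradient into estimator
errors. -/
theorem IsRun.sum_gradF_le (h : IsRun μ ℱ W f X w₁ α₀ j α vf vg s w) (hWc : IsCompact W)
    {L : ℝ≥0} (hL : ∀ i, LipschitzWith L (deriv (f i))) {u : EuclideanSpace ℝ (Fin d)}
    (hu : u ∈ W) (k : ℕ) (ω : Ω) :
    ∑ i, gradF f X (w (k + 1) ω) i * mv X (s (k + 1) ω - u) i
        + inner ℝ (vg (k + 1) ω) (s (k + 1) ω - u)
      ≤ diamInf W X * ∑ i, errF L f X w₁ α₀ j w (k + 1) ω i := by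
  have h1 : inner ℝ (s (k + 1) ω) (vf (k + 1) ω + vg (k + 1) ω)
      ≤ inner ℝ u (vf (k + 1) ω + vg (k + 1) ω) := h.s_min k ω hu
  have h2 := inner_estimator X (v := fun k => vf k ω) (a := fun k => α k ω) (j := fun k => j k ω)
    (by rw [h.init_vf, h.init_α]) (fun k => h.α_step k ω) (fun k => h.vf_step k ω) (k + 1)
    (s (k + 1) ω - u)
  have h3 : inner ℝ (vf (k + 1) ω) (s (k + 1) ω - u) + inner ℝ (vg (k + 1) ω) (s (k + 1) ω - u)
      ≤ 0 := by
    rw [← inner_add_left, real_inner_comm, inner_sub_left]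
    linarith
  have h4 : ∑ i, gradF f X (w (k + 1) ω) i * mv X (s (k + 1) ω - u) i
      - ∑ i, α (k + 1) ω i * mv X (s (k + 1) ω - u) i
      ≤ diamInf W X * ∑ i, errF L f X w₁ α₀ j w (k + 1) ω i := by
    rw [← Finset.sum_sub_distrib, Finset.mul_sum]
    refine Finset.sum_le_sum fun i _ => ?_
    rw [← sub_mul]
    refine (le_abs_self _).trans ?_
    rw [abs_mul, mul_comm]
    have h5 := h.abs_gradF_sub_le hL (k + 1) ω i
    rw [iter_succ] at h5
    exact mul_le_mul (abs_mv_le_diamInf X hWc (h.s_mem k ω) hu i) h5 (abs_nonneg _)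
      (diamInf_nonneg X)
  linarith

theorem continuous_smoothPart (hd : ∀ i, Differentiable ℝ (f i)) : Continuous (smoothPart f X) :=
  continuous_const.mul (continuous_finsetSum _ fun i _ =>
    (hd i).continuous.comp (continuous_mv_coord X i))

/-- The iterates stay in the compact set `W`, on which a continuous function is bounded. -/
theorem IsRun.integrable_comp [IsProbabilityMeasure μ]
    (h : IsRun μ ℱ W f X w₁ α₀ j α vf vg s w) (hWc : IsCompact W)
    (hW : Convex ℝ W) (hw₁ : w₁ ∈ W) {F : EuclideanSpace ℝ (Fin d) → ℝ} (hF : Continuous F)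
    (k : ℕ) : Integrable (fun ω => F (w (k + 1) ω)) μ := by
  obtain ⟨B, hB⟩ := hWc.exists_bound_of_continuousOn hF.continuousOn
  exact integrable_of_abs_le (hF.measurable.comp ((h.w_measurable k).mono (ℱ.le k) le_rfl))
    fun ω => hB _ (h.w_mem hW hw₁ k ω)

end Run

/-! ### Variant 1 -/

theorem stepSize_succ_sq_div_two (k : ℕ) :
    stepSize (k + 1) ^ 2 / 2 = 2 / ((k : ℝ) + 2) ^ 2 := by
  rw [stepSize_succ, div_pow]
  generalize ((k : ℝ) + 2) ^ 2 = x
  ring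

theorem sq_div_two_mul_smoothParam_mul (β₀ η x : ℝ) (k : ℕ) :
    η ^ 2 / (2 * smoothParam β₀ (k + 1)) * x = η ^ 2 / 2 * (x / β₀ * √((k : ℝ) + 2)) := by
  have := one_div_smoothParam β₀ (k + 1)
  push_cast at this
  rw [show (k : ℝ) + 1 + 1 = k + 2 by ring] at this
  calc _ = η ^ 2 / 2 * x * (1 / smoothParam β₀ (k + 1)) := by ring
    _ = _ := by rw [this]; ring

section VariantOne

variable {n m d : ℕ} {Ω : Type*} [mΩ : MeasurableSpace Ω] {μ : Measure Ω} {ℱ : Filtration ℕ mΩ}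
  {W : Set (EuclideanSpace ℝ (Fin d))} {f : Fin n → ℝ → ℝ} {X : Matrix (Fin n) (Fin d) ℝ}
  {w₁ : EuclideanSpace ℝ (Fin d)} {α₀ : Fin n → ℝ} {j : ℕ → Ω → Fin n} {α : ℕ → Ω → Fin n → ℝ}
  {vf vg s w : ℕ → Ω → EuclideanSpace ℝ (Fin d)} {A : Matrix (Fin m) (Fin d) ℝ} {β₀ : ℝ}

theorem exists_value_of_objective_ne_top {g : EuclideanSpace ℝ (Fin m) → EReal}
    (hbot : ∀ z, g z ≠ ⊥) {u : EuclideanSpace ℝ (Fin d)} (hu : objective f X g A u ≠ ⊤) :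
    ∃ r : ℝ, g (mv A u) = r ∧ (objective f X g A u).toReal = smoothPart f X u + r := by
  have ht : g (mv A u) ≠ ⊤ := by
    intro h
    rw [objective, h, EReal.coe_add_top] at hu
    exact hu rfl
  obtain ⟨r, hr⟩ : ∃ r : ℝ, g (mv A u) = r :=
    ⟨(g (mv A u)).toReal, (EReal.coe_toReal ht (hbot _)).symm⟩
  refine ⟨r, hr, ?_⟩
  rw [objective, hr, ← EReal.coe_add, EReal.toReal_coe]

theorem IsRun.variantOne_step (h : IsRun μ ℱ W f X w₁ α₀ j α vf vg s w) (hWc : IsCompact W)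
    (hW : Convex ℝ W) (hw₁ : w₁ ∈ W) {L : ℝ≥0} (hc : ∀ i, ConvexOn ℝ Set.univ (f i))
    (hd : ∀ i, Differentiable ℝ (f i)) (hL : ∀ i, LipschitzWith L (deriv (f i))) (hβ₀ : 0 < β₀)
    {g : EuclideanSpace ℝ (Fin m) → EReal} (hg : IsProperClosedConvex g)
    (hv : IsVariantOne g A β₀ vg w) {u : EuclideanSpace ℝ (Fin d)} (hu : u ∈ W) {r : ℝ}
    (hr : g (mv A u) = r) (k : ℕ) (ω : Ω) :
    smoothedObjective f X g A (smoothParam β₀ (k + 1)) (w (k + 2) ω) - (smoothPart f X u + r)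
      ≤ (1 - 2 / ((k : ℝ) + 2)) *
          (smoothedObjective f X g A (smoothParam β₀ k) (w (k + 1) ω) - (smoothPart f X u + r))
        + 2 / ((k : ℝ) + 2) * (diamInf W X * ∑ i, errF L f X w₁ α₀ j w (k + 1) ω i)
        + 2 / ((k : ℝ) + 2) ^ 2 * (L / n * (opNorm X ^ 2 * Metric.diam W ^ 2)
          + opNorm A ^ 2 * Metric.diam W ^ 2 / β₀ * √((k : ℝ) + 2)) := by
  have hβ := smoothParam_pos hβ₀ (k + 1)
  obtain ⟨hη, hη1⟩ := stepSize_mem k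
  obtain ⟨p, hp, hvg⟩ := hv k ω
  have hy := hp.isSmoothedGrad hg hβ
  have h1 := smoothPart_step hc hd hL X hη (w (k + 1) ω) (s (k + 1) ω) u
  have h2 := smoothed_step hβ (smoothParam_pos hβ₀ k) hη hη1 (smoothParam_decrease_le hβ₀ k)
    (d := mv A (s (k + 1) ω - w (k + 1) ω)) hy hr
  rw [← mv_smul, ← mv_add, ← mv_add, ← mv_sub, ← h.w_step k ω] at h2
  rw [← h.w_step k ω] at h1
  have h3 := h.sum_gradF_le hWc hL hu k ω
  have e1 : inner ℝ (vg (k + 1) ω) (s (k + 1) ω - u)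
      = inner ℝ ((1 / smoothParam β₀ (k + 1)) • (mv A (w (k + 1) ω) - p))
          (mv A (s (k + 1) ω - u)) := by
    rw [hvg, inner_smul_left, inner_smul_left, inner_mv_transpose, PiLp.inner_apply]
    congr 1
    exact Finset.sum_congr rfl fun i _ => mul_comm _ _
  have e2 : w (k + 1) ω + (s (k + 1) ω - w (k + 1) ω) - u = s (k + 1) ω - u := by abel
  rw [e2, ← e1] at h2
  have h4 := norm_mv_sq_le X hWc (h.s_mem k ω) (h.w_mem hW hw₁ k ω)
  have h5 := norm_mv_sq_le A hWc (h.s_mem k ω) (h.w_mem hW hw₁ k ω)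
  -- With an exact nonsmooth gradient the leftover gain is not needed and is dropped.
  have h6 : (0 : ℝ) ≤ 3 / 8 * stepSize (k + 1) * smoothParam β₀ (k + 1)
      * ‖(1 / smoothParam β₀ (k + 1)) • (mv A (w (k + 1) ω) - p)‖ ^ 2 := by positivity
  have h7 := mul_le_mul_of_nonneg_left h3 hη
  have h8 : stepSize (k + 1) ^ 2 / 2 * (L / n * ‖mv X (s (k + 1) ω - w (k + 1) ω)‖ ^ 2)
      ≤ stepSize (k + 1) ^ 2 / 2 * (L / n * (opNorm X ^ 2 * Metric.diam W ^ 2)) := by gcongr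
  have h9 : stepSize (k + 1) ^ 2 / (2 * smoothParam β₀ (k + 1))
        * ‖mv A (s (k + 1) ω - w (k + 1) ω)‖ ^ 2
      ≤ stepSize (k + 1) ^ 2 / (2 * smoothParam β₀ (k + 1))
        * (opNorm A ^ 2 * Metric.diam W ^ 2) := by gcongr
  rw [sq_div_two_mul_smoothParam_mul _ _ (opNorm A ^ 2 * Metric.diam W ^ 2)] at h9
  rw [← stepSize_succ_sq_div_two, ← stepSize_succ]
  unfold smoothedObjective
  linarith

end VariantOne

/-! ### Variant 2: the estimator of the gradient of the smoothed function -/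

theorem IsProperClosedConvex.isSmoothedGrad_deriv {g : ℝ → EReal} (hg : IsProperClosedConvex g)
    {β : ℝ} (hβ : 0 < β) (z : ℝ) : IsSmoothedGrad g β z (deriv (smoothed g β) z) := by
  obtain ⟨y, hy⟩ := hg.exists_isSmoothedGrad hβ z
  rwa [(hy.hasDerivAt hβ).deriv]

section VariantTwo

variable {n m d : ℕ} {Ω : Type*}

/-- `g_{β_k,i}'(a_iᵀ w_k)`. -/
noncomputable def dualG (g : Fin m → ℝ → EReal) (A : Matrix (Fin m) (Fin d) ℝ) (β₀ : ℝ)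
    (w : ℕ → Ω → EuclideanSpace ℝ (Fin d)) (k : ℕ) (ω : Ω) (i : Fin m) : ℝ :=
  deriv (smoothed (g i) (smoothParam β₀ k)) (mv A (iter w k ω) i)

/-- The increments that dominate the change of the gradient of the smoothed function, up to the
change of the gradients at the point `u`. -/
noncomputable def incG (A : Matrix (Fin m) (Fin d) ℝ) (β₀ : ℝ) (u : EuclideanSpace ℝ (Fin d))
    (w : ℕ → Ω → EuclideanSpace ℝ (Fin d)) (k : ℕ) (ω : Ω) (i : Fin m) : ℝ :=
  1 / smoothParam β₀ k * |mv A (w (k + 1) ω - iter w k ω) i|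
    + (1 / smoothParam β₀ (k + 1) - 1 / smoothParam β₀ k) * |mv A (w (k + 1) ω - u) i|

/-- An upper bound for `m` times the error of the estimator `γ`, up to the change of the gradients
at the point `u`. -/
noncomputable def errG (g : Fin m → ℝ → EReal) (A : Matrix (Fin m) (Fin d) ℝ) (β₀ : ℝ)
    (u w₁ : EuclideanSpace ℝ (Fin d)) (γ₀ : Fin m → ℝ) (l : ℕ → Ω → Fin m)
    (w : ℕ → Ω → EuclideanSpace ℝ (Fin d)) : ℕ → Ω → Fin m → ℝ :=
  stale l (fun i => m * |gradG g A β₀ w₁ i - γ₀ i|) (incG A β₀ u w)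

theorem one_div_smoothParam_mono {β₀ : ℝ} (hβ₀ : 0 < β₀) {a b : ℕ} (h : a ≤ b) :
    1 / smoothParam β₀ a ≤ 1 / smoothParam β₀ b :=
  one_div_le_one_div_of_le (smoothParam_pos hβ₀ b) (smoothParam_antitone hβ₀ h)

theorem incG_nonneg {A : Matrix (Fin m) (Fin d) ℝ} {β₀ : ℝ} (hβ₀ : 0 < β₀)
    (u : EuclideanSpace ℝ (Fin d)) (w : ℕ → Ω → EuclideanSpace ℝ (Fin d)) (k : ℕ) (ω : Ω)
    (i : Fin m) : 0 ≤ incG A β₀ u w k ω i := by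
  have := smoothParam_pos hβ₀ k
  exact add_nonneg (by positivity) (mul_nonneg
    (sub_nonneg.2 (one_div_smoothParam_mono hβ₀ (Nat.le_succ k))) (abs_nonneg _))

variable [mΩ : MeasurableSpace Ω] {μ : Measure Ω} {ℱ : Filtration ℕ mΩ}
  {W : Set (EuclideanSpace ℝ (Fin d))} {f : Fin n → ℝ → ℝ} {X : Matrix (Fin n) (Fin d) ℝ}
  {w₁ : EuclideanSpace ℝ (Fin d)} {α₀ : Fin n → ℝ} {j : ℕ → Ω → Fin n} {α : ℕ → Ω → Fin n → ℝ}
  {vf vg s w : ℕ → Ω → EuclideanSpace ℝ (Fin d)} {A : Matrix (Fin m) (Fin d) ℝ} {β₀ : ℝ}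
  {g : Fin m → ℝ → EReal} {γ₀ : Fin m → ℝ} {l : ℕ → Ω → Fin m} {γ : ℕ → Ω → Fin m → ℝ}

/-- The left side measures everything that has happened to a coordinate since its last refresh at
time `k - age`: the error stored then, the movement of the iterate at the old parameter, and the
parameter change seen from `u`. Before the first refresh the reference time is `0`, so only the
initial error is stored. -/
theorem IsVariantTwo.staleness_le (hv : IsVariantTwo μ ℱ g A β₀ γ₀ l γ vg w)
    (h : IsRun μ ℱ W f X w₁ α₀ j α vf vg s w) (hβ₀ : 0 < β₀)
    (u : EuclideanSpace ℝ (Fin d)) (k : ℕ) (ω : Ω) (i : Fin m) :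
    |dualG g A β₀ w (k - age l k ω i) ω i - m * γ k ω i|
      + 1 / smoothParam β₀ (k - age l k ω i)
        * |mv A (iter w k ω - iter w (k - age l k ω i) ω) i|
      + (1 / smoothParam β₀ k - 1 / smoothParam β₀ (k - age l k ω i)) * |mv A (iter w k ω - u) i|
      ≤ errG g A β₀ u w₁ γ₀ l w k ω i := by
  have hm : (m : ℝ) ≠ 0 := by
    have : 0 < m := Fin.pos i
    exact_mod_cast this.ne'
  have hz : mv A 0 = 0 := map_zero _
  have hcancel : ∀ x : ℝ, m * (1 / (m : ℝ) * x) = x := fun x => by field_simp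
  induction k with
  | zero =>
    simp only [Nat.zero_sub, sub_self, hz, zero_mul, add_zero, PiLp.zero_apply, abs_zero, mul_zero]
    rw [hv.init_γ]
    change _ ≤ m * |gradG g A β₀ w₁ i - γ₀ i|
    have e : (m : ℝ) = |(m : ℝ)| := (abs_of_nonneg (Nat.cast_nonneg m)).symm
    rw [show (m : ℝ) * |gradG g A β₀ w₁ i - γ₀ i| = |m * gradG g A β₀ w₁ i - m * γ₀ i| by
      rw [← mul_sub, abs_mul, ← e]]
    rw [gradG, hcancel, dualG, iter_zero, h.init_w, smoothParam_zero]
  | succ k ih =>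
    rw [errG, stale_succ, hv.γ_step, age_succ]
    split_ifs with hl
    · simp only [Nat.sub_zero, sub_self, hz, PiLp.zero_apply, abs_zero, mul_zero, zero_mul,
        add_zero]
      rw [hl, Function.update_self, gradG, hcancel, dualG, iter_succ, sub_self, abs_zero]
    · rw [Function.update_of_ne (Ne.symm hl), Nat.add_sub_add_right, iter_succ]
      set T := k - age l k ω i with hT
      have ih' : _ ≤ stale l _ _ k ω i := ih
      have hTk : T ≤ k := Nat.sub_le _ _
      have hb1 := one_div_smoothParam_mono hβ₀ hTk
      have hb2 := smoothParam_pos hβ₀ T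
      have hb3 : 0 ≤ 1 / smoothParam β₀ T := by positivity
      have t1 : |mv A (w (k + 1) ω - iter w T ω) i|
          ≤ |mv A (w (k + 1) ω - iter w k ω) i| + |mv A (iter w k ω - iter w T ω) i| := by
        simp only [mv_sub, PiLp.sub_apply]
        exact abs_sub_le _ _ _
      have t2 : |mv A (w (k + 1) ω - u) i|
          ≤ |mv A (w (k + 1) ω - iter w k ω) i| + |mv A (iter w k ω - u) i| := by
        simp only [mv_sub, PiLp.sub_apply]
        exact abs_sub_le _ _ _
      -- The weights `1/β_T` and `1/β_k - 1/β_T` of the last movement add up to `1/β_k`, which is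
      -- exactly the weight in `incG`.
      have t3 := mul_le_mul_of_nonneg_left t1 hb3
      have t4 := mul_le_mul_of_nonneg_left t2 (sub_nonneg.2 hb1)
      have e : incG A β₀ u w k ω i = 1 / smoothParam β₀ k * |mv A (w (k + 1) ω - iter w k ω) i|
        + (1 / smoothParam β₀ (k + 1) - 1 / smoothParam β₀ k) * |mv A (w (k + 1) ω - u) i| := rfl
      rw [e]
      linarith

/-- Comparing the gradients at the two times costs `(1 - β_k/β_T)|y|` for the current gradient `y`.
Bounding `|y|` by the gradient at `u` plus `1/β_k` times a distance separates a deterministic,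
possibly large factor from terms already collected in `errG`. -/
theorem IsVariantTwo.abs_dualG_sub_le (hv : IsVariantTwo μ ℱ g A β₀ γ₀ l γ vg w)
    (h : IsRun μ ℱ W f X w₁ α₀ j α vf vg s w) (hβ₀ : 0 < β₀)
    (hg : ∀ i, IsProperClosedConvex (g i)) (u : EuclideanSpace ℝ (Fin d)) (k : ℕ) (ω : Ω)
    (i : Fin m) :
    |dualG g A β₀ w k ω i - m * γ k ω i|
      ≤ errG g A β₀ u w₁ γ₀ l w k ω i
        + age l k ω i / ((k : ℝ) + 1)
          * |deriv (smoothed (g i) (smoothParam β₀ k)) (mv A u i)| := by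
  have h0 := hv.staleness_le h hβ₀ u k ω i
  set T := k - age l k ω i with hT
  have hTk : T ≤ k := Nat.sub_le _ _
  have hβ := smoothParam_pos hβ₀ k
  have hβT := smoothParam_pos hβ₀ T
  have hanti := smoothParam_antitone hβ₀ hTk
  have hy := (hg i).isSmoothedGrad_deriv hβ (mv A (iter w k ω) i)
  have hyT := (hg i).isSmoothedGrad_deriv hβT (mv A (iter w T ω) i)
  have hY := (hg i).isSmoothedGrad_deriv hβ (mv A u i)
  have h1 := hy.mul_norm_sub_le hyT
  have h2 := hy.mul_norm_sub_le hY
  simp only [Real.norm_eq_abs, sub_self, abs_zero, zero_mul, add_zero] at h1 h2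
  rw [abs_of_nonneg (sub_nonneg.2 hanti)] at h1
  have hκ := one_sub_smoothParam_div_le hβ₀ hTk
  have hage : k - T = age l k ω i := by
    have := age_le (j := l) k ω i
    omega
  rw [hage] at hκ
  simp only [mv_sub, PiLp.sub_apply] at h0
  change |dualG g A β₀ w k ω i - m * γ k ω i| ≤ _
  have hd1 : deriv (smoothed (g i) (smoothParam β₀ k)) (mv A (iter w k ω) i)
    = dualG g A β₀ w k ω i := rfl
  have hd2 : deriv (smoothed (g i) (smoothParam β₀ T)) (mv A (iter w T ω) i)
    = dualG g A β₀ w T ω i := rfl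
  rw [hd1] at h1 h2
  rw [hd2] at h1
  set y := dualG g A β₀ w k ω i
  set yT := dualG g A β₀ w T ω i
  set Y := deriv (smoothed (g i) (smoothParam β₀ k)) (mv A u i)
  set β := smoothParam β₀ k
  set βT := smoothParam β₀ T
  set ζ := |mv A (iter w k ω) i - mv A u i|
  set δ := |mv A (iter w k ω) i - mv A (iter w T ω) i|
  have t1 : |y - yT| ≤ 1 / βT * δ + (1 - β / βT) * |y| := by
    have := div_le_div_of_nonneg_right h1 hβT.le
    rw [mul_div_cancel_left₀ _ hβT.ne'] at this
    refine this.trans (le_of_eq ?_)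
    field_simp
  have t2 : |y| ≤ |Y| + 1 / β * ζ := by
    have := div_le_div_of_nonneg_right h2 hβ.le
    rw [mul_div_cancel_left₀ _ hβ.ne'] at this
    have h3 : |y| ≤ |y - Y| + |Y| := by
      have := abs_add_le (y - Y) Y
      rwa [sub_add_cancel] at this
    have : |y - Y| ≤ 1 / β * ζ := by rw [one_div_mul_eq_div]; exact this
    linarith
  have hκ0 : 0 ≤ 1 - β / βT := by rw [sub_nonneg, div_le_one hβT]; exact hanti
  have t3 := mul_le_mul_of_nonneg_left t2 hκ0
  have e : (1 - β / βT) * (|Y| + 1 / β * ζ) = (1 - β / βT) * |Y| + (1 / β - 1 / βT) * ζ := by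
    field_simp
  have t4 := mul_le_mul_of_nonneg_right hκ (abs_nonneg Y)
  have t5 := abs_sub_le y yT (m * γ k ω i)
  linarith

theorem IsRun.measurable_incG (h : IsRun μ ℱ W f X w₁ α₀ j α vf vg s w)
    (u : EuclideanSpace ℝ (Fin d)) (k : ℕ) (i : Fin m) :
    Measurable[ℱ k] fun ω => incG A β₀ u w k ω i :=
  ((measurable_abs_mv A ((h.w_measurable k).sub (h.iter_measurable k)) i).const_mul _).add
    ((measurable_abs_mv A ((h.w_measurable k).sub measurable_const) i).const_mul _)

/-- The movement of the iterates contributes `2`, from `√(k+1) · 2/(k+1)`, and the growth of `1/β_k`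
contributes `1/2`, from the increment of the square root. -/
theorem IsRun.sum_incG_le (h : IsRun μ ℱ W f X w₁ α₀ j α vf vg s w) (hWc : IsCompact W)
    (hW : Convex ℝ W) (hw₁ : w₁ ∈ W) (hβ₀ : 0 < β₀) {u : EuclideanSpace ℝ (Fin d)} (hu : u ∈ W)
    (k : ℕ) (ω : Ω) :
    ∑ i, incG A β₀ u w k ω i ≤ 5 / 2 * diamOne W A / β₀ / √((k : ℝ) + 1) := by
  have hk : (0 : ℝ) < (k : ℝ) + 1 := by positivity
  have h1 := h.sum_abs_mv_iter_sub_le hWc hW hw₁ A k ω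
  have h2 := sum_abs_mv_le_diamOne A hWc (h.w_mem hW hw₁ k ω) hu
  have hD := diamOne_nonneg A hWc ⟨w₁, hw₁⟩
  simp only [incG, Finset.sum_add_distrib, ← Finset.mul_sum]
  rw [one_div_smoothParam, one_div_smoothParam]
  push_cast
  have h3 := sqrt_succ_sub_sqrt_le hk
  have hmono : √((k : ℝ) + 1) ≤ √((k : ℝ) + 1 + 1) := Real.sqrt_le_sqrt (by linarith)
  have hs : 0 < √((k : ℝ) + 1) := Real.sqrt_pos.2 hk
  have hsq := Real.sq_sqrt hk.le
  set a := √((k : ℝ) + 1)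
  set b := √((k : ℝ) + 1 + 1)
  have h4 : a / β₀ * ∑ i, |mv A (w (k + 1) ω - iter w k ω) i|
      ≤ a / β₀ * (2 / ((k : ℝ) + 1) * diamOne W A) :=
    mul_le_mul_of_nonneg_left h1 (by positivity)
  have h5 : (b / β₀ - a / β₀) * ∑ i, |mv A (w (k + 1) ω - u) i|
      ≤ (1 / (2 * a)) / β₀ * diamOne W A := by
    rw [← sub_div]
    refine mul_le_mul (div_le_div_of_nonneg_right h3 hβ₀.le) h2
      (Finset.sum_nonneg fun i _ => abs_nonneg _) (by positivity)
  have e : a / β₀ * (2 / ((k : ℝ) + 1) * diamOne W A) + (1 / (2 * a)) / β₀ * diamOne W A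
      = 5 / 2 * diamOne W A / β₀ / a := by
    rw [← hsq]; field_simp; norm_num
  linarith

theorem IsRun.abs_incG_le (h : IsRun μ ℱ W f X w₁ α₀ j α vf vg s w) (hWc : IsCompact W)
    (hW : Convex ℝ W) (hw₁ : w₁ ∈ W) (hβ₀ : 0 < β₀) {u : EuclideanSpace ℝ (Fin d)} (hu : u ∈ W)
    (k : ℕ) (ω : Ω) (i : Fin m) :
    |incG A β₀ u w k ω i| ≤ 5 / 2 * diamOne W A / β₀ / √((k : ℝ) + 1) := by
  rw [abs_of_nonneg (incG_nonneg hβ₀ u w k ω i)]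
  exact (Finset.single_le_sum (fun i _ => incG_nonneg hβ₀ u w k ω i) (Finset.mem_univ i)).trans
    (h.sum_incG_le hWc hW hw₁ hβ₀ hu k ω)

theorem IsVariantTwo.integrable_errG [IsProbabilityMeasure μ]
    (hv : IsVariantTwo μ ℱ g A β₀ γ₀ l γ vg w)
    (h : IsRun μ ℱ W f X w₁ α₀ j α vf vg s w) (hWc : IsCompact W)
    (hW : Convex ℝ W) (hw₁ : w₁ ∈ W) (hβ₀ : 0 < β₀) {u : EuclideanSpace ℝ (Fin d)} (hu : u ∈ W)
    (k : ℕ) : Integrable (fun ω => ∑ i, errG g A β₀ u w₁ γ₀ l w k ω i) μ :=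
  integrable_finsetSum _ fun i _ => stale_integrable hv.sampling (h.measurable_incG u)
    (fun k ω i => h.abs_incG_le hWc hW hw₁ hβ₀ hu k ω i) k i

theorem IsVariantTwo.integral_errG_succ_le [IsProbabilityMeasure μ]
    (hv : IsVariantTwo μ ℱ g A β₀ γ₀ l γ vg w)
    (h : IsRun μ ℱ W f X w₁ α₀ j α vf vg s w) (hWc : IsCompact W)
    (hW : Convex ℝ W) (hw₁ : w₁ ∈ W) (hβ₀ : 0 < β₀) {u : EuclideanSpace ℝ (Fin d)} (hu : u ∈ W)
    (hm : 1 ≤ m) (k : ℕ) :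
    ∫ ω, ∑ i, errG g A β₀ u w₁ γ₀ l w (k + 1) ω i ∂μ
      ≤ (1 - 1 / (m : ℝ)) ^ (k + 1) * (m * ∑ i, |gradG g A β₀ w₁ i - γ₀ i|)
        + 2 * m * (5 / 2 * diamOne W A / β₀) / √((k : ℝ) + 1) := by
  have hm' : (1 : ℝ) ≤ m := by exact_mod_cast hm
  have hD := diamOne_nonneg A hWc ⟨w₁, hw₁⟩
  refine le_of_sqrt_forcing (r := fun k => ∫ ω, ∑ i, errG g A β₀ u w₁ γ₀ l w k ω i ∂μ) hm'
    (by positivity) ?_ (fun k => ?_) k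
  · simp [errG, stale, Finset.mul_sum]
  · have h1 := integral_sum_stale_succ_le (μ := μ) (r₀ := fun i => m * |gradG g A β₀ w₁ i - γ₀ i|)
      hv.sampling (h.measurable_incG u)
      (fun k ω i => h.abs_incG_le hWc hW hw₁ hβ₀ hu k ω i) (k := k)
      (fun ω => h.sum_incG_le (A := A) hWc hW hw₁ hβ₀ hu k ω) hm
    refine h1.trans ?_
    rw [mul_add]
    refine add_le_add le_rfl (mul_le_mul_of_nonneg_right (by linarith) (by positivity))

end VariantTwo

/-! ### Finite values of separable functions -/

theorem sum_ne_bot {ι : Type*} (t : Finset ι) {a : ι → EReal} (h : ∀ i, a i ≠ ⊥) :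
    ∑ i ∈ t, a i ≠ ⊥ :=
  Finset.sum_induction a (· ≠ ⊥) (fun _ _ hx hy => EReal.add_ne_bot_iff.2 ⟨hx, hy⟩)
    EReal.zero_ne_bot fun i _ => h i

theorem exists_values_of_separable {m : ℕ} (hm : 1 ≤ m) {g : Fin m → ℝ → EReal}
    (hbot : ∀ i x, g i x ≠ ⊥) {z : EuclideanSpace ℝ (Fin m)} (hz : separable g z ≠ ⊤) :
    ∃ r : Fin m → ℝ, (∀ i, g i (z i) = r i) ∧
      separable g z = ((1 / (m : ℝ) * ∑ i, r i : ℝ) : EReal) := by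
  have hm' : (0 : ℝ) < 1 / (m : ℝ) := by
    have : (0 : ℝ) < m := by exact_mod_cast hm
    positivity
  have ht : ∀ i, g i (z i) ≠ ⊤ := by
    intro i hi
    apply hz
    rw [separable, ← Finset.add_sum_erase _ _ (Finset.mem_univ i), hi,
      EReal.top_add_of_ne_bot (sum_ne_bot _ fun i => hbot i _), EReal.coe_mul_top_of_pos hm']
  have hr : ∀ i, g i (z i) = ((g i (z i)).toReal : EReal) :=
    fun i => (EReal.coe_toReal (ht i) (hbot i _)).symm
  refine ⟨fun i => (g i (z i)).toReal, hr, ?_⟩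
  have hs : ∀ t : Finset (Fin m), ∑ i ∈ t, g i (z i) = ((∑ i ∈ t, (g i (z i)).toReal : ℝ) : EReal) := by
    intro t
    induction t using Finset.induction_on with
    | empty => simp
    | insert a t ha ih => rw [Finset.sum_insert ha, Finset.sum_insert ha, ih, EReal.coe_add, ← hr]
  rw [separable, hs, EReal.coe_mul]

theorem separable_ne_bot {m : ℕ} {g : Fin m → ℝ → EReal} (hbot : ∀ i x, g i x ≠ ⊥)
    (z : EuclideanSpace ℝ (Fin m)) : separable g z ≠ ⊥ := by
  intro h
  have h1 : (0 : ℝ) ≤ 1 / (m : ℝ) := by positivity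
  rcases h1.eq_or_lt with h0 | h0
  · rw [separable, ← h0] at h
    simp at h
  · have hs := sum_ne_bot Finset.univ fun i => hbot i (z i)
    rw [separable] at h
    generalize ∑ i, g i (z i) = x at h hs
    induction x with
    | bot => exact hs rfl
    | coe x => rw [← EReal.coe_mul] at h; exact EReal.coe_ne_bot _ h
    | top => rw [EReal.coe_mul_top_of_pos h0] at h; exact top_ne_bot h

/-- The stale part of the error of the estimator is compensated by the decrease that comes from the
smoothing. -/
theorem mul_sub_sq_le {e y Y R κ Δ ζ D β c : ℝ} (hβ : 0 < β) (hc : 0 < c) (hc1 : c ≤ 1)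
    (hR : 0 ≤ R) (he : |e| ≤ R + κ * |Y|) (hY : |Y| ≤ |y| + 1 / β * |ζ|)
    (hΔ : |Δ| ≤ D) :
    e * Δ - 3 / 8 * β * y ^ 2
      ≤ D * R + c / β * (4 / 3 * Δ ^ 2 + 3 / 8 * ζ ^ 2) + 3 / 16 * (β / c) * (κ ^ 2 - c ^ 2) * Y ^ 2 := by
  have h1 : e * Δ ≤ R * D + κ * |Y| * |Δ| := by
    calc e * Δ ≤ |e| * |Δ| := by rw [← abs_mul]; exact le_abs_self _
      _ ≤ (R + κ * |Y|) * |Δ| := mul_le_mul_of_nonneg_right he (abs_nonneg _)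
      _ = R * |Δ| + κ * |Y| * |Δ| := by ring
      _ ≤ R * D + κ * |Y| * |Δ| := by gcongr
  have h2 : κ * |Y| * |Δ| ≤ 4 / 3 * (c / β) * Δ ^ 2 + 3 / 16 * (β / c) * κ ^ 2 * Y ^ 2 := by
    have : 4 / 3 * (c / β) * Δ ^ 2 + 3 / 16 * (β / c) * κ ^ 2 * Y ^ 2 - κ * |Y| * |Δ|
        = 4 / 3 / (c * β) * (c * |Δ| - 3 / 8 * β * κ * |Y|) ^ 2 := by
      rw [← sq_abs Δ, ← sq_abs Y]; field_simp; ring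
    have h3 : 0 ≤ 4 / 3 / (c * β) * (c * |Δ| - 3 / 8 * β * κ * |Y|) ^ 2 := by positivity
    linarith
  -- Half of `Y²` is controlled by `y²`, so the reserve `-(3/8) c β y²` supplies the compensating
  -- `-(3/16) c β Y²`.
  have h3 : β * Y ^ 2 ≤ 2 * β * y ^ 2 + 2 / β * ζ ^ 2 := by
    have h4 : Y ^ 2 ≤ 2 * y ^ 2 + 2 * (1 / β * |ζ|) ^ 2 := by
      rw [← sq_abs Y, ← sq_abs y]
      have := pow_le_pow_left₀ (abs_nonneg Y) hY 2
      nlinarith [sq_nonneg (|y| - 1 / β * |ζ|)]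
    have h5 := mul_le_mul_of_nonneg_left h4 hβ.le
    rw [mul_pow, sq_abs] at h5
    have e1 : β * (2 * y ^ 2 + 2 * ((1 / β) ^ 2 * ζ ^ 2)) = 2 * β * y ^ 2 + 2 / β * ζ ^ 2 := by
      field_simp
    linarith
  have h6 : c * (β * y ^ 2) ≤ β * y ^ 2 := mul_le_of_le_one_left (by positivity) hc1
  have h7 := mul_le_mul_of_nonneg_left h3 hc.le
  have e2 : 3 / 16 * (β / c) * (κ ^ 2 - c ^ 2) * Y ^ 2
      = 3 / 16 * (β / c) * κ ^ 2 * Y ^ 2 - 3 / 16 * (c * (β * Y ^ 2)) := by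
    field_simp
  have e3 : c * (2 * β * y ^ 2 + 2 / β * ζ ^ 2) = 2 * (c * (β * y ^ 2)) + 2 * (c / β) * ζ ^ 2 := by
    ring
  rw [e2]
  rw [e3] at h7
  linarith

/-! ### Variant 2: estimator error in one iteration -/

section VariantTwo

variable {n m d : ℕ} {Ω : Type*} [mΩ : MeasurableSpace Ω] {μ : Measure Ω} {ℱ : Filtration ℕ mΩ}
  {W : Set (EuclideanSpace ℝ (Fin d))} {f : Fin n → ℝ → ℝ} {X : Matrix (Fin n) (Fin d) ℝ}
  {w₁ : EuclideanSpace ℝ (Fin d)} {α₀ : Fin n → ℝ} {j : ℕ → Ω → Fin n} {α : ℕ → Ω → Fin n → ℝ}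
  {vf vg s w : ℕ → Ω → EuclideanSpace ℝ (Fin d)} {A : Matrix (Fin m) (Fin d) ℝ} {β₀ : ℝ}
  {g : Fin m → ℝ → EReal} {γ₀ : Fin m → ℝ} {l : ℕ → Ω → Fin m} {γ : ℕ → Ω → Fin m → ℝ}

/-- `mul_sub_sq_le` is applied in each coordinate and summed. The constant `41/24` is `4/3 + 3/8`,
as both squared distances are bounded by the same product of diameters. The weight `c` stays free
because it can only be chosen after taking expectations of the ages. -/
theorem IsVariantTwo.error_le (hv : IsVariantTwo μ ℱ g A β₀ γ₀ l γ vg w)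
    (h : IsRun μ ℱ W f X w₁ α₀ j α vf vg s w) (hWc : IsCompact W)
    (hW : Convex ℝ W) (hw₁ : w₁ ∈ W) (hβ₀ : 0 < β₀) (hg : ∀ i, IsProperClosedConvex (g i))
    {u : EuclideanSpace ℝ (Fin d)} (hu : u ∈ W) {c : ℝ} (hc : 0 < c) (hc1 : c ≤ 1)
    (k : ℕ) (ω : Ω) :
    1 / (m : ℝ) * ∑ i, dualG g A β₀ w (k + 1) ω i * mv A (s (k + 1) ω - u) i
        - inner ℝ (vg (k + 1) ω) (s (k + 1) ω - u)
        - 3 / 8 * smoothParam β₀ (k + 1) * (1 / (m : ℝ) * ∑ i, dualG g A β₀ w (k + 1) ω i ^ 2)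
      ≤ 1 / (m : ℝ) * (diamInf W A * ∑ i, errG g A β₀ u w₁ γ₀ l w (k + 1) ω i
          + c / smoothParam β₀ (k + 1) * (41 / 24 * (diamOne W A * diamInf W A))
          + 3 / 16 * (smoothParam β₀ (k + 1) / c)
            * ∑ i, ((age l (k + 1) ω i / ((k : ℝ) + 2)) ^ 2 - c ^ 2)
              * deriv (smoothed (g i) (smoothParam β₀ (k + 1))) (mv A u i) ^ 2) := by
  have hβ := smoothParam_pos hβ₀ (k + 1)
  have hsc : ∀ i,
      (dualG g A β₀ w (k + 1) ω i - m * γ (k + 1) ω i) * mv A (s (k + 1) ω - u) i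
        - 3 / 8 * smoothParam β₀ (k + 1) * dualG g A β₀ w (k + 1) ω i ^ 2
      ≤ diamInf W A * errG g A β₀ u w₁ γ₀ l w (k + 1) ω i
        + c / smoothParam β₀ (k + 1) * (4 / 3 * mv A (s (k + 1) ω - u) i ^ 2
          + 3 / 8 * mv A (w (k + 1) ω - u) i ^ 2)
        + 3 / 16 * (smoothParam β₀ (k + 1) / c)
          * ((age l (k + 1) ω i / ((k : ℝ) + 2)) ^ 2 - c ^ 2)
          * deriv (smoothed (g i) (smoothParam β₀ (k + 1))) (mv A u i) ^ 2 := by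
    intro i
    have he := hv.abs_dualG_sub_le h hβ₀ hg u (k + 1) ω i
    push_cast at he
    rw [show (k : ℝ) + 1 + 1 = k + 2 by ring] at he
    refine mul_sub_sq_le hβ hc hc1 ?_ he ?_
      (abs_mv_le_diamInf A hWc (h.s_mem k ω) hu i)
    · exact stale_nonneg (fun _ => by positivity) (fun k ω i => incG_nonneg hβ₀ u w k ω i) _ _ _
    · have hy := (hg i).isSmoothedGrad_deriv hβ (mv A (iter w (k + 1) ω) i)
      have hY := (hg i).isSmoothedGrad_deriv hβ (mv A u i)
      have h2 := hY.mul_norm_sub_le hy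
      simp only [Real.norm_eq_abs, sub_self, abs_zero, zero_mul, add_zero] at h2
      rw [abs_sub_comm (mv A u i), ← le_div_iff₀' hβ, iter_succ] at h2
      rw [mv_sub, PiLp.sub_apply, one_div_mul_eq_div, dualG, iter_succ]
      have h3 := abs_sub_abs_le_abs_sub
        (deriv (smoothed (g i) (smoothParam β₀ (k + 1))) (mv A u i))
        (deriv (smoothed (g i) (smoothParam β₀ (k + 1))) (mv A (w (k + 1) ω) i))
      linarith
  have hm0 : (0 : ℝ) ≤ 1 / (m : ℝ) := by positivity
  have hs := mul_le_mul_of_nonneg_left (Finset.sum_le_sum fun i (_ : i ∈ Finset.univ) => hsc i) hm0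
  have hest := inner_estimator A (v := fun k => vg k ω) (a := fun k => γ k ω) (j := fun k => l k ω)
    (by rw [hv.init_vg, hv.init_γ]) (fun k => hv.γ_step k ω) (fun k => hv.vg_step k ω) (k + 1)
    (s (k + 1) ω - u)
  have h1 := sum_sq_mv_le A hWc (h.s_mem k ω) hu
  have h2 := sum_sq_mv_le A hWc (h.w_mem hW hw₁ k ω) hu
  have h3 : c / smoothParam β₀ (k + 1) * (4 / 3 * ∑ i, mv A (s (k + 1) ω - u) i ^ 2
      + 3 / 8 * ∑ i, mv A (w (k + 1) ω - u) i ^ 2)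
      ≤ c / smoothParam β₀ (k + 1) * (41 / 24 * (diamOne W A * diamInf W A)) :=
    mul_le_mul_of_nonneg_left (by linarith) (by positivity)
  have h4 := mul_le_mul_of_nonneg_left h3 hm0
  have e1 : ∑ i, (dualG g A β₀ w (k + 1) ω i - m * γ (k + 1) ω i) * mv A (s (k + 1) ω - u) i
      = ∑ i, dualG g A β₀ w (k + 1) ω i * mv A (s (k + 1) ω - u) i
        - m * inner ℝ (vg (k + 1) ω) (s (k + 1) ω - u) := by
    rw [hest, Finset.mul_sum, ← Finset.sum_sub_distrib]
    exact Finset.sum_congr rfl fun i _ => by ring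
  have e2 : 1 / (m : ℝ) * (m * inner ℝ (vg (k + 1) ω) (s (k + 1) ω - u))
      = inner ℝ (vg (k + 1) ω) (s (k + 1) ω - u) := by
    have : (m : ℝ) ≠ 0 := by
      have : 0 < m := Fin.pos (l 0 ω)
      exact_mod_cast this.ne'
    field_simp
  simp only [Finset.sum_add_distrib, Finset.sum_sub_distrib, ← Finset.mul_sum, mul_assoc] at hs
  rw [e1] at hs
  linarith

end VariantTwo

/-! ### Variant 2: one-step inequality and summation of its errors -/

section Assembly

variable {n m d : ℕ} {Ω : Type*} [mΩ : MeasurableSpace Ω] {μ : Measure Ω} {ℱ : Filtration ℕ mΩ}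
  {W : Set (EuclideanSpace ℝ (Fin d))} {f : Fin n → ℝ → ℝ} {X : Matrix (Fin n) (Fin d) ℝ}
  {w₁ : EuclideanSpace ℝ (Fin d)} {α₀ : Fin n → ℝ} {j : ℕ → Ω → Fin n} {α : ℕ → Ω → Fin n → ℝ}
  {vf vg s w : ℕ → Ω → EuclideanSpace ℝ (Fin d)} {A : Matrix (Fin m) (Fin d) ℝ} {β₀ : ℝ}

theorem IsRun.variantTwo_step (h : IsRun μ ℱ W f X w₁ α₀ j α vf vg s w) (hWc : IsCompact W)
    (hW : Convex ℝ W) (hw₁ : w₁ ∈ W) {L : ℝ≥0} (hc : ∀ i, ConvexOn ℝ Set.univ (f i))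
    (hd : ∀ i, Differentiable ℝ (f i)) (hL : ∀ i, LipschitzWith L (deriv (f i))) (hβ₀ : 0 < β₀)
    {g : Fin m → ℝ → EReal} (hg : ∀ i, IsProperClosedConvex (g i)) {γ₀ : Fin m → ℝ}
    {l : ℕ → Ω → Fin m} {γ : ℕ → Ω → Fin m → ℝ} (hv : IsVariantTwo μ ℱ g A β₀ γ₀ l γ vg w)
    {u : EuclideanSpace ℝ (Fin d)} (hu : u ∈ W) {r : Fin m → ℝ}
    (hr : ∀ i, g i (mv A u i) = r i) {c : ℝ} (hc0 : 0 < c) (hc1 : c ≤ 1) (k : ℕ) (ω : Ω) :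
    smoothedObjectiveSep f X g A (smoothParam β₀ (k + 1)) (w (k + 2) ω)
        - (smoothPart f X u + 1 / (m : ℝ) * ∑ i, r i)
      ≤ (1 - 2 / ((k : ℝ) + 2)) *
          (smoothedObjectiveSep f X g A (smoothParam β₀ k) (w (k + 1) ω)
            - (smoothPart f X u + 1 / (m : ℝ) * ∑ i, r i))
        + 2 / ((k : ℝ) + 2) * (diamInf W X * ∑ i, errF L f X w₁ α₀ j w (k + 1) ω i
          + 1 / (m : ℝ) * (diamInf W A * ∑ i, errG g A β₀ u w₁ γ₀ l w (k + 1) ω i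
            + c / smoothParam β₀ (k + 1) * (41 / 24 * (diamOne W A * diamInf W A))
            + 3 / 16 * (smoothParam β₀ (k + 1) / c)
              * ∑ i, ((age l (k + 1) ω i / ((k : ℝ) + 2)) ^ 2 - c ^ 2)
                * deriv (smoothed (g i) (smoothParam β₀ (k + 1))) (mv A u i) ^ 2))
        + 2 / ((k : ℝ) + 2) ^ 2 * (L / n * (opNorm X ^ 2 * Metric.diam W ^ 2)
          + opNorm A ^ 2 * Metric.diam W ^ 2 / β₀ * √((k : ℝ) + 2)) := by
  have hβ := smoothParam_pos hβ₀ (k + 1)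
  obtain ⟨hη, hη1⟩ := stepSize_mem k
  have hm : (1 : ℝ) ≤ m := by exact_mod_cast (Fin.pos (l 0 ω) : 0 < m)
  have hy : ∀ i, IsSmoothedGrad (g i) (smoothParam β₀ (k + 1)) (mv A (w (k + 1) ω) i)
      (dualG g A β₀ w (k + 1) ω i) := fun i => by
    rw [dualG, iter_succ]; exact (hg i).isSmoothedGrad_deriv hβ _
  have h1 := smoothPart_step hc hd hL X hη (w (k + 1) ω) (s (k + 1) ω) u
  have h2 := separable_step A hβ (smoothParam_pos hβ₀ k) hη hη1 (smoothParam_decrease_le hβ₀ k)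
    (w := w (k + 1) ω) (s := s (k + 1) ω) hy hr
  rw [← h.w_step k ω] at h1 h2
  have h3 := h.sum_gradF_le hWc hL hu k ω
  have h3' := hv.error_le h hWc hW hw₁ hβ₀ hg hu hc0 hc1 k ω
  have h4 := norm_mv_sq_le X hWc (h.s_mem k ω) (h.w_mem hW hw₁ k ω)
  have h5 : 1 / (m : ℝ) * ‖mv A (s (k + 1) ω - w (k + 1) ω)‖ ^ 2
      ≤ opNorm A ^ 2 * Metric.diam W ^ 2 := by
    refine (mul_le_of_le_one_left (by positivity) ?_).trans
      (norm_mv_sq_le A hWc (h.s_mem k ω) (h.w_mem hW hw₁ k ω))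
    rw [div_le_one (by linarith)]; exact hm
  have h7 := mul_le_mul_of_nonneg_left (add_le_add h3 h3') hη
  have h8 : stepSize (k + 1) ^ 2 / 2 * (L / n * ‖mv X (s (k + 1) ω - w (k + 1) ω)‖ ^ 2)
      ≤ stepSize (k + 1) ^ 2 / 2 * (L / n * (opNorm X ^ 2 * Metric.diam W ^ 2)) := by gcongr
  have h9 := mul_le_mul_of_nonneg_left h5
    (by positivity : 0 ≤ stepSize (k + 1) ^ 2 / (2 * smoothParam β₀ (k + 1)))
  rw [sq_div_two_mul_smoothParam_mul _ _ (opNorm A ^ 2 * Metric.diam W ^ 2)] at h9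
  rw [← stepSize_succ_sq_div_two, ← stepSize_succ]
  unfold smoothedObjectiveSep
  linarith

theorem continuous_smoothedObjective (hd : ∀ i, Differentiable ℝ (f i)) (hβ₀ : 0 < β₀)
    {g : EuclideanSpace ℝ (Fin m) → EReal} (hg : IsProperClosedConvex g) (k : ℕ) :
    Continuous (smoothedObjective f X g A (smoothParam β₀ k)) :=
  (continuous_smoothPart hd).add ((continuous_smoothed (smoothParam_pos hβ₀ k)
    (hg.exists_isSmoothedGrad (smoothParam_pos hβ₀ k))).comp (continuous_mv A))

theorem continuous_smoothedObjectiveSep (hd : ∀ i, Differentiable ℝ (f i)) (hβ₀ : 0 < β₀)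
    {g : Fin m → ℝ → EReal} (hg : ∀ i, IsProperClosedConvex (g i)) (k : ℕ) :
    Continuous (smoothedObjectiveSep f X g A (smoothParam β₀ k)) :=
  (continuous_smoothPart hd).add (continuous_const.mul (continuous_finsetSum _ fun i _ =>
    (continuous_smoothed (smoothParam_pos hβ₀ k)
      ((hg i).exists_isSmoothedGrad (smoothParam_pos hβ₀ k))).comp (continuous_mv_coord A i)))

/-- The weight of the stale part of the error of the estimator `γ`. -/
noncomputable def staleWeight (m k : ℕ) : ℝ := min 1 (17 / 12 * m / ((k : ℝ) + 2))

theorem staleWeight_pos {m : ℕ} (hm : 1 ≤ m) (k : ℕ) : 0 < staleWeight m k := by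
  have : (1 : ℝ) ≤ m := by exact_mod_cast hm
  exact lt_min one_pos (by positivity)

/-- When the minimum in `staleWeight` is `1`, it suffices that the age is at most `k + 1`. Otherwise
the bound `2m²` for the second moment is used, and `17/12` is a rational upper bound for `√2`. -/
theorem IsUniformSampling.integral_age_div_sq_le [IsProbabilityMeasure μ] {l : ℕ → Ω → Fin m}
    (hl : IsUniformSampling μ ℱ l) (k : ℕ) (i : Fin m) :
    ∫ ω, (age l (k + 1) ω i / ((k : ℝ) + 2)) ^ 2 ∂μ ≤ staleWeight m k ^ 2 := by
  have hint := integrable_age_sq (μ := μ) hl (k + 1) i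
  simp_rw [div_pow]
  rw [integral_div]
  have hk : (0 : ℝ) < (k : ℝ) + 2 := by positivity
  rw [div_le_iff₀ (by positivity), ← mul_pow]
  rcases le_total 1 (17 / 12 * m / ((k : ℝ) + 2)) with h | h
  · rw [staleWeight, min_eq_left h, one_mul]
    calc ∫ ω, (age l (k + 1) ω i : ℝ) ^ 2 ∂μ ≤ ∫ _, ((k : ℝ) + 2) ^ 2 ∂μ := by
          refine integral_mono hint (integrable_const _) fun ω => ?_
          have : (age l (k + 1) ω i : ℝ) ≤ ((k + 1 : ℕ) : ℝ) := Nat.cast_le.2 (age_le _ _ _)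
          push_cast at this
          exact pow_le_pow_left₀ (by positivity) (by linarith) 2
      _ = ((k : ℝ) + 2) ^ 2 := by simp
  · rw [staleWeight, min_eq_right h, div_mul_cancel₀ _ hk.ne']
    have := integral_age_sq_le (μ := μ) hl (k + 1) i
    nlinarith [sq_nonneg (m : ℝ)]

/-- The error terms of Variant 2 sum to the constants of the theorem. -/
theorem two_mul_succ_mul_error_le {m : ℕ} (hm : 1 ≤ m) {β₀ D₁ D r e : ℝ} (hβ₀ : 0 < β₀)
    (hD₁ : 0 ≤ D₁) (hD : 0 ≤ D) (k : ℕ)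
    (hr : r ≤ (1 - 1 / (m : ℝ)) ^ (k + 1) * e + 2 * m * (5 / 2 * D₁ / β₀) / √((k : ℝ) + 1)) :
    2 * ((k : ℝ) + 1) * (1 / (m : ℝ) * (D * r
        + staleWeight m k / smoothParam β₀ (k + 1) * (41 / 24 * (D₁ * D))))
      ≤ (10 + 697 / 144) * (D₁ * D / β₀) * √((k : ℝ) + 1)
        + 2 * D / m * (((k : ℝ) + 1) * ((1 - 1 / (m : ℝ)) ^ (k + 1) * e)) := by
  have hm' : (0 : ℝ) < m := by exact_mod_cast hm
  have hk : (0 : ℝ) ≤ k := Nat.cast_nonneg k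
  have ha : 0 < √((k : ℝ) + 1) := Real.sqrt_pos.2 (by linarith)
  have hb : 0 < √((k : ℝ) + 2) := Real.sqrt_pos.2 (by linarith)
  have h1 := Real.sq_sqrt (by linarith : 0 ≤ (k : ℝ) + 1)
  have h2 := Real.sq_sqrt (by linarith : 0 ≤ (k : ℝ) + 2)
  have hab : √((k : ℝ) + 1) ≤ √((k : ℝ) + 2) := Real.sqrt_le_sqrt (by linarith)
  have e0 : staleWeight m k / smoothParam β₀ (k + 1)
      = staleWeight m k * (√((k : ℝ) + 2) / β₀) := by
    have := one_div_smoothParam β₀ (k + 1)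
    push_cast at this
    rw [show (k : ℝ) + 1 + 1 = k + 2 by ring] at this
    rw [← this, mul_one_div]
  rw [e0]
  have hs : staleWeight m k ≤ 17 / 12 * m / ((k : ℝ) + 2) := min_le_right _ _
  set a := √((k : ℝ) + 1)
  set b := √((k : ℝ) + 2)
  have p1 : 2 * ((k : ℝ) + 1) * (1 / (m : ℝ) * (D * r))
      ≤ 2 * ((k : ℝ) + 1) * (1 / (m : ℝ) * (D * ((1 - 1 / (m : ℝ)) ^ (k + 1) * e
        + 2 * m * (5 / 2 * D₁ / β₀) / a))) := by gcongr
  have e1 : 2 * ((k : ℝ) + 1) * (1 / (m : ℝ) * (D * ((1 - 1 / (m : ℝ)) ^ (k + 1) * e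
        + 2 * m * (5 / 2 * D₁ / β₀) / a)))
      = 2 * D / m * (((k : ℝ) + 1) * ((1 - 1 / (m : ℝ)) ^ (k + 1) * e))
        + 10 * (D₁ * D / β₀) * a := by
    have : 2 * ((k : ℝ) + 1) * (1 / (m : ℝ) * (D * (2 * m * (5 / 2 * D₁ / β₀) / a)))
        = 10 * (D₁ * D / β₀) * a := by
      rw [← h1]; field_simp; ring
    rw [← this]; ring
  -- Only the branch `17/12 · m/(k+2)` of the weight matters here: its `m` cancels the average, and
  -- `2 · 17/12 · 41/24 = 697/144`.
  have p2 : 2 * ((k : ℝ) + 1) * (1 / (m : ℝ) * (staleWeight m k * (b / β₀)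
        * (41 / 24 * (D₁ * D))))
      ≤ 2 * ((k : ℝ) + 1) * (1 / (m : ℝ) * (17 / 12 * m / ((k : ℝ) + 2) * (b / β₀)
        * (41 / 24 * (D₁ * D)))) := by gcongr
  have e2 : 2 * ((k : ℝ) + 1) * (1 / (m : ℝ) * (17 / 12 * m / ((k : ℝ) + 2) * (b / β₀)
        * (41 / 24 * (D₁ * D))))
      = 697 / 144 * (D₁ * D / β₀) * (((k : ℝ) + 1) / (k + 2) * b) := by
    field_simp; ring
  have p3 : ((k : ℝ) + 1) / (k + 2) * b ≤ a := by
    rw [div_mul_eq_mul_div, div_le_iff₀ (by positivity)]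
    nlinarith [mul_nonneg (mul_nonneg ha.le hb.le) (sub_nonneg.2 hab)]
  have p4 := mul_le_mul_of_nonneg_left p3 (by positivity : 0 ≤ 697 / 144 * (D₁ * D / β₀))
  linarith

open Finset in
-- The geometric sequence satisfies the reset recursion with zero forcing, so `weighted_sum_le` sums
-- it. With `e` equal to `m` times the initial error this yields the `m²` in the last constant.
theorem sum_geometric_error_le {m : ℕ} (hm : 1 ≤ m) {D e : ℝ} (hD : 0 ≤ D) (he : 0 ≤ e) (K : ℕ) :
    ∑ k ∈ range K, 2 * D / m * (((k : ℝ) + 1) * ((1 - 1 / (m : ℝ)) ^ (k + 1) * e))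
      ≤ 2 * D * m * e := by
  have hm' : (1 : ℝ) ≤ m := by exact_mod_cast hm
  have hm0 : (0 : ℝ) < m := by linarith
  have hρ : 0 ≤ 1 - 1 / (m : ℝ) := by
    rw [sub_nonneg, div_le_one hm0]; exact hm'
  have h := weighted_sum_le (i := fun _ => 0) hm' (u := fun k => (1 - 1 / (m : ℝ)) ^ k * e)
    (fun k => by positivity) (fun k => by
      rw [pow_succ, add_zero]
      refine le_of_eq ?_
      have : (m : ℝ) * (1 - 1 / (m : ℝ)) = m - 1 := by field_simp
      rw [← this]; ring) K
  simp only [mul_zero, sum_const_zero, zero_add, add_zero, pow_zero, one_mul] at h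
  rw [← mul_sum]
  refine (mul_le_mul_of_nonneg_left h (by positivity)).trans ?_
  have e1 : 2 * D / m * ((m - 1) * (m * e)) = 2 * D * m * e - 2 * D * e := by
    field_simp
  rw [e1]
  have : 0 ≤ 2 * D * e := by positivity
  linarith

end Assembly

/-! ### Passage to expectations and the final constants -/

section Rates

variable {n m d : ℕ} {Ω : Type*} [mΩ : MeasurableSpace Ω] {μ : Measure Ω} [IsProbabilityMeasure μ]
  {ℱ : Filtration ℕ mΩ}
  {W : Set (EuclideanSpace ℝ (Fin d))} {f : Fin n → ℝ → ℝ} {X : Matrix (Fin n) (Fin d) ℝ}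
  {w₁ : EuclideanSpace ℝ (Fin d)} {α₀ : Fin n → ℝ} {j : ℕ → Ω → Fin n} {α : ℕ → Ω → Fin n → ℝ}
  {vf vg s w : ℕ → Ω → EuclideanSpace ℝ (Fin d)} {A : Matrix (Fin m) (Fin d) ℝ} {β₀ : ℝ}

omit [IsProbabilityMeasure μ] in
theorem integral_mul_add_mul_add {P Q R : Ω → ℝ} (hP : Integrable P μ) (hQ : Integrable Q μ)
    (hR : Integrable R μ) (a b : ℝ) :
    ∫ ω, (a * P ω + b * (Q ω + R ω)) ∂μ = a * ∫ ω, P ω ∂μ + b * (∫ ω, Q ω ∂μ + ∫ ω, R ω ∂μ) := by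
  have h2 : Integrable (fun ω => b * (Q ω + R ω)) μ := (hQ.add hR).const_mul b
  rw [integral_add (hP.const_mul a) h2, integral_const_mul, integral_const_mul, integral_add hQ hR]

theorem integral_add_const' {P : Ω → ℝ} (hP : Integrable P μ) (c : ℝ) :
    ∫ ω, (P ω + c) ∂μ = ∫ ω, P ω ∂μ + c := by
  rw [integral_add hP (integrable_const c)]
  simp

/-- The expected gap of a run whose nonsmooth part contributes the random errors `Z k`. -/
theorem IsRun.integral_gap_le (h : IsRun μ ℱ W f X w₁ α₀ j α vf vg s w) (hWc : IsCompact W)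
    (hW : Convex ℝ W) (hw₁ : w₁ ∈ W) {L : ℝ≥0} {gap Z : ℕ → Ω → ℝ} {E e : ℕ → ℝ} {LX LA B Ce : ℝ}
    (hLX : 0 ≤ LX) (hLA : 0 ≤ LA) (hB : 0 ≤ B) (hCe : 0 ≤ Ce)
    (hgap : ∀ k, Integrable (gap k) μ) (hZ : ∀ k, Integrable (Z k) μ)
    (hZE : ∀ k, ∫ ω, Z k ω ∂μ ≤ E k)
    (hE : ∀ k : ℕ, 2 * ((k : ℝ) + 1) * E k ≤ B * √((k : ℝ) + 1) + e k)
    (he : ∀ K, ∑ k ∈ Finset.range K, e k ≤ Ce)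
    (hstep : ∀ k ω, gap (k + 1) ω ≤ (1 - 2 / ((k : ℝ) + 2)) * gap k ω
      + 2 / ((k : ℝ) + 2) * (diamInf W X * ∑ i, errF L f X w₁ α₀ j w (k + 1) ω i + Z k ω)
      + 2 / ((k : ℝ) + 2) ^ 2 * (LX + LA * √((k : ℝ) + 2))) {K : ℕ} (hK : 1 ≤ K) :
    ∫ ω, gap K ω ∂μ ≤ 2 / 3 * (2 * LA + B) / √K
      + (8 * L * diamOne W X * diamInf W X + 2 * LX) / K
      + (2 * n ^ 2 * diamInf W X * ((∑ i, |gradF f X w₁ i - α₀ i|) + 32 * L * diamOne W X) + Ce)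
        / (K : ℝ) ^ 2 := by
  have hne : Nonempty Ω := nonempty_of_isProbabilityMeasure μ
  have hn : 1 ≤ n := Fin.pos (j 0 hne.some)
  have hD₁ := diamOne_nonneg X hWc ⟨w₁, hw₁⟩
  have hD : 0 ≤ diamInf W X := diamInf_nonneg X
  have hG : ∀ k : ℕ, ∫ ω, gap (k + 1) ω ∂μ ≤ (1 - 2 / ((k : ℝ) + 2)) * ∫ ω, gap k ω ∂μ
      + 2 / ((k : ℝ) + 2)
        * (diamInf W X * ∫ ω, ∑ i, errF L f X w₁ α₀ j w (k + 1) ω i ∂μ + E k)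
      + 2 / ((k : ℝ) + 2) ^ 2 * (LX + LA * √((k : ℝ) + 2)) := by
    intro k
    have i2 := (h.integrable_errF hWc hW hw₁ L (k + 1)).const_mul (diamInf W X)
    have i3 : Integrable (fun ω => (1 - 2 / ((k : ℝ) + 2)) * gap k ω + 2 / ((k : ℝ) + 2)
        * (diamInf W X * ∑ i, errF L f X w₁ α₀ j w (k + 1) ω i + Z k ω)) μ :=
      ((hgap k).const_mul _).add ((i2.add (hZ k)).const_mul _)
    refine (integral_mono (hgap (k + 1)) (i3.add (integrable_const _)) (hstep k)).trans ?_
    simp only [Pi.add_apply]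
    rw [integral_add_const' i3, integral_mul_add_mul_add (hgap k) i2 (hZ k), integral_const_mul]
    have := mul_le_mul_of_nonneg_left (hZE k) (by positivity : 0 ≤ 2 / ((k : ℝ) + 2))
    linarith
  have hrate := rate_of_recursion (G := fun k => ∫ ω, gap k ω ∂μ) (a := n) (P := diamInf W X) (c₁ := 2 * L * diamOne W X)
    (by exact_mod_cast hn) hD (by positivity) hLX hLA hB hCe
    (u := fun k => ∫ ω, ∑ i, errF L f X w₁ α₀ j w k ω i ∂μ)
    (fun k => integral_nonneg fun ω => Finset.sum_nonneg fun i _ => errF_nonneg L k ω i)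
    (h.integral_errF_succ_le hWc hW hw₁ L hn) hE he hG hK
  have e0 : ∫ ω, ∑ i, errF L f X w₁ α₀ j w 0 ω i ∂μ = ∑ i, |gradF f X w₁ i - α₀ i| := by
    simp [errF, stale]
  simp only [e0] at hrate
  refine hrate.trans (add_le_add (add_le_add le_rfl (le_of_eq (by ring))) ?_)
  refine div_le_div_of_nonneg_right ?_ (by positivity)
  -- The recursion produces `2 L D₁` where the statement allows `32 L D₁`; this is the slack.
  have : 0 ≤ 2 * (n : ℝ) ^ 2 * diamInf W X * (30 * L * diamOne W X) := by positivity
  linarith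

theorem IsRun.variantOne_rate (h : IsRun μ ℱ W f X w₁ α₀ j α vf vg s w) (hWc : IsCompact W)
    (hW : Convex ℝ W) (hw₁ : w₁ ∈ W) {L : ℝ≥0} (hc : ∀ i, ConvexOn ℝ Set.univ (f i))
    (hd : ∀ i, Differentiable ℝ (f i)) (hL : ∀ i, LipschitzWith L (deriv (f i))) (hβ₀ : 0 < β₀)
    {g : EuclideanSpace ℝ (Fin m) → EReal} (hg : IsProperClosedConvex g)
    (hv : IsVariantOne g A β₀ vg w) {u : EuclideanSpace ℝ (Fin d)}
    (hu : IsSolution W (objective f X g A) u) {K : ℕ} (hK : 1 ≤ K) :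
    Integrable (fun ω => smoothedObjective f X g A (smoothParam β₀ K) (w (K + 1) ω)
        - (objective f X g A u).toReal) μ ∧
      ∫ ω, (smoothedObjective f X g A (smoothParam β₀ K) (w (K + 1) ω)
          - (objective f X g A u).toReal) ∂μ
        ≤ (2 * Metric.diam W ^ 2 * opNorm A ^ 2 / β₀) / √K
          + (8 * L * diamOne W X * diamInf W X
            + 2 / n * L * opNorm X ^ 2 * Metric.diam W ^ 2) / K
          + (2 * n ^ 2 * diamInf W X *
            ((∑ i, |gradF f X w₁ i - α₀ i|) + 32 * L * diamOne W X)) / (K : ℝ) ^ 2 := by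
  obtain ⟨r, hr, hval⟩ := exists_value_of_objective_ne_top hg.ne_bot hu.2.2
  have hgap : ∀ k, Integrable (fun ω =>
      smoothedObjective f X g A (smoothParam β₀ k) (w (k + 1) ω) - (smoothPart f X u + r)) μ :=
    fun k => (h.integrable_comp hWc hW hw₁ (continuous_smoothedObjective hd hβ₀ hg k) k).sub
      (integrable_const _)
  rw [hval]
  refine ⟨hgap K, ?_⟩
  have hrate := h.integral_gap_le hWc hW hw₁ (Z := fun _ _ => 0) (E := fun _ => 0) (e := fun _ => 0)
    (B := 0) (Ce := 0) (LX := L / n * (opNorm X ^ 2 * Metric.diam W ^ 2))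
    (LA := opNorm A ^ 2 * Metric.diam W ^ 2 / β₀) (by positivity) (by positivity) le_rfl le_rfl
    hgap (fun _ => integrable_const _) (fun _ => by simp) (fun _ => by simp) (fun _ => by simp)
    (fun k ω => by
      rw [add_zero]
      exact h.variantOne_step hWc hW hw₁ hc hd hL hβ₀ hg hv hu.1 hr k ω) hK
  refine hrate.trans ?_
  refine add_le_add (add_le_add (div_le_div_of_nonneg_right ?_ (by positivity)) (le_of_eq ?_))
    (le_of_eq ?_)
  · have : 0 ≤ opNorm A ^ 2 * Metric.diam W ^ 2 / β₀ := by positivity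
    rw [show 2 * Metric.diam W ^ 2 * opNorm A ^ 2 / β₀
      = 2 * (opNorm A ^ 2 * Metric.diam W ^ 2 / β₀) by ring]
    linarith
  · ring
  · rw [add_zero]

theorem IsRun.variantTwo_rate (h : IsRun μ ℱ W f X w₁ α₀ j α vf vg s w) (hWc : IsCompact W)
    (hW : Convex ℝ W) (hw₁ : w₁ ∈ W) {L : ℝ≥0} (hc : ∀ i, ConvexOn ℝ Set.univ (f i))
    (hd : ∀ i, Differentiable ℝ (f i)) (hL : ∀ i, LipschitzWith L (deriv (f i))) (hβ₀ : 0 < β₀)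
    {g : Fin m → ℝ → EReal} (hg : ∀ i, IsProperClosedConvex (g i)) {γ₀ : Fin m → ℝ}
    {l : ℕ → Ω → Fin m} {γ : ℕ → Ω → Fin m → ℝ} (hv : IsVariantTwo μ ℱ g A β₀ γ₀ l γ vg w)
    {u : EuclideanSpace ℝ (Fin d)} (hu : IsSolution W (objective f X (separable g) A) u)
    {K : ℕ} (hK : 1 ≤ K) :
    Integrable (fun ω => smoothedObjectiveSep f X g A (smoothParam β₀ K) (w (K + 1) ω)
        - (objective f X (separable g) A u).toReal) μ ∧
      ∫ ω, (smoothedObjectiveSep f X g A (smoothParam β₀ K) (w (K + 1) ω)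
          - (objective f X (separable g) A u).toReal) ∂μ
        ≤ ((2 * Metric.diam W ^ 2 * opNorm A ^ 2 + 10 * diamOne W A * diamInf W A) / β₀) / √K
          + (8 * L * diamOne W X * diamInf W X
            + 2 / n * L * opNorm X ^ 2 * Metric.diam W ^ 2) / K
          + (2 * n ^ 2 * diamInf W X *
              ((∑ i, |gradF f X w₁ i - α₀ i|) + 32 * L * diamOne W X)
            + 2 * m ^ 2 * diamInf W A * ∑ i, |gradG g A β₀ w₁ i - γ₀ i|) / (K : ℝ) ^ 2 := by
  have hne : Nonempty Ω := nonempty_of_isProbabilityMeasure μ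
  have hm : 1 ≤ m := Fin.pos (l 0 hne.some)
  have hbot : ∀ i x, g i x ≠ ⊥ := fun i => (hg i).ne_bot
  obtain ⟨R, hR, hval⟩ := exists_value_of_objective_ne_top (separable_ne_bot hbot) hu.2.2
  obtain ⟨r, hr, hsep⟩ := exists_values_of_separable hm hbot
    (z := mv A u) (by rw [hR]; exact EReal.coe_ne_top R)
  have hRr : R = 1 / (m : ℝ) * ∑ i, r i := by
    rw [hR] at hsep
    exact_mod_cast hsep
  rw [hval, hRr]
  have hD₁ := diamOne_nonneg A hWc ⟨w₁, hw₁⟩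
  have hD : 0 ≤ diamInf W A := diamInf_nonneg A
  have hgap : ∀ k, Integrable (fun ω =>
      smoothedObjectiveSep f X g A (smoothParam β₀ k) (w (k + 1) ω)
        - (smoothPart f X u + 1 / (m : ℝ) * ∑ i, r i)) μ :=
    fun k => (h.integrable_comp hWc hW hw₁ (continuous_smoothedObjectiveSep hd hβ₀ hg k) k).sub
      (integrable_const _)
  refine ⟨hgap K, ?_⟩
  set e₀ : ℝ := m * ∑ i, |gradG g A β₀ w₁ i - γ₀ i| with he₀
  have he₀0 : 0 ≤ e₀ := mul_nonneg (Nat.cast_nonneg m) (Finset.sum_nonneg fun i _ => abs_nonneg _)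
  have hY : ∀ k i, Integrable (fun ω => ((age l (k + 1) ω i / ((k : ℝ) + 2)) ^ 2
      - staleWeight m k ^ 2)
        * deriv (smoothed (g i) (smoothParam β₀ (k + 1))) (mv A u i) ^ 2) μ := by
    intro k i
    refine Integrable.mul_const (Integrable.sub ?_ (integrable_const _)) _
    simp_rw [div_pow]
    exact (integrable_age_sq hv.sampling (k + 1) i).div_const _
  -- The derivative at `u` is deterministic and factors out of the integral, so the sign is decided
  -- by the second moment of the age alone, whatever the size of the derivative.
  have hY0 : ∀ k, ∫ ω, ∑ i, ((age l (k + 1) ω i / ((k : ℝ) + 2)) ^ 2 - staleWeight m k ^ 2)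
      * deriv (smoothed (g i) (smoothParam β₀ (k + 1))) (mv A u i) ^ 2 ∂μ ≤ 0 := by
    intro k
    rw [integral_finsetSum _ fun i _ => hY k i]
    refine Finset.sum_nonpos fun i _ => ?_
    rw [integral_mul_const, integral_sub _ (integrable_const _)]
    · refine mul_nonpos_of_nonpos_of_nonneg ?_ (sq_nonneg _)
      have := hv.sampling.integral_age_div_sq_le k i
      simp only [integral_const, probReal_univ, one_smul]
      linarith
    · simp_rw [div_pow]
      exact (integrable_age_sq hv.sampling (k + 1) i).div_const _
  have i1 : ∀ k, Integrable (fun ω =>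
      diamInf W A * ∑ i, errG g A β₀ u w₁ γ₀ l w (k + 1) ω i) μ :=
    fun k => (hv.integrable_errG h hWc hW hw₁ hβ₀ hu.1 (k + 1)).const_mul _
  have i2 : ∀ k, Integrable (fun ω => 3 / 16 * (smoothParam β₀ (k + 1) / staleWeight m k)
      * ∑ i, ((age l (k + 1) ω i / ((k : ℝ) + 2)) ^ 2 - staleWeight m k ^ 2)
        * deriv (smoothed (g i) (smoothParam β₀ (k + 1))) (mv A u i) ^ 2) μ :=
    fun k => (integrable_finsetSum _ fun i _ => hY k i).const_mul _
  have hrate := h.integral_gap_le hWc hW hw₁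
    (Z := fun k ω => 1 / (m : ℝ) * (diamInf W A * ∑ i, errG g A β₀ u w₁ γ₀ l w (k + 1) ω i
      + staleWeight m k / smoothParam β₀ (k + 1) * (41 / 24 * (diamOne W A * diamInf W A))
      + 3 / 16 * (smoothParam β₀ (k + 1) / staleWeight m k)
        * ∑ i, ((age l (k + 1) ω i / ((k : ℝ) + 2)) ^ 2 - staleWeight m k ^ 2)
          * deriv (smoothed (g i) (smoothParam β₀ (k + 1))) (mv A u i) ^ 2))
    (E := fun k => 1 / (m : ℝ) * (diamInf W A
        * ∫ ω, ∑ i, errG g A β₀ u w₁ γ₀ l w (k + 1) ω i ∂μ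
      + staleWeight m k / smoothParam β₀ (k + 1) * (41 / 24 * (diamOne W A * diamInf W A))))
    (e := fun k => 2 * diamInf W A / m * (((k : ℝ) + 1) * ((1 - 1 / (m : ℝ)) ^ (k + 1) * e₀)))
    (B := (10 + 697 / 144) * (diamOne W A * diamInf W A / β₀)) (Ce := 2 * diamInf W A * m * e₀)
    (LX := L / n * (opNorm X ^ 2 * Metric.diam W ^ 2))
    (LA := opNorm A ^ 2 * Metric.diam W ^ 2 / β₀) (by positivity) (by positivity) (by positivity)
    (by positivity) hgap
    (fun k => (((i1 k).add (integrable_const _)).add (i2 k)).const_mul _)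
    (fun k => by
      have i3 : Integrable (fun ω => diamInf W A * ∑ i, errG g A β₀ u w₁ γ₀ l w (k + 1) ω i
          + staleWeight m k / smoothParam β₀ (k + 1)
            * (41 / 24 * (diamOne W A * diamInf W A))) μ := (i1 k).add (integrable_const _)
      rw [integral_const_mul, integral_add i3 (i2 k), integral_add_const' (i1 k),
        integral_const_mul, integral_const_mul]
      refine mul_le_mul_of_nonneg_left ?_ (by positivity)
      have h1 : 0 ≤ 3 / 16 * (smoothParam β₀ (k + 1) / staleWeight m k) := by
        have := smoothParam_pos hβ₀ (k + 1)
        have := staleWeight_pos hm k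
        positivity
      have := mul_nonpos_of_nonneg_of_nonpos h1 (hY0 k)
      linarith)
    (fun k => two_mul_succ_mul_error_le hm hβ₀ hD₁ hD k
      (hv.integral_errG_succ_le h hWc hW hw₁ hβ₀ hu.1 hm k))
    (fun K => sum_geometric_error_le hm hD he₀0 K)
    (fun k ω => h.variantTwo_step hWc hW hw₁ hc hd hL hβ₀ hg hv hu.1 hr (staleWeight_pos hm k)
      (min_le_left _ _) k ω) hK
  refine hrate.trans ?_
  refine add_le_add (add_le_add (div_le_div_of_nonneg_right ?_ (by positivity)) (le_of_eq ?_))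
    (le_of_eq ?_)
  · have h1 : 0 ≤ opNorm A ^ 2 * Metric.diam W ^ 2 / β₀ := by positivity
    have h2 : 0 ≤ diamOne W A * diamInf W A / β₀ := by positivity
    rw [show (2 * Metric.diam W ^ 2 * opNorm A ^ 2 + 10 * diamOne W A * diamInf W A) / β₀
      = 2 * (opNorm A ^ 2 * Metric.diam W ^ 2 / β₀) + 10 * (diamOne W A * diamInf W A / β₀) by ring]
    -- Here `2/3 · (10 + 697/144) < 10` and `4/3 ≤ 2`.
    linarith
  · ring
  · rw [he₀]; ring

end Rates

end HSagCgm

theorem mainTheorem1 {n m d : ℕ}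
    (W : Set (EuclideanSpace ℝ (Fin d))) (hW_compact : IsCompact W) (hW_convex : Convex ℝ W)
    (f : Fin n → ℝ → ℝ) (Lf : ℝ≥0)
    (hf_convex : ∀ i, ConvexOn ℝ Set.univ (f i))
    (hf_diff : ∀ i, Differentiable ℝ (f i))
    (hf_smooth : ∀ i, LipschitzWith Lf (deriv (f i)))
    (X : Matrix (Fin n) (Fin d) ℝ) (A : Matrix (Fin m) (Fin d) ℝ)
    (β₀ : ℝ) (hβ₀ : 0 < β₀)
    (w₁ : EuclideanSpace ℝ (Fin d)) (hw₁ : w₁ ∈ W) (α₀ : Fin n → ℝ)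
    {Ω : Type*} [mΩ : MeasurableSpace Ω] (μ : Measure Ω) [IsProbabilityMeasure μ]
    (ℱ : Filtration ℕ mΩ)
    (j : ℕ → Ω → Fin n) (α : ℕ → Ω → Fin n → ℝ)
    (vf vg s w : ℕ → Ω → EuclideanSpace ℝ (Fin d))
    (hrun : HSagCgm.IsRun μ ℱ W f X w₁ α₀ j α vf vg s w) :
    -- Variant 1
    (∀ (g : EuclideanSpace ℝ (Fin m) → EReal) (wstar : EuclideanSpace ℝ (Fin d)),
      HSagCgm.IsProperClosedConvex g →
      HSagCgm.IsSolution W (HSagCgm.objective f X g A) wstar →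
      HSagCgm.IsVariantOne g A β₀ vg w →
      ∀ k : ℕ, 2 ≤ k →
        let gap : Ω → ℝ := fun ω =>
          HSagCgm.smoothedObjective f X g A (HSagCgm.smoothParam β₀ k) (w (k + 1) ω)
            - (HSagCgm.objective f X g A wstar).toReal
        let C₁ : ℝ := 2 * Metric.diam W ^ 2 * HSagCgm.opNorm A ^ 2 / β₀
        let C₂ : ℝ := 8 * Lf * HSagCgm.diamOne W X * HSagCgm.diamInf W X
          + 2 / n * Lf * HSagCgm.opNorm X ^ 2 * Metric.diam W ^ 2
        let C₃ : ℝ := 2 * n ^ 2 * HSagCgm.diamInf W X *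
          ((∑ i, |HSagCgm.gradF f X w₁ i - α₀ i|) + 32 * Lf * HSagCgm.diamOne W X)
        Integrable gap μ ∧ ∫ ω, gap ω ∂μ ≤ C₁ / Real.sqrt k + C₂ / k + C₃ / k ^ 2) ∧
    -- Variant 2
    (∀ (g : Fin m → ℝ → EReal) (wstar : EuclideanSpace ℝ (Fin d)) (γ₀ : Fin m → ℝ)
      (l : ℕ → Ω → Fin m) (γ : ℕ → Ω → Fin m → ℝ),
      (∀ i, HSagCgm.IsProperClosedConvex (g i)) →
      HSagCgm.IsSolution W (HSagCgm.objective f X (HSagCgm.separable g) A) wstar →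
      HSagCgm.IsVariantTwo μ ℱ g A β₀ γ₀ l γ vg w →
      ∀ k : ℕ, 2 ≤ k →
        let gap : Ω → ℝ := fun ω =>
          HSagCgm.smoothedObjectiveSep f X g A (HSagCgm.smoothParam β₀ k) (w (k + 1) ω)
            - (HSagCgm.objective f X (HSagCgm.separable g) A wstar).toReal
        let C₁ : ℝ := (2 * Metric.diam W ^ 2 * HSagCgm.opNorm A ^ 2
          + 10 * HSagCgm.diamOne W A * HSagCgm.diamInf W A) / β₀
        let C₂ : ℝ := 8 * Lf * HSagCgm.diamOne W X * HSagCgm.diamInf W X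
          + 2 / n * Lf * HSagCgm.opNorm X ^ 2 * Metric.diam W ^ 2
        let C₃ : ℝ := 2 * n ^ 2 * HSagCgm.diamInf W X *
            ((∑ i, |HSagCgm.gradF f X w₁ i - α₀ i|) + 32 * Lf * HSagCgm.diamOne W X)
          + 2 * m ^ 2 * HSagCgm.diamInf W A * ∑ i, |HSagCgm.gradG g A β₀ w₁ i - γ₀ i|
        Integrable gap μ ∧ ∫ ω, gap ω ∂μ ≤ C₁ / Real.sqrt k + C₂ / k + C₃ / k ^ 2) := by
  refine ⟨fun g wstar hg hsol hv k hk => ?_, fun g wstar γ₀ l γ hg hsol hv k hk => ?_⟩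
  · exact hrun.variantOne_rate hW_compact hW_convex hw₁ hf_convex hf_diff hf_smooth hβ₀ hg hv hsol
      (one_le_two.trans hk)
  · exact hrun.variantTwo_rate hW_compact hW_convex hw₁ hf_convex hf_diff hf_smooth hβ₀ hg hv hsol
      (one_le_two.trans hk)
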